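/- Let $N\ge 1$, $w_0,\dots,w_{N-1}\in\mathbb C$, $\hbar\in\mathbb C^*$. On the universal covering $\mathbb C^{N-1}$ of $(\mathbb C^*)^{N-1}$ use the coordinates $s_i=\log u_i$, and write $x=e^t$; functions of $x$ may be multivalued, i.e. they are functions of $t=\log x\in\mathbb C$. Let $$W(u;x)=\sum_{i=1}^{N-1}(u_i+w_i\log u_i)+\frac{x}{u_1\cdots u_{N-1}}+w_0\log\frac{x}{u_1\cdots u_{N-1}} .$$ Fix $x_0=e^{t_0}$, and let $\Gamma$ be a Lefschetz thimble of $W(\cdot;x_0)$ for $\hbar$: a smooth injectively immersed $\gamma:\mathbb R^{N-1}\to\mathbb C^{N-1}$ for which $\gamma(0)=c$ is a non-degenerate critical point of $W(\cdot;x_0)$, $W(\gamma(y);x_0)=W(c;x_0)-\hbar\|y\|^2$ (so that the spheres $\|y\|^2=r$ are vanishing cycles in the fibres over the half-line $W(c;x_0)-\hbar r$, $r\ge0$), and such that the steepest descent field of $\mathrm{Re}(W(\cdot;x_0)/\hbar)$ for the metric $\sum|du_i/u_i|^2$ is everywhere tangent to $\Gamma$. With this fixed cycle $\Gamma$ put $$\mathcal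 I_{\mathbb{CP}^{N-1}_w}(x)=\int_\Gamma e^{\frac1\hbar W(u;x)}\prod_{i=1}^{N-1}\frac{du_i}{u_i},\qquad \hat x f=xf,\qquad \hat y f=\hbar x\frac{df}{dx}=\hbar\frac{df}{dt}.$$ (1) If $U\subset\mathbb C$ is open and the integral converges absolutely for every $t\in U$, then $\mathcal I_{\mathbb{CP}^{N-1}_w}$ is holomorphic in $t\in U$ and on $U$ $$\Big[\prod_{i=0}^{N-1}(\hat y-w_i)-\hat x\Big]\mathcal I_{\mathbb{CP}^{N-1}_w}=0 .$$ (2) Let $n\ge0$, let $l_1,\dots,l_n\ge1$ be integers with $l_1+\dots+l_n<N$, let $\lambda_1,\dots,\lambda_n\in\mathbb C$, and assume $\mathrm{Re}\,\hbar>0$. Let $D\subset\mathbb C$ be open and connected (possibly empty) with $D+\mathbb R=D$. (2a) Let $F$ be holomorphic on $D$ and equal to $\mathcal I_{\mathbb{CP}^{N-1}_w}$ on some non-empty open subset of $D$ on which the integral $\mathcal I_{\mathbb{CP}^{N-1}_w}$ converges absolutely (that is, $F$ is the analytic continuation of $\mathcal I_{\mathbb{CP}^{N-1}_w}$ to $D$).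 Suppose that for every $t\in D$ the Laplace integral $$\mathcal I_{X_{l;w,\lambda}}(x)=\int_{(0,\infty)^n}e^{-\frac1\hbar\sum_a(v_a+\lambda_a\log v_a)}\,F\big(t+\textstyle\sum_a l_a\log v_a\big)\,dv_1\cdots dv_n$$ (in terms of $x$: of the function $F$ at $v_1^{l_1}\cdots v_n^{l_n}x$) converges absolutely. Then $\mathcal I_{X_{l;w,\lambda}}$ is holomorphic in $t\in D$ and on $D$ $$\Big[\prod_{i=0}^{N-1}(\hat y-w_i)-\hat x\prod_{a=1}^n\prod_{m=1}^{l_a}(l_a\hat y-\lambda_a+m\hbar)\Big]\mathcal I_{X_{l;w,\lambda}}=0 .$$ (2b) Suppose that for every $t\in D$ the integral $$\int_{\Gamma\times(0,\infty)^n}e^{\frac1\hbar W_X(u,v;x)}\prod_{i=1}^{N-1}\frac{du_i}{u_i}\prod_{a=1}^n dv_a ,$$ $$W_X(u,v;x)=\sum_{i}(u_i+w_i\log u_i)-\sum_a(v_a+\lambda_a\log v_a)+\frac{v_1^{l_1}\cdots v_n^{l_n}}{u_1\cdots u_{N-1}}x+w_0\log\Big(\frac{v_1^{l_1}\cdots v_n^{l_n}}{u_1\cdots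 u_{N-1}}x\Big),$$ converges absolutely. Then on $D$ it equals the Laplace integral of (2a) with $F$ replaced by the integral $\mathcal I_{\mathbb{CP}^{N-1}_w}$ over $\Gamma$, it is holomorphic, and it satisfies the equation of (2a). -/

import Mathlib

open MeasureTheory

noncomputable section

namespace MirrorGKZ

/-! Logarithmic coordinates are used throughout: `s i = log (u i)` is a global coordinate on the
universal covering of `ℂ*`, so the universal covering of `(ℂ*)^k` is `Fin k → ℂ`, and the form
`du_i / u_i` is `ds_i`.  Likewise `x = exp t`, so that a multivalued function of `x` is a function
of `t`, and `x * d/dx` is `d/dt`.  The projective space has `N = k + 1` homogeneous coordinates. -/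

/-- The mirror potential of equivariant projective space,
`∑ (u_i + w_i log u_i) + x / (u_1 ⋯ u_k) + w_0 log (x / (u_1 ⋯ u_k))`,
at `u_i = exp (s i)`, `x = exp t`. -/
def cpPotential {k : ℕ} (w : Fin (k + 1) → ℂ) (t : ℂ) (s : Fin k → ℂ) : ℂ :=
  (∑ i, (Complex.exp (s i) + w i.succ * s i)) + Complex.exp (t - ∑ i, s i)
    + w 0 * (t - ∑ i, s i)

/-- The mirror potential of the complete intersection of degrees `l a`,
at `u_i = exp (s i)`, `v_a = exp (r a)`, `x = exp t`. -/
def ciPotential {k n : ℕ} (w : Fin (k + 1) → ℂ) (l : Fin n → ℕ) (lam : Fin n → ℂ) (t : ℂ)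
    (s : Fin k → ℂ) (r : Fin n → ℂ) : ℂ :=
  (∑ i, (Complex.exp (s i) + w i.succ * s i)) - (∑ a, (Complex.exp (r a) + lam a * r a))
    + Complex.exp (t + ∑ a, (l a : ℂ) * r a - ∑ i, s i)
    + w 0 * (t + ∑ a, (l a : ℂ) * r a - ∑ i, s i)

/-- The partial derivative `∂f/∂s_i`. -/
def partialDeriv {k : ℕ} (f : (Fin k → ℂ) → ℂ) (i : Fin k) (s : Fin k → ℂ) : ℂ :=
  fderiv ℂ f s (Pi.single i 1)

/-- `c` is a non-degenerate critical point of `f`. -/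
def IsNondegenerateCritical {k : ℕ} (f : (Fin k → ℂ) → ℂ) (c : Fin k → ℂ) : Prop :=
  (∀ i, partialDeriv f i c = 0) ∧
    (Matrix.of fun i j => partialDeriv (partialDeriv f i) j c).det ≠ 0

/-- `γ` parametrizes the Lefschetz thimble of the critical point `c` of `f` for the parameter `ħ`:
an injectively immersed `ℝ^k` through the non-degenerate critical point `c`, whose sphere
`‖y‖ ^ 2 = r` (the vanishing cycle) lies in the fibre of `f` over the point `f c - ħ r` of the
half-line that starts at `f c` in the direction `- ħ`, and which is swept out by steepest descent
lines: the descent direction of `Re (f / ħ)` for the metric `∑ |ds_i|^2 = ∑ |du_i / u_i|^2`,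
namely `- conj (∂f/∂s_i / ħ)`, is everywhere tangent to it. -/
structure IsLefschetzThimble {k : ℕ} (f : (Fin k → ℂ) → ℂ) (ħ : ℂ) (c : Fin k → ℂ)
    (γ : EuclideanSpace ℝ (Fin k) → (Fin k → ℂ)) : Prop where
  critical : IsNondegenerateCritical f c
  smooth : ContDiff ℝ ((⊤ : ℕ∞) : WithTop ℕ∞) γ
  injective : Function.Injective γ
  immersion : ∀ y, Function.Injective (fderiv ℝ γ y)
  base : γ 0 = c
  level : ∀ y, f (γ y) = f c - ħ * ((‖y‖ ^ 2 : ℝ) : ℂ)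
  descent : ∀ y, ∃ η : EuclideanSpace ℝ (Fin k), fderiv ℝ γ y η =
    fun i => - (starRingEnd ℂ) (partialDeriv f i (γ y) / ħ)

/-- The density of the pull-back by `γ` of the form `ds_1 ∧ ⋯ ∧ ds_k`. -/
def formDensity {k : ℕ} (γ : EuclideanSpace ℝ (Fin k) → (Fin k → ℂ))
    (y : EuclideanSpace ℝ (Fin k)) : ℂ :=
  (Matrix.of fun i j : Fin k => fderiv ℝ γ y (EuclideanSpace.single j (1 : ℝ)) i).det

/-- The pull-back by `γ` of `exp (W / ħ) du_1 / u_1 ⋯ du_k / u_k`. -/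
def cpIntegrand {k : ℕ} (w : Fin (k + 1) → ℂ) (ħ : ℂ)
    (γ : EuclideanSpace ℝ (Fin k) → (Fin k → ℂ)) (t : ℂ) (y : EuclideanSpace ℝ (Fin k)) : ℂ :=
  Complex.exp (cpPotential w t (γ y) / ħ) * formDensity γ y

/-- The oscillatory integral of projective space over the cycle parametrized by `γ`. -/
def cpIntegral {k : ℕ} (w : Fin (k + 1) → ℂ) (ħ : ℂ)
    (γ : EuclideanSpace ℝ (Fin k) → (Fin k → ℂ)) (t : ℂ) : ℂ :=
  ∫ y, cpIntegrand w ħ γ t y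

/-- The domain `(0, ∞)^n` of the variables `v_1, …, v_n`. -/
def orthant (n : ℕ) : Set (Fin n → ℝ) := {v | ∀ a, 0 < v a}

/-- The integrand of the Laplace transform of `F`, a function of `t = log x`;
the argument `v_1 ^ l_1 ⋯ v_n ^ l_n * x` of `F` has logarithm `t + ∑ l_a log v_a`. -/
def laplaceIntegrand {n : ℕ} (l : Fin n → ℕ) (lam : Fin n → ℂ) (ħ : ℂ) (F : ℂ → ℂ) (t : ℂ)
    (v : Fin n → ℝ) : ℂ :=
  Complex.exp (-(∑ a, ((v a : ℂ) + lam a * (Real.log (v a) : ℂ))) / ħ)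
    * F (t + ∑ a, (l a : ℂ) * (Real.log (v a) : ℂ))

/-- The oscillatory integral of the complete intersection, as a Laplace transform. -/
def ciLaplace {n : ℕ} (l : Fin n → ℕ) (lam : Fin n → ℂ) (ħ : ℂ) (F : ℂ → ℂ) (t : ℂ) : ℂ :=
  ∫ v in orthant n, laplaceIntegrand l lam ħ F t v

/-- The pull-back by `γ × id` of `exp (W_X / ħ) du_1 / u_1 ⋯ du_k / u_k dv_1 ⋯ dv_n`. -/
def ciIntegrand {k n : ℕ} (w : Fin (k + 1) → ℂ) (l : Fin n → ℕ) (lam : Fin n → ℂ) (ħ : ℂ)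
    (γ : EuclideanSpace ℝ (Fin k) → (Fin k → ℂ)) (t : ℂ)
    (p : EuclideanSpace ℝ (Fin k) × (Fin n → ℝ)) : ℂ :=
  Complex.exp (ciPotential w l lam t (γ p.1) (fun a => (Real.log (p.2 a) : ℂ)) / ħ)
    * formDensity γ p.1

/-- The oscillatory integral of the complete intersection over `Γ × (0, ∞)^n`. -/
def ciIntegral {k n : ℕ} (w : Fin (k + 1) → ℂ) (l : Fin n → ℕ) (lam : Fin n → ℂ) (ħ : ℂ)
    (γ : EuclideanSpace ℝ (Fin k) → (Fin k → ℂ)) (t : ℂ) : ℂ :=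
  ∫ p in (Set.univ ×ˢ orthant n), ciIntegrand w l lam ħ γ t p

/-- The operator `ŷ = ħ x d/dx = ħ d/dt`. -/
def yHat (ħ : ℂ) (F : ℂ → ℂ) : ℂ → ℂ := fun t => ħ * deriv F t

/-- The operator `x̂` of multiplication by `x = exp t`. -/
def xHat (F : ℂ → ℂ) : ℂ → ℂ := fun t => Complex.exp t * F t

/-- Composition of a list of operators, applied to a function. -/
def opProd (L : List ((ℂ → ℂ) → (ℂ → ℂ))) (F : ℂ → ℂ) : ℂ → ℂ :=
  L.foldr (fun A G => A G) F

/-- `∏_{i=0}^{k} (ŷ - w_i)`. -/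
def wProd {k : ℕ} (w : Fin (k + 1) → ℂ) (ħ : ℂ) : (ℂ → ℂ) → (ℂ → ℂ) :=
  opProd ((List.finRange (k + 1)).map fun i F t => yHat ħ F t - w i * F t)

/-- `∏_{a=1}^{n} ∏_{m=1}^{l_a} (l_a ŷ - λ_a + m ħ)`. -/
def lamProd {n : ℕ} (l : Fin n → ℕ) (lam : Fin n → ℂ) (ħ : ℂ) : (ℂ → ℂ) → (ℂ → ℂ) :=
  opProd ((List.finRange n).flatMap fun a => (List.range (l a)).map fun m F t =>
    (l a : ℂ) * yHat ħ F t + (-lam a + ((m : ℂ) + 1) * ħ) * F t)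

/-- The GKZ operator `∏ (ŷ - w_i) - x̂` of projective space. -/
def cpGKZ {k : ℕ} (w : Fin (k + 1) → ℂ) (ħ : ℂ) (F : ℂ → ℂ) : ℂ → ℂ :=
  fun t => wProd w ħ F t - xHat F t

/-- The GKZ operator `∏ (ŷ - w_i) - x̂ ∏ ∏ (l_a ŷ - λ_a + m ħ)` of the complete intersection. -/
def ciGKZ {k n : ℕ} (w : Fin (k + 1) → ℂ) (l : Fin n → ℕ) (lam : Fin n → ℂ) (ħ : ℂ)
    (F : ℂ → ℂ) : ℂ → ℂ :=
  fun t => wProd w ħ F t - xHat (lamProd l lam ħ F) t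

end MirrorGKZ

end

/-! Along the thimble `e ^ (W / ħ)` is `e ^ (W c / ħ) e ^ (-‖y‖²)`, and integration by parts turns
the multiplication by `u_i` into `ŷ - w_i` and that by `x / (u_1 ⋯ u_k)` into `ŷ - w_0`; the
product of all these monomials is `x`. Only convergence of the integral is assumed, so the
boundary terms have to be controlled: steepest descent and the maximum principle show that the
`u_i` and `x / (u_1 ⋯ u_k)` grow at most like `‖y‖²` along the thimble, and a factor
`e ^ (-ε ‖y‖²)`, removed at the end, makes all integrals that occur converge.

In the Laplace integral, integration by parts in `v_a` turns `∏∏ (l_a ŷ - λ_a + m ħ)` into the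
multiplication by `∏ v_a ^ l_a`, which is the factor that the equation of `F` at the point
`t + ∑ l_a log v_a` produces. Differentiation under the integral sign needs domination of the
integrand near a given `t`. Interior estimates for the differential equation bound `F` at a point
by the integral of `|F|` over a horizontal segment nearby, at the cost of a factor
`e ^ (C |x| ^ (1 / (k + 1)))`. At `x ∏ v_a ^ l_a` this factor is subexponential in `v` because
`∑ l_a < k + 1`, and a shift of the integration variables `log v_a` gains an exponentially
decaying factor that absorbs it. -/

namespace MirrorGKZ

open Filter Topology Metric

/-! ### First-order operators with constant coefficients -/

/-- The operator `α d/dt + β`; every factor of the two GKZ operators is of this form. -/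
noncomputable def firstOrder (α β : ℂ) (F : ℂ → ℂ) : ℂ → ℂ := fun t => α * deriv F t + β * F t

/-- The composition of the operators `α d/dt + β` for the pairs `(α, β)` of a list. -/
noncomputable def firstOrderProd : List (ℂ × ℂ) → (ℂ → ℂ) → (ℂ → ℂ)
  | [], F => F
  | p :: L, F => firstOrder p.1 p.2 (firstOrderProd L F)

theorem firstOrderProd_append (L M : List (ℂ × ℂ)) (F : ℂ → ℂ) :
    firstOrderProd (L ++ M) F = firstOrderProd L (firstOrderProd M F) := by
  induction L with
  | nil => rfl
  | cons p L ih => simp [firstOrderProd, ih]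

theorem opProd_map_eq_firstOrderProd {ι : Type*} (A : ι → (ℂ → ℂ) → (ℂ → ℂ)) (p : ι → ℂ × ℂ)
    (hA : ∀ i F, A i F = firstOrder (p i).1 (p i).2 F) (L : List ι) (F : ℂ → ℂ) :
    opProd (L.map A) F = firstOrderProd (L.map p) F := by
  induction L with
  | nil => rfl
  | cons i L ih => exact (congrArg (A i) ih).trans (hA i _)

theorem wProd_eq_firstOrderProd {k : ℕ} (w : Fin (k + 1) → ℂ) (ħ : ℂ) (F : ℂ → ℂ) :
    wProd w ħ F = firstOrderProd ((List.finRange (k + 1)).map fun i => (ħ, -w i)) F :=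
  opProd_map_eq_firstOrderProd _ _
    (fun i F => by funext t; simp only [firstOrder, yHat]; ring) _ F

theorem lamProd_eq_firstOrderProd {n : ℕ} (l : Fin n → ℕ) (lam : Fin n → ℂ) (ħ : ℂ) (F : ℂ → ℂ) :
    lamProd l lam ħ F = firstOrderProd ((List.finRange n).flatMap fun a =>
      (List.range (l a)).map fun m : ℕ => ((l a : ℂ) * ħ, -lam a + ((m : ℂ) + 1) * ħ)) F := by
  -- `lamProd` maps over `List.range (l a)` coerced to a list of complex numbers
  have coe_range (L : List ℕ) : (do let m ← L; pure (m : ℂ)) = L.map fun m : ℕ => (m : ℂ) :=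
    List.flatMap_pure_eq_map _ L
  unfold lamProd
  simp only [coe_range, List.map_map]
  induction List.finRange n with
  | nil => rfl
  | cons a L ih =>
    have opProd_append (M N : List ((ℂ → ℂ) → (ℂ → ℂ))) :
        opProd (M ++ N) F = opProd M (opProd N F) := List.foldr_append
    rw [List.flatMap_cons, List.flatMap_cons, firstOrderProd_append, opProd_append, ih]
    refine opProd_map_eq_firstOrderProd _ _ (fun m G => ?_) _ _
    funext t
    simp only [Function.comp_apply, firstOrder, yHat]
    ring

section

variable {D : Set ℂ} {F G : ℂ → ℂ}

theorem differentiableOn_firstOrder (hD : IsOpen D) (α β : ℂ) (hF : DifferentiableOn ℂ F D) :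
    DifferentiableOn ℂ (firstOrder α β F) D :=
  ((hF.deriv hD).const_mul α).add (hF.const_mul β)

theorem differentiableOn_firstOrderProd (hD : IsOpen D) (L : List (ℂ × ℂ))
    (hF : DifferentiableOn ℂ F D) : DifferentiableOn ℂ (firstOrderProd L F) D := by
  induction L with
  | nil => exact hF
  | cons p L ih => exact differentiableOn_firstOrder hD _ _ ih

theorem firstOrder_congr (hD : IsOpen D) (α β : ℂ) (h : Set.EqOn F G D) :
    Set.EqOn (firstOrder α β F) (firstOrder α β G) D := by
  intro t ht
  have hFG : F =ᶠ[𝓝 t] G := h.eventuallyEq_of_mem (hD.mem_nhds ht)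
  simp only [firstOrder, hFG.deriv_eq, h ht]

theorem firstOrderProd_congr (hD : IsOpen D) (L : List (ℂ × ℂ)) (h : Set.EqOn F G D) :
    Set.EqOn (firstOrderProd L F) (firstOrderProd L G) D := by
  induction L with
  | nil => exact h
  | cons p L ih => exact firstOrder_congr hD _ _ ih

theorem firstOrder_comm (hD : IsOpen D) (α β α' β' : ℂ) (hF : DifferentiableOn ℂ F D) :
    Set.EqOn (firstOrder α β (firstOrder α' β' F)) (firstOrder α' β' (firstOrder α β F)) D := by
  intro t ht
  have hF_t : DifferentiableAt ℂ F t := hF.differentiableAt (hD.mem_nhds ht)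
  have hF'_t : DifferentiableAt ℂ (deriv F) t := (hF.deriv hD).differentiableAt (hD.mem_nhds ht)
  have deriv_firstOrder (a b : ℂ) :
      deriv (firstOrder a b F) t = a * deriv (deriv F) t + b * deriv F t :=
    ((hF'_t.hasDerivAt.const_mul a).add (hF_t.hasDerivAt.const_mul b)).deriv
  rw [firstOrder.eq_def α, firstOrder.eq_def α' β' (firstOrder α β F)]
  simp only [deriv_firstOrder]
  simp only [firstOrder]
  ring

theorem firstOrderProd_perm (hD : IsOpen D) {L M : List (ℂ × ℂ)} (h : L.Perm M)
    (hF : DifferentiableOn ℂ F D) : Set.EqOn (firstOrderProd L F) (firstOrderProd M F) D := by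
  induction h with
  | nil => exact fun t _ => rfl
  | cons p _ ih => exact firstOrder_congr hD _ _ ih
  | swap p q L => exact firstOrder_comm hD _ _ _ _ (differentiableOn_firstOrderProd hD L hF)
  | trans _ _ ih₁ ih₂ => exact ih₁.trans ih₂

end

theorem firstOrder_const_mul_translate (α β b a : ℂ) (F : ℂ → ℂ) :
    firstOrder α β (fun t => b * F (t + a)) = fun t => b * firstOrder α β F (t + a) := by
  funext t
  simp only [firstOrder, deriv_const_mul_field, deriv_comp_add_const]
  ring

theorem firstOrderProd_const_mul_translate (L : List (ℂ × ℂ)) (b a : ℂ) (F : ℂ → ℂ) :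
    firstOrderProd L (fun t => b * F (t + a)) = fun t => b * firstOrderProd L F (t + a) := by
  induction L with
  | nil => rfl
  | cons p L ih => simp only [firstOrderProd, ih, firstOrder_const_mul_translate]

/-! ### Holomorphic families with locally uniform domination -/

/-- A family of functions of `y`, holomorphic in the parameter `t ∈ U` and locally uniformly in `t`
dominated by integrable functions: the hypothesis under which one differentiates under the integral
sign any number of times. -/
structure LocDominated {α : Type*} [MeasurableSpace α] (μ : Measure α) (U : Set ℂ)
    (f : ℂ → α → ℂ) : Prop where
  holo : ∀ y, DifferentiableOn ℂ (fun t => f t y) U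
  meas : ∀ t ∈ U, AEStronglyMeasurable (f t) μ
  bound : ∀ t ∈ U, ∃ δ > 0, ball t δ ⊆ U ∧ ∃ b : α → ℝ, Integrable b μ ∧
    ∀ t' ∈ ball t δ, ∀ y, ‖f t' y‖ ≤ b y

namespace LocDominated

variable {α : Type*} [MeasurableSpace α] {μ : Measure α} {U : Set ℂ} {f g : ℂ → α → ℂ}

theorem integrable (hf : LocDominated μ U f) {t : ℂ} (ht : t ∈ U) : Integrable (f t) μ := by
  obtain ⟨δ, hδ, -, b, hb, hle⟩ := hf.bound t ht
  exact hb.mono' (hf.meas t ht) (Eventually.of_forall (hle t (mem_ball_self hδ)))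

theorem const_mul (hf : LocDominated μ U f) (a : ℂ) :
    LocDominated μ U (fun t y => a * f t y) where
  holo y := (hf.holo y).const_mul a
  meas t ht := (hf.meas t ht).const_mul a
  bound t ht := by
    obtain ⟨δ, hδ, hs, b, hb, hle⟩ := hf.bound t ht
    refine ⟨δ, hδ, hs, fun y => ‖a‖ * b y, hb.const_mul _, fun t' ht' y => ?_⟩
    rw [norm_mul]
    exact mul_le_mul_of_nonneg_left (hle t' ht' y) (norm_nonneg a)

theorem add (hf : LocDominated μ U f) (hg : LocDominated μ U g) :
    LocDominated μ U (fun t y => f t y + g t y) where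
  holo y := (hf.holo y).add (hg.holo y)
  meas t ht := (hf.meas t ht).add (hg.meas t ht)
  bound t ht := by
    obtain ⟨δ, hδ, hs, b, hb, hle⟩ := hf.bound t ht
    obtain ⟨δ', hδ', -, b', hb', hle'⟩ := hg.bound t ht
    refine ⟨min δ δ', lt_min hδ hδ', (ball_subset_ball (min_le_left _ _)).trans hs,
      fun y => b y + b' y, hb.add hb', fun t' ht' y => (norm_add_le _ _).trans ?_⟩
    exact add_le_add (hle t' (ball_subset_ball (min_le_left _ _) ht') y)
      (hle' t' (ball_subset_ball (min_le_right _ _) ht') y)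

theorem bdd_mul (hf : LocDominated μ U f) {m : α → ℂ} (hm : AEStronglyMeasurable m μ) {C : ℝ}
    (hC : ∀ y, ‖m y‖ ≤ C) : LocDominated μ U (fun t y => m y * f t y) where
  holo y := (hf.holo y).const_mul (m y)
  meas t ht := hm.mul (hf.meas t ht)
  bound t ht := by
    obtain ⟨δ, hδ, hs, b, hb, hle⟩ := hf.bound t ht
    refine ⟨δ, hδ, hs, fun y => C * b y, hb.const_mul _, fun t' ht' y => ?_⟩
    rw [norm_mul]
    exact mul_le_mul (hC y) (hle t' ht' y) (norm_nonneg _) ((norm_nonneg _).trans (hC y))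

theorem exists_norm_deriv_le (hf : LocDominated μ U f) {t : ℂ} (ht : t ∈ U) :
    ∃ δ > 0, ball t δ ⊆ U ∧ ∃ b : α → ℝ, Integrable b μ ∧
      ∀ t' ∈ ball t δ, ∀ y, ‖deriv (fun t => f t y) t'‖ ≤ b y := by
  obtain ⟨δ, hδ, hs, b, hb, hle⟩ := hf.bound t ht
  have hδ₄ : (0 : ℝ) < δ / 4 := by positivity
  refine ⟨δ / 2, half_pos hδ, (ball_subset_ball (by linarith)).trans hs, fun y => b y / (δ / 4),
    hb.div_const _, fun t' ht' y => ?_⟩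
  have hsub : closedBall t' (δ / 4) ⊆ ball t δ :=
    closedBall_subset_ball' (by linarith [mem_ball.mp ht'])
  refine Complex.norm_deriv_le_of_forall_mem_sphere_norm_le hδ₄ ?_
    fun z hz => hle z (hsub (sphere_subset_closedBall hz)) y
  apply DifferentiableOn.diffContOnCl
  rw [closure_ball _ hδ₄.ne']
  exact (hf.holo y).mono (hsub.trans hs)

theorem aestronglyMeasurable_deriv (hf : LocDominated μ U f) (hU : IsOpen U) {t : ℂ}
    (ht : t ∈ U) : AEStronglyMeasurable (fun y => deriv (fun t => f t y) t) μ := by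
  classical
  refine aestronglyMeasurable_of_tendsto_ae (𝓝[≠] (0 : ℂ))
    (f := fun h y => if t + h ∈ U then h⁻¹ • (f (t + h) y - f t y) else 0) (fun h => ?_)
    (Eventually.of_forall fun y => ?_)
  · by_cases hmem : t + h ∈ U
    · simp only [hmem, if_true]
      exact ((hf.meas _ hmem).sub (hf.meas t ht)).const_smul h⁻¹
    · simp only [hmem, if_false]
      exact aestronglyMeasurable_const
  · have hslope := ((hf.holo y).differentiableAt (hU.mem_nhds ht)).hasDerivAt.tendsto_slope_zero
    have hnear : ∀ᶠ h in 𝓝[≠] (0 : ℂ), t + h ∈ U :=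
      ((continuous_const_add t).tendsto' 0 t (add_zero t)).eventually (hU.mem_nhds ht)
        |>.filter_mono nhdsWithin_le_nhds
    exact hslope.congr' (hnear.mono fun h hh => (if_pos hh).symm)

theorem deriv (hf : LocDominated μ U f) (hU : IsOpen U) :
    LocDominated μ U (fun t y => deriv (fun t => f t y) t) where
  holo y := (hf.holo y).deriv hU
  meas _ ht := hf.aestronglyMeasurable_deriv hU ht
  bound _ ht := hf.exists_norm_deriv_le ht

theorem hasDerivAt_integral (hf : LocDominated μ U f) (hU : IsOpen U) {t : ℂ} (ht : t ∈ U) :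
    HasDerivAt (fun t => ∫ y, f t y ∂μ) (∫ y, _root_.deriv (fun t => f t y) t ∂μ) t := by
  obtain ⟨δ, hδ, hs, b, hb, hle⟩ := hf.exists_norm_deriv_le ht
  refine (hasDerivAt_integral_of_dominated_loc_of_deriv_le (ball_mem_nhds t hδ)
    (eventually_of_mem (hU.mem_nhds ht) fun t' ht' => hf.meas t' ht') (hf.integrable ht)
    (F' := fun t y => _root_.deriv (fun t => f t y) t)
    (hf.aestronglyMeasurable_deriv hU ht) (Eventually.of_forall fun y t' ht' => hle t' ht' y) hb
    (Eventually.of_forall fun y t' ht' => ?_)).2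
  exact ((hf.holo y).differentiableAt (hU.mem_nhds (hs ht'))).hasDerivAt

theorem differentiableOn_integral (hf : LocDominated μ U f) (hU : IsOpen U) :
    DifferentiableOn ℂ (fun t => ∫ y, f t y ∂μ) U :=
  fun _ ht => (hf.hasDerivAt_integral hU ht).differentiableAt.differentiableWithinAt

theorem firstOrder (hf : LocDominated μ U f) (hU : IsOpen U) (a b : ℂ) :
    LocDominated μ U (fun t y => firstOrder a b (fun t => f t y) t) :=
  ((hf.deriv hU).const_mul a).add (hf.const_mul b)

theorem firstOrder_integral (hf : LocDominated μ U f) (hU : IsOpen U) (a b : ℂ) {t : ℂ}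
    (ht : t ∈ U) : MirrorGKZ.firstOrder a b (fun t => ∫ y, f t y ∂μ) t =
      ∫ y, MirrorGKZ.firstOrder a b (fun t => f t y) t ∂μ := by
  simp only [MirrorGKZ.firstOrder, (hf.hasDerivAt_integral hU ht).deriv]
  rw [integral_add (((hf.deriv hU).integrable ht).const_mul a) ((hf.integrable ht).const_mul b),
    integral_const_mul, integral_const_mul]

theorem firstOrderProd (hf : LocDominated μ U f) (hU : IsOpen U) (L : List (ℂ × ℂ)) :
    LocDominated μ U (fun t y => firstOrderProd L (fun t => f t y) t) := by
  induction L with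
  | nil => exact hf
  | cons p L ih => exact ih.firstOrder hU p.1 p.2

theorem firstOrderProd_integral (hf : LocDominated μ U f) (hU : IsOpen U) (L : List (ℂ × ℂ)) :
    Set.EqOn (MirrorGKZ.firstOrderProd L (fun t => ∫ y, f t y ∂μ))
      (fun t => ∫ y, MirrorGKZ.firstOrderProd L (fun t => f t y) t ∂μ) U := by
  induction L with
  | nil => exact fun t _ => rfl
  | cons p L ih =>
    intro t ht
    exact (firstOrder_congr hU p.1 p.2 ih ht).trans
      ((hf.firstOrderProd hU L).firstOrder_integral hU p.1 p.2 ht)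

end LocDominated

section BoundedMultipliers

variable {α : Type*} [MeasurableSpace α] {μ : Measure α} {C : ℝ} {κ : ℂ}

theorem integrable_norm_sub_mul {m : α → ℂ} (hm : AEStronglyMeasurable m μ)
    (hC : ∀ y, ‖m y‖ ≤ C) (κ : ℂ) {b : α → ℝ} (hb : Integrable b μ) :
    Integrable (fun y => ‖m y - κ‖ * b y) μ :=
  hb.bdd_mul (hm.sub aestronglyMeasurable_const).norm (c := C + ‖κ‖)
    (Eventually.of_forall fun y => by
      rw [norm_norm]; exact (norm_sub_le _ _).trans (by linarith [hC y]))

variable {ι : Type*} {φ : Filter ι} [φ.IsCountablyGenerated] {m : ι → α → ℂ}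

theorem tendsto_integral_norm_sub_mul (hm : ∀ᶠ i in φ, AEStronglyMeasurable (m i) μ)
    (hC : ∀ᶠ i in φ, ∀ y, ‖m i y‖ ≤ C) (hκ : ∀ y, Tendsto (fun i => m i y) φ (𝓝 κ))
    {b : α → ℝ} (hb : Integrable b μ) :
    Tendsto (fun i => ∫ y, ‖m i y - κ‖ * b y ∂μ) φ (𝓝 0) := by
  rw [← integral_zero α ℝ (μ := μ)]
  refine tendsto_integral_filter_of_dominated_convergence (fun y => (C + ‖κ‖) * ‖b y‖) ?_ ?_
    (hb.norm.const_mul _) (Eventually.of_forall fun y => ?_)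
  · filter_upwards [hm] with i hmi
    exact (hmi.sub aestronglyMeasurable_const).norm.mul hb.aestronglyMeasurable
  · filter_upwards [hC] with i hCi
    refine Eventually.of_forall fun y => ?_
    rw [norm_mul, norm_norm]
    exact mul_le_mul_of_nonneg_right ((norm_sub_le _ _).trans (by linarith [hCi y]))
      (norm_nonneg _)
  · simpa only [sub_self, norm_zero, zero_mul] using
      (((hκ y).sub (tendsto_const_nhds (x := κ))).norm).mul_const (b y)

theorem LocDominated.tendstoLocallyUniformlyOn_integral_mul {U : Set ℂ} {f : ℂ → α → ℂ}
    (hf : LocDominated μ U f) (hm : ∀ᶠ i in φ, AEStronglyMeasurable (m i) μ)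
    (hC : ∀ᶠ i in φ, ∀ y, ‖m i y‖ ≤ C) (hκ : ∀ y, Tendsto (fun i => m i y) φ (𝓝 κ)) :
    TendstoLocallyUniformlyOn (fun i t => ∫ y, m i y * f t y ∂μ)
      (fun t => κ * ∫ y, f t y ∂μ) φ U := by
  rw [Metric.tendstoLocallyUniformlyOn_iff]
  intro ε hε t ht
  obtain ⟨δ, hδ, hs, b, hb, hle⟩ := hf.bound t ht
  refine ⟨ball t δ, mem_nhdsWithin_of_mem_nhds (ball_mem_nhds t hδ), ?_⟩
  filter_upwards [hm, hC, (tendsto_integral_norm_sub_mul hm hC hκ hb).eventually (gt_mem_nhds hε)]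
    with i hmi hCi hi t' ht'
  rw [dist_comm, dist_eq_norm, ← integral_const_mul,
    ← integral_sub ((hf.bdd_mul hmi hCi).integrable (hs ht'))
      ((hf.integrable (hs ht')).const_mul κ)]
  refine (norm_integral_le_of_norm_le (integrable_norm_sub_mul hmi hCi κ hb)
    (Eventually.of_forall fun y => ?_)).trans_lt hi
  rw [← sub_mul, norm_mul]
  exact mul_le_mul_of_nonneg_left (hle t' ht' y) (norm_nonneg _)

end BoundedMultipliers

/-! ### Stokes' theorem for a form `dφ_1 ∧ ⋯ ∧ dφ_k` -/

section Stokes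

variable {E F : Type*} [NormedAddCommGroup E] [NormedSpace ℝ E] [NormedAddCommGroup F]
  [NormedSpace ℝ F]

theorem fderiv_fderiv_apply_comm {g : E → F} (hg : ContDiff ℝ 2 g) (y u v : E) :
    fderiv ℝ (fun y => fderiv ℝ g y u) y v = fderiv ℝ (fun y => fderiv ℝ g y v) y u := by
  have hdiff : DifferentiableAt ℝ (fderiv ℝ g) y :=
    (hg.fderiv_right (m := 1) (by norm_num)).differentiable one_ne_zero y
  have hsymm : IsSymmSndFDerivAt ℝ g y :=
    hg.contDiffAt.isSymmSndFDerivAt (by rw [minSmoothness_of_isRCLikeNormedField])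
  have fderiv_apply_eq (u v : E) :
      fderiv ℝ (fun y => fderiv ℝ g y u) y v = fderiv ℝ (fderiv ℝ g) y v u := by
    rw [fderiv_clm_apply hdiff (differentiableAt_const u)]
    simp
  rw [fderiv_apply_eq, fderiv_apply_eq]
  exact hsymm v u

variable {ι : Type*} [Fintype ι] [DecidableEq ι]

/-- The factor that multiplies `∂φ_{i₀} / ∂v_{σ i₀}` in the term of the permutation `σ` of the
Leibniz expansion of the Jacobian determinant of `φ` in the directions `v`. -/
noncomputable def leibnizCofactor (φ : ι → E → ℂ) (v : ι → E) (i₀ : ι) (σ : Equiv.Perm ι)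
    (y : E) : ℂ :=
  ∏ i ∈ Finset.univ.erase i₀, fderiv ℝ (φ i) y (v (σ i))

theorem det_fderiv_eq_sum_leibnizCofactor (φ : ι → E → ℂ) (v : ι → E) (i₀ : ι) (y : E) :
    (Matrix.of fun i j => fderiv ℝ (φ i) y (v j)).det = ∑ σ : Equiv.Perm ι,
      ((Equiv.Perm.sign σ : ℤ) : ℂ) *
        (leibnizCofactor φ v i₀ σ y * fderiv ℝ (φ i₀) y (v (σ i₀))) := by
  rw [← Matrix.det_transpose, Matrix.det_apply']
  refine Finset.sum_congr rfl fun σ _ => ?_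
  rw [← Finset.prod_erase_mul _ _ (Finset.mem_univ i₀)]
  rfl

variable {φ : ι → E → ℂ}

theorem contDiff_fderiv_apply {g : E → F} (hg : ContDiff ℝ 2 g) (u : E) :
    ContDiff ℝ 1 fun y => fderiv ℝ g y u :=
  (hg.fderiv_right (by norm_num)).clm_apply contDiff_const

theorem contDiff_leibnizCofactor (hφ : ∀ i, ContDiff ℝ 2 (φ i)) (v : ι → E) (i₀ : ι)
    (σ : Equiv.Perm ι) : ContDiff ℝ 1 (leibnizCofactor φ v i₀ σ) :=
  contDiff_prod fun i _ => contDiff_fderiv_apply (hφ i) (v (σ i))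

theorem fderiv_leibnizCofactor (hφ : ∀ i, ContDiff ℝ 2 (φ i)) (v : ι → E) (i₀ : ι)
    (σ : Equiv.Perm ι) (y u : E) :
    fderiv ℝ (leibnizCofactor φ v i₀ σ) y u = ∑ m ∈ Finset.univ.erase i₀,
      (∏ j ∈ (Finset.univ.erase i₀).erase m, fderiv ℝ (φ j) y (v (σ j))) *
        fderiv ℝ (fun y => fderiv ℝ (φ m) y (v (σ m))) y u := by
  have hprod := fderiv_finsetProd (u := Finset.univ.erase i₀) (x := y)
    (g := fun i y => fderiv ℝ (φ i) y (v (σ i)))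
    fun i _ => (contDiff_fderiv_apply (hφ i) (v (σ i))).differentiable one_ne_zero y
  unfold leibnizCofactor
  simp only [hprod, sum_apply, smul_apply, smul_eq_mul]

/- The cofactors form a divergence-free field: the terms of `σ` and of `σ` composed with the
transposition of `i₀` and `m` cancel by the symmetry of the second derivatives of `φ_m`. -/
theorem sum_sign_mul_fderiv_leibnizCofactor (hφ : ∀ i, ContDiff ℝ 2 (φ i)) (v : ι → E) (i₀ : ι)
    (y : E) : ∑ σ : Equiv.Perm ι, ((Equiv.Perm.sign σ : ℤ) : ℂ) *
      fderiv ℝ (leibnizCofactor φ v i₀ σ) y (v (σ i₀)) = 0 := by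
  simp only [fderiv_leibnizCofactor hφ, Finset.mul_sum]
  rw [Finset.sum_comm]
  refine Finset.sum_eq_zero fun m hm => ?_
  have hm₀ : m ≠ i₀ := Finset.ne_of_mem_erase hm
  refine Finset.sum_involution (fun σ _ => σ * Equiv.swap i₀ m) (fun σ _ => ?_)
    (fun σ _ _ hfix => ?_) (fun σ _ => Finset.mem_univ _) (fun σ _ => ?_)
  · have hprod : ∏ j ∈ (Finset.univ.erase i₀).erase m,
        fderiv ℝ (φ j) y (v ((σ * Equiv.swap i₀ m) j)) =
        ∏ j ∈ (Finset.univ.erase i₀).erase m, fderiv ℝ (φ j) y (v (σ j)) := by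
      refine Finset.prod_congr rfl fun j hj => ?_
      rw [Equiv.Perm.mul_apply, Equiv.swap_apply_of_ne_of_ne
        (Finset.ne_of_mem_erase (Finset.mem_of_mem_erase hj)) (Finset.ne_of_mem_erase hj)]
    rw [hprod, Equiv.Perm.sign_mul, Equiv.Perm.sign_swap hm₀.symm, Equiv.Perm.mul_apply,
      Equiv.Perm.mul_apply, Equiv.swap_apply_left, Equiv.swap_apply_right,
      fderiv_fderiv_apply_comm (hφ m) y (v (σ i₀)) (v (σ m))]
    simp
  · have hswap : Equiv.swap i₀ m = 1 := mul_eq_left.mp hfix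
    exact hm₀ (Equiv.swap_eq_one_iff.mp hswap).symm
  · simp [mul_assoc]

theorem integral_det_fderiv_eq_zero [FiniteDimensional ℝ E] [MeasurableSpace E] [BorelSpace E]
    (μ : Measure E) [μ.IsAddHaarMeasure] (v : ι → E) (hφ : ∀ i, ContDiff ℝ 2 (φ i)) (i₀ : ι)
    (hc : HasCompactSupport (φ i₀)) :
    ∫ y, (Matrix.of fun i j => fderiv ℝ (φ i) y (v j)).det ∂μ = 0 := by
  let Q := leibnizCofactor φ v i₀
  have hQ (σ) : ContDiff ℝ 1 (Q σ) := contDiff_leibnizCofactor hφ v i₀ σ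
  have hQ_cont (σ) : Continuous fun y => fderiv ℝ (Q σ) y (v (σ i₀)) :=
    ((hQ σ).continuous_fderiv one_ne_zero).clm_apply continuous_const
  have hQφ' (σ) : Integrable (fun y => Q σ y * fderiv ℝ (φ i₀) y (v (σ i₀))) μ :=
    ((hQ σ).continuous.mul (contDiff_fderiv_apply (hφ i₀) _).continuous)
      |>.integrable_of_hasCompactSupport ((hc.fderiv_apply ℝ _).mul_left)
  have hQ'φ (σ) : Integrable (fun y => fderiv ℝ (Q σ) y (v (σ i₀)) * φ i₀ y) μ :=
    ((hQ_cont σ).mul (hφ i₀).continuous).integrable_of_hasCompactSupport hc.mul_left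
  have hQφ (σ) : Integrable (fun y => Q σ y * φ i₀ y) μ :=
    ((hQ σ).continuous.mul (hφ i₀).continuous).integrable_of_hasCompactSupport hc.mul_left
  have by_parts (σ : Equiv.Perm ι) : ∫ y, ((Equiv.Perm.sign σ : ℤ) : ℂ) *
      (Q σ y * fderiv ℝ (φ i₀) y (v (σ i₀))) ∂μ =
      - ∫ y, ((Equiv.Perm.sign σ : ℤ) : ℂ) * (fderiv ℝ (Q σ) y (v (σ i₀)) * φ i₀ y) ∂μ := by
    rw [integral_const_mul, integral_const_mul,
      integral_mul_fderiv_eq_neg_fderiv_mul_of_integrable (hQ'φ σ) (hQφ' σ) (hQφ σ)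
        (fun y _ => (hQ σ).differentiable one_ne_zero y)
        (fun y _ => (hφ i₀).differentiable two_ne_zero y), mul_neg]
  simp only [det_fderiv_eq_sum_leibnizCofactor φ v i₀]
  rw [integral_finsetSum _ fun σ _ => (hQφ' σ).const_mul _,
    Finset.sum_congr rfl fun σ _ => by_parts σ, Finset.sum_neg_distrib,
    ← integral_finsetSum _ fun σ _ => (hQ'φ σ).const_mul _, neg_eq_zero]
  refine integral_eq_zero_of_ae (Eventually.of_forall fun y => ?_)
  simp only [← mul_assoc]
  rw [← Finset.sum_mul, sum_sign_mul_fderiv_leibnizCofactor hφ v i₀ y, zero_mul]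
  rfl

end Stokes

theorem hasCompactSupport_comp_norm_sq_div {E : Type*} [NormedAddCommGroup E] [ProperSpace E]
    {χ : ℝ → ℝ} (hχ : HasCompactSupport χ) {R : ℝ} (hR : 0 < R) :
    HasCompactSupport fun y : E => χ (‖y‖ ^ 2 / R) := by
  obtain ⟨r, hr⟩ := hχ.isBounded.subset_closedBall 0
  refine HasCompactSupport.of_support_subset_isCompact
    (isCompact_closedBall (0 : E) (Real.sqrt (r * R))) fun y hy => ?_
  have hmem := hr (subset_tsupport _ hy)
  rw [mem_closedBall_zero_iff, Real.norm_of_nonneg (by positivity), div_le_iff₀ hR] at hmem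
  rw [mem_closedBall_zero_iff]
  exact Real.le_sqrt_of_sq_le hmem

theorem hasFDerivAt_comp_norm_sq_div {E : Type*} [NormedAddCommGroup E] [InnerProductSpace ℝ E]
    {χ : ℝ → ℝ} (hχ : Differentiable ℝ χ) (R : ℝ) (y : E) :
    HasFDerivAt (fun y : E => χ (‖y‖ ^ 2 / R))
      (deriv χ (‖y‖ ^ 2 / R) • (R⁻¹ • (2 • innerSL ℝ y))) y := by
  have hscale : HasFDerivAt (fun y : E => ‖y‖ ^ 2 / R) (R⁻¹ • (2 • innerSL ℝ y)) y := by
    simpa only [div_eq_inv_mul] using (hasStrictFDerivAt_norm_sq y).hasFDerivAt.const_mul R⁻¹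
  exact (hχ _).hasDerivAt.comp_hasFDerivAt y hscale

theorem fderiv_eq_sum_partialDeriv {k : ℕ} (Φ : (Fin k → ℂ) → ℂ) (s v : Fin k → ℂ) :
    fderiv ℂ Φ s v = ∑ l, v l * partialDeriv Φ l s := by
  conv_lhs => rw [pi_eq_sum_univ' v, map_sum]
  simp [partialDeriv, Pi.single]

/-! ### Stokes' theorem on a thimble -/

section Thimble

variable {k : ℕ} {γ : EuclideanSpace ℝ (Fin k) → (Fin k → ℂ)}

theorem hasFDerivAt_comp_real {Φ : (Fin k → ℂ) → ℂ} {y : EuclideanSpace ℝ (Fin k)}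
    (hΦ : DifferentiableAt ℂ Φ (γ y)) (hγ : DifferentiableAt ℝ γ y) :
    HasFDerivAt (fun y => Φ (γ y)) (((fderiv ℂ Φ (γ y)).restrictScalars ℝ).comp (fderiv ℝ γ y)) y :=
  (hΦ.hasFDerivAt.restrictScalars ℝ).comp y hγ.hasFDerivAt

theorem continuous_partialDeriv_comp {Φ : (Fin k → ℂ) → ℂ} (hΦ : ContDiff ℂ 1 Φ)
    (hγ : Continuous γ) (i : Fin k) : Continuous fun y => partialDeriv Φ i (γ y) :=
  ((hΦ.continuous_fderiv one_ne_zero).clm_apply continuous_const).comp hγ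

theorem continuous_formDensity (hγ : ContDiff ℝ 1 γ) : Continuous (formDensity γ) :=
  Continuous.matrix_det <| continuous_matrix fun i _ =>
    (continuous_apply i).comp ((hγ.continuous_fderiv one_ne_zero).clm_apply continuous_const)

theorem det_fderiv_update {ψ : EuclideanSpace ℝ (Fin k) → ℂ} {y : EuclideanSpace ℝ (Fin k)}
    (hγ : DifferentiableAt ℝ γ y) (i : Fin k) {a : Fin k → ℂ}
    (ha : ∀ v, fderiv ℝ ψ y v = ∑ l, a l * fderiv ℝ γ y v l) :
    (Matrix.of fun l j => fderiv ℝ (Function.update (fun l y => γ y l) i ψ l) y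
      (EuclideanSpace.single j 1)).det = a i * formDensity γ y := by
  set J : Matrix (Fin k) (Fin k) ℂ :=
    Matrix.of fun l j => fderiv ℝ γ y (EuclideanSpace.single j 1) l with hJ
  have hrow : (Matrix.of fun l j => fderiv ℝ (Function.update (fun l y => γ y l) i ψ l) y
      (EuclideanSpace.single j 1)) = J.updateRow i (∑ l, a l • J l) := by
    ext l j
    by_cases h : l = i
    · subst h
      simp [ha, hJ, Finset.sum_apply]
    · rw [Matrix.updateRow_ne h, Matrix.of_apply, Function.update_of_ne h, fderiv_apply hγ]
      rfl
  rw [hrow, Matrix.det_updateRow_sum, smul_eq_mul]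
  rfl

theorem integral_mul_formDensity_eq_zero (hγ : ContDiff ℝ 2 γ) {ψ : EuclideanSpace ℝ (Fin k) → ℂ}
    (hψ : ContDiff ℝ 2 ψ) (hc : HasCompactSupport ψ) {a : Fin k → EuclideanSpace ℝ (Fin k) → ℂ}
    (ha : ∀ y v, fderiv ℝ ψ y v = ∑ l, a l y * fderiv ℝ γ y v l) (i : Fin k) :
    ∫ y, a i y * formDensity γ y = 0 := by
  set φ : Fin k → EuclideanSpace ℝ (Fin k) → ℂ := Function.update (fun l y => γ y l) i ψ with hφ
  have hφ_smooth (l) : ContDiff ℝ 2 (φ l) := by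
    by_cases h : l = i
    · rwa [h, hφ, Function.update_self]
    · rw [hφ, Function.update_of_ne h]
      exact contDiff_pi.mp hγ l
  rw [← integral_det_fderiv_eq_zero volume (fun j => EuclideanSpace.single j (1 : ℝ)) hφ_smooth i
    (by rwa [hφ, Function.update_self])]
  exact integral_congr_ae (Eventually.of_forall fun y =>
    (det_fderiv_update (hγ.differentiable two_ne_zero y) i (ha y)).symm)

variable {f : (Fin k → ℂ) → ℂ} {ħ : ℂ} {c : Fin k → ℂ}

theorem IsLefschetzThimble.differentiable (hγ : IsLefschetzThimble f ħ c γ) :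
    Differentiable ℝ γ := hγ.smooth.differentiable (by simp)

theorem IsLefschetzThimble.sum_partialDeriv (hγ : IsLefschetzThimble f ħ c γ)
    (hf : Differentiable ℂ f) (y v : EuclideanSpace ℝ (Fin k)) :
    ∑ l, fderiv ℝ γ y v l * partialDeriv f l (γ y) = -ħ * ((2 * inner ℝ y v : ℝ) : ℂ) := by
  have chain_rule := hasFDerivAt_comp_real (hf (γ y)) (hγ.differentiable y)
  rw [funext hγ.level] at chain_rule
  have level_deriv := ((Complex.ofRealCLM.hasFDerivAt.comp y
    (hasStrictFDerivAt_norm_sq y).hasFDerivAt).const_mul ħ).const_sub (f c)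
  have heq := DFunLike.congr_fun (chain_rule.unique level_deriv) v
  rw [ContinuousLinearMap.comp_apply, ContinuousLinearMap.coe_restrictScalars',
    fderiv_eq_sum_partialDeriv] at heq
  rw [heq]
  simp

/-- The coefficient of `ds_i` in the differential of `χ(‖y‖² / R) Φ` along a thimble of `f`, on
which `‖y‖² = (f c - f) / ħ`. -/
noncomputable def cutoffPartialDeriv (f : (Fin k → ℂ) → ℂ) (ħ : ℂ)
    (γ : EuclideanSpace ℝ (Fin k) → (Fin k → ℂ)) (χ : ℝ → ℝ) (R : ℝ) (Φ : (Fin k → ℂ) → ℂ)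
    (i : Fin k) (y : EuclideanSpace ℝ (Fin k)) : ℂ :=
  (χ (‖y‖ ^ 2 / R) : ℂ) * partialDeriv Φ i (γ y) -
    (deriv χ (‖y‖ ^ 2 / R) / R : ℝ) * Φ (γ y) * partialDeriv f i (γ y) / ħ

theorem IsLefschetzThimble.fderiv_cutoff_mul (hγ : IsLefschetzThimble f ħ c γ) (hħ : ħ ≠ 0)
    (hf : Differentiable ℂ f) {Φ : (Fin k → ℂ) → ℂ} (hΦ : Differentiable ℂ Φ) {χ : ℝ → ℝ}
    (hχ : Differentiable ℝ χ) (R : ℝ) (y v : EuclideanSpace ℝ (Fin k)) :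
    fderiv ℝ (fun y => (χ (‖y‖ ^ 2 / R) : ℂ) * Φ (γ y)) y v =
      ∑ l, cutoffPartialDeriv f ħ γ χ R Φ l y * fderiv ℝ γ y v l := by
  have hprod : HasFDerivAt (fun y => (χ (‖y‖ ^ 2 / R) : ℂ) * Φ (γ y)) _ y :=
    (Complex.ofRealCLM.hasFDerivAt.comp y (hasFDerivAt_comp_norm_sq_div hχ R y)).mul
      (hasFDerivAt_comp_real (hΦ (γ y)) (hγ.differentiable y))
  have hlevel : ∑ l, ((deriv χ (‖y‖ ^ 2 / R) / R : ℝ) : ℂ) * Φ (γ y) * partialDeriv f l (γ y) / ħ *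
      fderiv ℝ γ y v l = ((deriv χ (‖y‖ ^ 2 / R) / R : ℝ) : ℂ) * Φ (γ y) / ħ *
      (-ħ * ((2 * inner ℝ y v : ℝ) : ℂ)) := by
    rw [← hγ.sum_partialDeriv hf y v, Finset.mul_sum]
    exact Finset.sum_congr rfl fun l _ => by ring
  simp only [cutoffPartialDeriv, sub_mul, Finset.sum_sub_distrib]
  rw [hprod.fderiv, hlevel]
  simp only [ContinuousLinearMap.comp_apply, ContinuousLinearMap.coe_restrictScalars', add_apply,
    smul_apply, fderiv_eq_sum_partialDeriv, Function.comp_apply]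
  rw [Finset.smul_sum, sub_eq_add_neg]
  congr 1
  · exact Finset.sum_congr rfl fun l _ => by rw [smul_eq_mul, Complex.ofRealCLM_apply]; ring
  · simp
    field_simp

theorem IsLefschetzThimble.integral_cutoffPartialDeriv_eq_zero (hγ : IsLefschetzThimble f ħ c γ)
    (hħ : ħ ≠ 0) (hf : Differentiable ℂ f) {Φ : (Fin k → ℂ) → ℂ} (hΦ : ContDiff ℂ 2 Φ)
    {χ : ℝ → ℝ} (hχ : ContDiff ℝ 2 χ) (hχc : HasCompactSupport χ) {R : ℝ} (hR : 0 < R)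
    (i : Fin k) :
    ∫ y, cutoffPartialDeriv f ħ γ χ R Φ i y * formDensity γ y = 0 := by
  have hγ₂ : ContDiff ℝ 2 γ := contDiff_infty.mp hγ.smooth 2
  have hcutoff : ContDiff ℝ 2 fun y : EuclideanSpace ℝ (Fin k) => (χ (‖y‖ ^ 2 / R) : ℂ) :=
    Complex.ofRealCLM.contDiff.comp (hχ.comp ((contDiff_norm_sq ℝ).div_const R))
  have hcutoff_c : HasCompactSupport fun y : EuclideanSpace ℝ (Fin k) => (χ (‖y‖ ^ 2 / R) : ℂ) :=
    (hasCompactSupport_comp_norm_sq_div hχc hR).comp_left Complex.ofReal_zero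
  exact integral_mul_formDensity_eq_zero hγ₂ (hcutoff.mul ((hΦ.restrict_scalars ℝ).comp hγ₂))
    hcutoff_c.mul_right (hγ.fderiv_cutoff_mul hħ hf (hΦ.differentiable two_ne_zero)
      (hχ.differentiable two_ne_zero) R) i

theorem continuous_cutoffPartialDeriv (hγ : Continuous γ) (hf : ContDiff ℂ 1 f)
    {Φ : (Fin k → ℂ) → ℂ} (hΦ : ContDiff ℂ 1 Φ) {χ : ℝ → ℝ} (hχ : ContDiff ℝ 1 χ) (R : ℝ)
    (i : Fin k) : Continuous (cutoffPartialDeriv f ħ γ χ R Φ i) := by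
  have hscale : Continuous fun y : EuclideanSpace ℝ (Fin k) => ‖y‖ ^ 2 / R := by fun_prop
  have hχ' : Continuous (deriv χ) := hχ.continuous_deriv le_rfl
  exact ((Complex.continuous_ofReal.comp (hχ.continuous.comp hscale)).mul
    (continuous_partialDeriv_comp hΦ hγ i)).sub
    ((((Complex.continuous_ofReal.comp ((hχ'.comp hscale).div_const _)).mul
      (hΦ.continuous.comp hγ)).mul (continuous_partialDeriv_comp hf hγ i)).div_const _)

theorem norm_cutoffPartialDeriv_mul_le {χ : ℝ → ℝ} (hχ : ∀ x, ‖χ x‖ ≤ 1) {K : ℝ}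
    (hK : ∀ x, ‖deriv χ x‖ ≤ K) {R : ℝ} (hR : 1 ≤ R) (Φ : (Fin k → ℂ) → ℂ) {i : Fin k}
    {y : EuclideanSpace ℝ (Fin k)} {C : ℝ} (hC : ‖partialDeriv f i (γ y)‖ ≤ C * (1 + ‖y‖ ^ 2))
    (d : ℂ) :
    ‖cutoffPartialDeriv f ħ γ χ R Φ i y * d‖ ≤ ‖partialDeriv Φ i (γ y) * d‖ +
      K * C / ‖ħ‖ * ((1 + ‖y‖ ^ 2) * ‖Φ (γ y) * d‖) := by
  have hK₀ : 0 ≤ K := (norm_nonneg _).trans (hK 0)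
  have hslope : ‖deriv χ (‖y‖ ^ 2 / R) / R‖ ≤ K := by
    rw [norm_div, Real.norm_of_nonneg (zero_le_one.trans hR)]
    exact (div_le_self (norm_nonneg _) hR).trans (hK _)
  rw [cutoffPartialDeriv, sub_mul]
  refine (norm_sub_le _ _).trans (add_le_add ?_ ?_)
  · rw [mul_assoc, norm_mul, Complex.norm_real]
    exact mul_le_of_le_one_left (norm_nonneg _) (hχ _)
  · have hassoc (a b p : ℂ) : a * b * p / ħ * d = a * p / ħ * (b * d) := by ring
    have hcoef : ‖deriv χ (‖y‖ ^ 2 / R) / R‖ * ‖partialDeriv f i (γ y)‖ / ‖ħ‖ ≤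
        K * C / ‖ħ‖ * (1 + ‖y‖ ^ 2) := by
      rw [div_mul_eq_mul_div, mul_assoc K]
      gcongr
    rw [hassoc, norm_mul, norm_div, norm_mul, Complex.norm_real, ← mul_assoc]
    exact mul_le_mul_of_nonneg_right hcoef (norm_nonneg _)

theorem tendsto_cutoffPartialDeriv {χ : ℝ → ℝ} (hχ : χ =ᶠ[𝓝 0] fun _ => 1)
    (Φ : (Fin k → ℂ) → ℂ) (i : Fin k) (y : EuclideanSpace ℝ (Fin k)) :
    Tendsto (fun R => cutoffPartialDeriv f ħ γ χ R Φ i y) atTop (𝓝 (partialDeriv Φ i (γ y))) := by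
  refine tendsto_const_nhds.congr' ?_
  have hscale : Tendsto (fun R : ℝ => ‖y‖ ^ 2 / R) atTop (𝓝 0) :=
    tendsto_const_nhds.div_atTop tendsto_id
  filter_upwards [hscale.eventually hχ.eventuallyEq_nhds] with R hR
  rw [cutoffPartialDeriv, hR.deriv_eq, hR.eq_of_nhds]
  simp

/- The factor `‖χ'(‖y‖² / R) / R‖ ‖∂f/∂s_i‖` of the error term stays bounded because `∂f/∂s_i` grows
at most like `‖y‖²`. -/
theorem IsLefschetzThimble.integral_partialDeriv_eq_zero (hγ : IsLefschetzThimble f ħ c γ)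
    (hħ : ħ ≠ 0) (hf : ContDiff ℂ 1 f) {Φ : (Fin k → ℂ) → ℂ} (hΦ : ContDiff ℂ 2 Φ) (i : Fin k)
    {C : ℝ} (hC : ∀ y, ‖partialDeriv f i (γ y)‖ ≤ C * (1 + ‖y‖ ^ 2))
    (hint : Integrable fun y => (1 + ‖y‖ ^ 2) * ‖Φ (γ y) * formDensity γ y‖)
    (hint' : Integrable fun y => partialDeriv Φ i (γ y) * formDensity γ y) :
    ∫ y, partialDeriv Φ i (γ y) * formDensity γ y = 0 := by
  let χ : ContDiffBump (0 : ℝ) := ⟨1, 2, one_pos, one_lt_two⟩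
  have hχ₁ : ContDiff ℝ 1 χ := χ.contDiff
  obtain ⟨K, hK⟩ := χ.hasCompactSupport.deriv.exists_bound_of_continuous
    (hχ₁.continuous_deriv le_rfl)
  have hχ_norm (x : ℝ) : ‖χ x‖ ≤ 1 := by rw [Real.norm_of_nonneg χ.nonneg]; exact χ.le_one
  have hγ₁ : ContDiff ℝ 1 γ := contDiff_infty.mp hγ.smooth 1
  have hlim : Tendsto (fun R => ∫ y, cutoffPartialDeriv f ħ γ χ R Φ i y * formDensity γ y) atTop
      (𝓝 (∫ y, partialDeriv Φ i (γ y) * formDensity γ y)) := by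
    refine tendsto_integral_filter_of_dominated_convergence
      (fun y => ‖partialDeriv Φ i (γ y) * formDensity γ y‖ +
        K * C / ‖ħ‖ * ((1 + ‖y‖ ^ 2) * ‖Φ (γ y) * formDensity γ y‖)) ?_ ?_
      (hint'.norm.add (hint.const_mul _))
      (Eventually.of_forall fun y =>
        (tendsto_cutoffPartialDeriv χ.eventuallyEq_one Φ i y).mul_const _)
    · exact Eventually.of_forall fun R => ((continuous_cutoffPartialDeriv hγ₁.continuous hf
        (hΦ.of_le one_le_two) hχ₁ R i).mul (continuous_formDensity hγ₁)).aestronglyMeasurable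
    · filter_upwards [eventually_ge_atTop 1] with R hR
      exact Eventually.of_forall fun y => norm_cutoffPartialDeriv_mul_le hχ_norm hK hR Φ (hC y) _
  refine tendsto_nhds_unique hlim (tendsto_const_nhds.congr' ?_)
  filter_upwards [eventually_gt_atTop 0] with R hR
  exact (hγ.integral_cutoffPartialDeriv_eq_zero hħ (hf.differentiable one_ne_zero) hΦ χ.contDiff
    χ.hasCompactSupport hR i).symm

end Thimble

/-! ### Partial derivatives -/

section PartialDeriv

variable {k : ℕ} {f g : (Fin k → ℂ) → ℂ} {s : Fin k → ℂ}

theorem partialDeriv_eq_of_hasFDerivAt {f' : (Fin k → ℂ) →L[ℂ] ℂ} (h : HasFDerivAt f f' s)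
    (i : Fin k) : partialDeriv f i s = f' (Pi.single i 1) := by
  rw [partialDeriv, h.fderiv]

theorem partialDeriv_const (a : ℂ) (i : Fin k) (s : Fin k → ℂ) :
    partialDeriv (fun _ => a) i s = 0 := by simp [partialDeriv]

theorem partialDeriv_add (hf : DifferentiableAt ℂ f s) (hg : DifferentiableAt ℂ g s) (i : Fin k) :
    partialDeriv (fun s => f s + g s) i s = partialDeriv f i s + partialDeriv g i s :=
  partialDeriv_eq_of_hasFDerivAt (hf.hasFDerivAt.fun_add hg.hasFDerivAt) i

theorem partialDeriv_mul (hf : DifferentiableAt ℂ f s) (hg : DifferentiableAt ℂ g s) (i : Fin k) :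
    partialDeriv (fun s => f s * g s) i s =
      f s * partialDeriv g i s + partialDeriv f i s * g s := by
  rw [partialDeriv_eq_of_hasFDerivAt (hf.hasFDerivAt.fun_mul hg.hasFDerivAt)]
  simp [partialDeriv, mul_comm]

theorem partialDeriv_const_mul (hf : DifferentiableAt ℂ f s) (a : ℂ) (i : Fin k) :
    partialDeriv (fun s => a * f s) i s = a * partialDeriv f i s :=
  partialDeriv_eq_of_hasFDerivAt (hf.hasFDerivAt.const_mul a) i

theorem partialDeriv_exp (hf : DifferentiableAt ℂ f s) (i : Fin k) :
    partialDeriv (fun s => Complex.exp (f s)) i s = partialDeriv f i s * Complex.exp (f s) := by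
  rw [partialDeriv_eq_of_hasFDerivAt hf.hasFDerivAt.cexp]
  simp [partialDeriv, mul_comm]

theorem partialDeriv_coord (i j : Fin k) (s : Fin k → ℂ) :
    partialDeriv (fun s => s j) i s = if j = i then 1 else 0 := by
  rw [partialDeriv_eq_of_hasFDerivAt (hasFDerivAt_apply j s)]
  simp [Pi.single_apply]

theorem partialDeriv_sum {ι : Type*} (S : Finset ι) {F : ι → (Fin k → ℂ) → ℂ}
    (hF : ∀ j ∈ S, DifferentiableAt ℂ (F j) s) (i : Fin k) :
    partialDeriv (fun s => ∑ j ∈ S, F j s) i s = ∑ j ∈ S, partialDeriv (F j) i s := by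
  rw [partialDeriv_eq_of_hasFDerivAt (HasFDerivAt.fun_sum fun j hj => (hF j hj).hasFDerivAt)]
  simp [partialDeriv, sum_apply]

theorem partialDeriv_const_sub_sum (a : ℂ) (i : Fin k) (s : Fin k → ℂ) :
    partialDeriv (fun s => a - ∑ j, s j) i s = -1 := by
  have hsum : DifferentiableAt ℂ (fun s : Fin k → ℂ => ∑ j, s j) s := by fun_prop
  rw [partialDeriv_eq_of_hasFDerivAt (hsum.hasFDerivAt.const_sub a), neg_apply]
  change -partialDeriv (fun s => ∑ j, s j) i s = -1
  rw [partialDeriv_sum _ fun j _ => by fun_prop]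
  simp [partialDeriv_coord]

end PartialDeriv

/-! ### The potential of projective space -/

section Potential

variable {k : ℕ} (w : Fin (k + 1) → ℂ) (t : ℂ)

theorem contDiff_cpPotential {n : WithTop ℕ∞} : ContDiff ℂ n (cpPotential w t) := by
  unfold cpPotential
  fun_prop

theorem partialDeriv_cpPotential (i : Fin k) (s : Fin k → ℂ) :
    partialDeriv (cpPotential w t) i s =
      Complex.exp (s i) + w i.succ - Complex.exp (t - ∑ j, s j) - w 0 := by
  have hterm (j : Fin k) : partialDeriv (fun s => Complex.exp (s j) + w j.succ * s j) i s =
      if j = i then Complex.exp (s j) + w j.succ else 0 := by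
    rw [partialDeriv_add (by fun_prop) (by fun_prop), partialDeriv_exp (by fun_prop),
      partialDeriv_const_mul (by fun_prop), partialDeriv_coord]
    split_ifs <;> simp
  unfold cpPotential
  rw [partialDeriv_add (by fun_prop) (by fun_prop), partialDeriv_add (by fun_prop) (by fun_prop),
    partialDeriv_sum _ fun j _ => by fun_prop, partialDeriv_exp (by fun_prop),
    partialDeriv_const_mul (by fun_prop), partialDeriv_const_sub_sum,
    Finset.sum_congr rfl fun j _ => hterm j, Finset.sum_ite_eq' Finset.univ i,
    if_pos (Finset.mem_univ i)]
  ring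

theorem exp_eq_mul_prod_exp (s : Fin k → ℂ) :
    Complex.exp t = Complex.exp (t - ∑ j, s j) * ∏ j, Complex.exp (s j) := by
  rw [← Complex.exp_sum, ← Complex.exp_add, sub_add_cancel]

/-- All the monomials `u_i = exp (s i)` and `x / (u_1 ⋯ u_k)` of the mirror potential are bounded
by `B` at `s`. -/
def MonomialsBoundedBy (B : ℝ) (s : Fin k → ℂ) : Prop :=
  (∀ i, ‖Complex.exp (s i)‖ ≤ B) ∧ ‖Complex.exp (t - ∑ j, s j)‖ ≤ B

theorem norm_le_one_add_add_norm_mul_prod {ι : Type*} [Fintype ι] {a : ι → ℂ} {z : ℂ} {A : ℝ}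
    (hA : 0 ≤ A) (ha : ∀ i, ‖a i - z‖ ≤ A) : ‖z‖ ≤ 1 + A + ‖z * ∏ i, a i‖ := by
  by_contra! hlt
  have one_le_norm (i : ι) : 1 ≤ ‖a i‖ := by
    have htri := norm_sub_norm_le z (a i)
    rw [norm_sub_rev] at htri
    linarith [ha i, norm_nonneg (z * ∏ i, a i)]
  have hz : ‖z‖ ≤ ‖z * ∏ i, a i‖ := by
    rw [norm_mul, norm_prod]
    exact le_mul_of_one_le_right (norm_nonneg _) (Finset.one_le_prod fun i _ => one_le_norm i)
  linarith

/- The critical points do not escape to infinity: where the gradient is bounded, the `u_i` differ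
boundedly from `x / (u_1 ⋯ u_k)`, while the product of all these monomials is `x`. -/
theorem exists_monomialsBoundedBy_of_norm_partialDeriv_le :
    ∃ C : ℝ, 1 ≤ C ∧ ∀ (s : Fin k → ℂ) (P : ℝ), 0 ≤ P →
      (∀ i, ‖partialDeriv (cpPotential w t) i s‖ ≤ P) →
      MonomialsBoundedBy t (C * (1 + P)) s := by
  set W := ∑ i, ‖w i‖ with hW
  have hW₀ : 0 ≤ W := Finset.sum_nonneg fun _ _ => norm_nonneg _
  have hx₀ := norm_nonneg (Complex.exp t)
  refine ⟨2 * (1 + W) + ‖Complex.exp t‖, by linarith, fun s P hP₀ hP => ?_⟩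
  set z := Complex.exp (t - ∑ j, s j)
  have hdiff (i : Fin k) : ‖Complex.exp (s i) - z‖ ≤ P + W := by
    have hgrad := hP i
    rw [partialDeriv_cpPotential] at hgrad
    have hw_le : ‖w i.succ‖ + ‖w 0‖ ≤ W := by
      rw [hW, Fin.sum_univ_succ, add_comm]
      exact add_le_add_right (Finset.single_le_sum (f := fun i : Fin k => ‖w i.succ‖)
        (fun _ _ => norm_nonneg _) (Finset.mem_univ i)) _
    calc ‖Complex.exp (s i) - z‖
        = ‖(Complex.exp (s i) + w i.succ - z - w 0) - w i.succ + w 0‖ := by congr 1; ring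
      _ ≤ P + ‖w i.succ‖ + ‖w 0‖ :=
          (norm_add_le _ _).trans (by gcongr; exact (norm_sub_le _ _).trans (by gcongr))
      _ ≤ P + W := by linarith
  have hz_le : ‖z‖ ≤ 1 + (P + W) + ‖Complex.exp t‖ := by
    rw [exp_eq_mul_prod_exp t s]
    exact norm_le_one_add_add_norm_mul_prod (add_nonneg hP₀ hW₀) hdiff
  have hconst : 1 + 2 * (P + W) + ‖Complex.exp t‖ ≤ (2 * (1 + W) + ‖Complex.exp t‖) * (1 + P) := by
    nlinarith [mul_nonneg hW₀ hP₀, mul_nonneg hx₀ hP₀]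
  refine ⟨fun i => ?_, by linarith⟩
  linarith [norm_sub_norm_le (Complex.exp (s i)) z, hdiff i]

theorem hasFDerivAt_partialDeriv_cpPotential (i : Fin k) (s : Fin k → ℂ) :
    HasFDerivAt (partialDeriv (cpPotential w t) i)
      (Complex.exp (s i) • (ContinuousLinearMap.proj i : (Fin k → ℂ) →L[ℂ] ℂ) +
        Complex.exp (t - ∑ j, s j) •
          ∑ j : Fin k, (ContinuousLinearMap.proj j : (Fin k → ℂ) →L[ℂ] ℂ)) s := by
  have hquot := ((HasFDerivAt.fun_sum (u := Finset.univ) fun (j : Fin k) _ =>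
    hasFDerivAt_apply (𝕜 := ℂ) j s).const_sub t).cexp
  have hderiv := (((hasFDerivAt_apply (𝕜 := ℂ) i s).cexp.add_const (w i.succ)).sub hquot).sub_const
    (w 0)
  rw [smul_neg, sub_neg_eq_add] at hderiv
  exact hderiv.congr_of_eventuallyEq
    (Eventually.of_forall fun s => partialDeriv_cpPotential w t i s)

theorem norm_fderiv_partialDeriv_cpPotential_le {s v : Fin k → ℂ} {B V : ℝ} (hB₀ : 0 ≤ B)
    (hB : MonomialsBoundedBy t B s) (hV : ∀ j, ‖v j‖ ≤ V) (i : Fin k) :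
    ‖fderiv ℂ (partialDeriv (cpPotential w t) i) s v‖ ≤ B * ((k + 1) * V) := by
  have hsum : ‖∑ j, v j‖ ≤ k * V := by
    simpa using norm_sum_le_of_le Finset.univ fun j _ => hV j
  rw [(hasFDerivAt_partialDeriv_cpPotential w t i s).fderiv]
  simp only [add_apply, smul_apply, sum_apply, ContinuousLinearMap.proj_apply, smul_eq_mul]
  calc ‖Complex.exp (s i) * v i + Complex.exp (t - ∑ j, s j) * ∑ j, v j‖
      ≤ ‖Complex.exp (s i)‖ * ‖v i‖ + ‖Complex.exp (t - ∑ j, s j)‖ * ‖∑ j, v j‖ := by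
        rw [← norm_mul, ← norm_mul]
        exact norm_add_le _ _
    _ ≤ B * V + B * (k * V) := by
        gcongr
        exacts [hB.1 i, hV i, hB.2]
    _ = B * ((k + 1) * V) := by ring

end Potential

/-! ### Growth of the monomials along a thimble -/

theorem eventually_gt_of_hasDerivAt_pos {g : ℝ → ℝ} {g' : ℝ} (h : HasDerivAt g g' 0)
    (hg' : 0 < g') : ∀ᶠ τ in 𝓝[>] (0 : ℝ), g 0 < g τ := by
  have hslope := (hasDerivAt_iff_tendsto_slope_zero.mp h).mono_left
    (nhdsWithin_mono 0 fun x (hx : 0 < x) => hx.ne')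
  filter_upwards [hslope.eventually (lt_mem_nhds hg'), self_mem_nhdsWithin] with τ hτ (hτ₀ : 0 < τ)
  rw [zero_add, smul_eq_mul] at hτ
  exact sub_pos.mp (pos_of_mul_pos_right hτ (inv_nonneg.mpr hτ₀.le))

section MaximumPrinciple

variable {E : Type*} [NormedAddCommGroup E] [InnerProductSpace ℝ E]

theorem hasLineDerivAt_norm_sq (x v : E) :
    HasLineDerivAt ℝ (fun x : E => ‖x‖ ^ 2) (2 * inner ℝ x v) x v := by
  simpa using (hasStrictFDerivAt_norm_sq x).hasFDerivAt.hasLineDerivAt v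

theorem le_of_forall_exists_hasLineDerivAt_pos [ProperSpace E] {g : E → ℝ} (hg : Continuous g)
    {B : ℝ} (h : ∀ x, B < g x → ∃ v, inner ℝ x v < 0 ∧ ∃ g' > 0, HasLineDerivAt ℝ g g' x v)
    (y : E) : g y ≤ B := by
  obtain ⟨x, hx, hmax⟩ :=
    (isCompact_closedBall (0 : E) ‖y‖).exists_isMaxOn ⟨y, by simp⟩ hg.continuousOn
  refine (hmax (by simp : y ∈ closedBall 0 ‖y‖)).trans ?_
  by_contra! hlt
  obtain ⟨v, hv, g', hg', hderiv⟩ := h x hlt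
  have hnorm := (hasLineDerivAt_norm_sq x v).neg
  obtain ⟨τ, hgτ, hnormτ⟩ := ((eventually_gt_of_hasDerivAt_pos hderiv hg').and
    (eventually_gt_of_hasDerivAt_pos hnorm (by linarith))).exists
  simp only [zero_smul, add_zero, Pi.neg_apply] at hgτ hnormτ
  have hmem : x + τ • v ∈ closedBall (0 : E) ‖y‖ := by
    rw [mem_closedBall_zero_iff] at hx ⊢
    exact (abs_le_of_sq_le_sq' (neg_lt_neg_iff.mp hnormτ).le (norm_nonneg x)).2.trans hx
  exact (hmax hmem).not_gt hgτ

/- The maximum principle is applied to `u / (1 + ‖x‖²)²`. -/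
theorem sqrt_le_of_hasLineDerivAt [ProperSpace E] {u : E → ℝ} (hu : Continuous u)
    (hu₀ : ∀ x, 0 ≤ u x) {A κ : ℝ} (hA : 0 ≤ A) (hκ : 0 < κ)
    (h : ∀ x, ∃ v, 2 * inner ℝ x v = -(κ * u x) ∧ ∃ u', HasLineDerivAt ℝ u u' x v ∧
      -(A * u x * (1 + √(u x))) ≤ u') (y : E) :
    √(u y) ≤ (1 + A / κ) * (1 + ‖y‖ ^ 2) := by
  have hg : Continuous fun y : E => u y / (1 + ‖y‖ ^ 2) ^ 2 :=
    hu.div (by fun_prop) fun y => by positivity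
  have hle := le_of_forall_exists_hasLineDerivAt_pos hg (B := (1 + A / κ) ^ 2) (fun x hx => ?_) y
  · rw [div_le_iff₀ (by positivity), ← mul_pow] at hle
    exact (Real.sqrt_le_left (by positivity)).mpr hle
  obtain ⟨v, hxv, u', hu', hu'_ge⟩ := h x
  set P := √(u x) with hP
  have hP_sq : u x = P ^ 2 := (Real.sq_sqrt (hu₀ x)).symm
  set r := 1 + ‖x‖ ^ 2 with hr
  have hr₁ : 1 ≤ r := by nlinarith [sq_nonneg ‖x‖]
  have hP_gt : (1 + A / κ) * r < P := by
    rw [lt_div_iff₀ (by positivity), ← mul_pow, hP_sq] at hx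
    exact lt_of_pow_lt_pow_left₀ 2 (Real.sqrt_nonneg _) hx
  have hκP : (κ + A) * r < κ * P := by
    have hκA : κ * (1 + A / κ) = κ + A := by field_simp
    rw [← hκA, mul_assoc]
    exact mul_lt_mul_of_pos_left hP_gt hκ
  have hP₁ : 1 < P := by nlinarith [div_nonneg hA hκ.le]
  have hr' : HasLineDerivAt ℝ (fun x : E => (1 + ‖x‖ ^ 2) ^ 2) (2 * r * -(κ * u x)) x v := by
    refine HasDerivAt.congr_deriv (((hasLineDerivAt_norm_sq x v).const_add 1).fun_pow 2) ?_
    simp [hxv, hr]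
  refine ⟨v, by nlinarith [mul_pos hκ (by positivity : 0 < P ^ 2)], _, ?_, hu'.fun_div hr' ?_⟩
  · simp only [zero_smul, add_zero]
    refine div_pos ?_ (by positivity)
    have hnum : A * (1 + P) * r < 2 * (κ * P ^ 2) := by
      have hAr : A * r < κ * P := by nlinarith [mul_pos hκ (by linarith : 0 < r)]
      have hAr₀ : 0 ≤ A * r := by positivity
      calc A * (1 + P) * r ≤ 2 * P * (A * r) := by nlinarith
        _ < 2 * P * (κ * P) := by gcongr
        _ = 2 * (κ * P ^ 2) := by ring
    rw [hP_sq] at hu'_ge ⊢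
    have : 0 < r * P ^ 2 * (2 * (κ * P ^ 2) - A * (1 + P) * r) := by
      have := sub_pos.mpr hnum
      positivity
    nlinarith [mul_le_mul_of_nonneg_right hu'_ge (by positivity : (0 : ℝ) ≤ r ^ 2)]
  · simp only [zero_smul, add_zero]
    positivity

end MaximumPrinciple

section Growth

variable {k : ℕ} {f : (Fin k → ℂ) → ℂ} {ħ : ℂ} {c : Fin k → ℂ}
  {γ : EuclideanSpace ℝ (Fin k) → (Fin k → ℂ)}

/-- The square of the length of the gradient of `f` for the metric `∑ |ds_i|²`. -/
noncomputable def gradNormSq (f : (Fin k → ℂ) → ℂ) (s : Fin k → ℂ) : ℝ :=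
  ∑ i, ‖partialDeriv f i s‖ ^ 2

theorem gradNormSq_nonneg (f : (Fin k → ℂ) → ℂ) (s : Fin k → ℂ) : 0 ≤ gradNormSq f s :=
  Finset.sum_nonneg fun _ _ => sq_nonneg _

theorem norm_partialDeriv_le_sqrt_gradNormSq (f : (Fin k → ℂ) → ℂ) (s : Fin k → ℂ) (i : Fin k) :
    ‖partialDeriv f i s‖ ≤ √(gradNormSq f s) :=
  Real.le_sqrt_of_sq_le (Finset.single_le_sum (f := fun i => ‖partialDeriv f i s‖ ^ 2)
    (fun _ _ => sq_nonneg _) (Finset.mem_univ i))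

theorem hasLineDerivAt_gradNormSq_comp {y : EuclideanSpace ℝ (Fin k)}
    (hf : ∀ i, DifferentiableAt ℂ (partialDeriv f i) (γ y)) (hγ : DifferentiableAt ℝ γ y)
    (v : EuclideanSpace ℝ (Fin k)) :
    HasLineDerivAt ℝ (fun y => gradNormSq f (γ y)) (∑ i, 2 * inner ℝ (partialDeriv f i (γ y))
      (fderiv ℂ (partialDeriv f i) (γ y) (fderiv ℝ γ y v))) y v := by
  have hterm (i : Fin k) := ((hasFDerivAt_comp_real (hf i) hγ).hasLineDerivAt v).norm_sq
  simp only [zero_smul, add_zero] at hterm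
  exact HasDerivAt.fun_sum fun i _ => hterm i

theorem IsLefschetzThimble.exists_descent (hγ : IsLefschetzThimble f ħ c γ) (hħ : ħ ≠ 0)
    (hf : Differentiable ℂ f) (y : EuclideanSpace ℝ (Fin k)) :
    ∃ η, (∀ i, ‖fderiv ℝ γ y η i‖ = ‖partialDeriv f i (γ y)‖ / ‖ħ‖) ∧
      2 * inner ℝ y η = gradNormSq f (γ y) / ‖ħ‖ ^ 2 := by
  obtain ⟨η, hη⟩ := hγ.descent y
  refine ⟨η, fun i => by simp [hη], ?_⟩
  have hħ_conj : (starRingEnd ℂ) ħ ≠ 0 := (map_ne_zero _).mpr hħ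
  have hlevel := hγ.sum_partialDeriv hf y η
  have hgrad : ∑ l, fderiv ℝ γ y η l * partialDeriv f l (γ y) =
      -(gradNormSq f (γ y) : ℂ) / (starRingEnd ℂ) ħ := by
    rw [hη, gradNormSq]
    push_cast
    rw [neg_div, Finset.sum_div, ← Finset.sum_neg_distrib]
    refine Finset.sum_congr rfl fun l _ => ?_
    rw [← Complex.conj_mul', map_div₀]
    ring
  rw [hgrad, div_eq_iff hħ_conj] at hlevel
  rw [eq_div_iff (pow_ne_zero 2 (norm_ne_zero_iff.mpr hħ))]
  apply Complex.ofReal_injective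
  rw [Complex.ofReal_mul, Complex.ofReal_pow, ← Complex.mul_conj']
  linear_combination hlevel

theorem IsLefschetzThimble.exists_sqrt_gradNormSq_le {w : Fin (k + 1) → ℂ} {t₀ : ℂ}
    (hγ : IsLefschetzThimble (cpPotential w t₀) ħ c γ) (hħ : ħ ≠ 0) :
    ∃ K : ℝ, ∀ y, √(gradNormSq (cpPotential w t₀) (γ y)) ≤ K * (1 + ‖y‖ ^ 2) := by
  have hf_smooth : ContDiff ℂ 1 (cpPotential w t₀) := contDiff_cpPotential w t₀
  have hf := hf_smooth.differentiable one_ne_zero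
  have hħ₀ : 0 < ‖ħ‖ := norm_pos_iff.mpr hħ
  obtain ⟨C, hC₁, hC⟩ := exists_monomialsBoundedBy_of_norm_partialDeriv_le w t₀
  have hcont : Continuous fun y => gradNormSq (cpPotential w t₀) (γ y) :=
    continuous_finsetSum _ fun i _ =>
      (continuous_partialDeriv_comp hf_smooth hγ.smooth.continuous i).norm.pow 2
  refine ⟨_, sqrt_le_of_hasLineDerivAt hcont (fun y => gradNormSq_nonneg _ _)
    (A := 2 * k * (C * ((k + 1) / ‖ħ‖))) (by positivity) (κ := 1 / ‖ħ‖ ^ 2) (by positivity)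
    fun x => ?_⟩
  obtain ⟨η, hη_norm, hη_inner⟩ := hγ.exists_descent hħ hf x
  refine ⟨-η, by rw [inner_neg_right, mul_neg, hη_inner]; ring, _, hasLineDerivAt_gradNormSq_comp
    (fun i => (hasFDerivAt_partialDeriv_cpPotential w t₀ i _).differentiableAt)
    (hγ.differentiable x) (-η), ?_⟩
  set p := fun i => partialDeriv (cpPotential w t₀) i (γ x)
  set P := √(gradNormSq (cpPotential w t₀) (γ x)) with hP
  have hP₀ : 0 ≤ P := Real.sqrt_nonneg _
  have hp (i) : ‖p i‖ ≤ P := norm_partialDeriv_le_sqrt_gradNormSq _ _ i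
  have hmon : MonomialsBoundedBy t₀ (C * (1 + P)) (γ x) := hC _ _ hP₀ hp
  have hη_le (j) : ‖fderiv ℝ γ x (-η) j‖ ≤ P / ‖ħ‖ := by
    rw [map_neg, Pi.neg_apply, norm_neg, hη_norm]
    exact div_le_div_of_nonneg_right (hp j) hħ₀.le
  have hterm (i : Fin k) (_ : i ∈ Finset.univ) :
      -(2 * (P * (C * (1 + P) * ((k + 1) * (P / ‖ħ‖))))) ≤ 2 * inner ℝ (p i)
        (fderiv ℂ (partialDeriv (cpPotential w t₀) i) (γ x) (fderiv ℝ γ x (-η))) := by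
    have hq := norm_fderiv_partialDeriv_cpPotential_le w t₀ (by positivity) hmon hη_le i
    have hcauchy := neg_le_of_abs_le (abs_real_inner_le_norm (p i)
      (fderiv ℂ (partialDeriv (cpPotential w t₀) i) (γ x) (fderiv ℝ γ x (-η))))
    linarith [mul_le_mul (hp i) hq (norm_nonneg _) hP₀]
  refine le_trans (le_of_eq ?_) (Finset.card_nsmul_le_sum _ _ _ hterm)
  rw [← Real.sq_sqrt (gradNormSq_nonneg (cpPotential w t₀) (γ x)), ← hP, Finset.card_univ,
    Fintype.card_fin, nsmul_eq_mul]
  ring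

/- Steepest descent keeps the gradient `O(‖y‖²)`: its logarithmic derivative along the descent
lines is bounded by the gradient itself, which in turn bounds the monomials. -/
theorem IsLefschetzThimble.exists_monomialsBoundedBy {w : Fin (k + 1) → ℂ} {t₀ : ℂ}
    (hγ : IsLefschetzThimble (cpPotential w t₀) ħ c γ) (hħ : ħ ≠ 0) :
    ∃ C : ℝ, 0 ≤ C ∧ ∀ y, MonomialsBoundedBy t₀ (C * (1 + ‖y‖ ^ 2)) (γ y) := by
  obtain ⟨K, hK⟩ := hγ.exists_sqrt_gradNormSq_le hħ
  obtain ⟨C, hC₁, hC⟩ := exists_monomialsBoundedBy_of_norm_partialDeriv_le w t₀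
  have hK₀ : 0 ≤ K := by simpa using (Real.sqrt_nonneg _).trans (hK 0)
  refine ⟨C * (1 + K), by positivity, fun y => ?_⟩
  obtain ⟨hu, hz⟩ := hC (γ y) _ (Real.sqrt_nonneg _) (norm_partialDeriv_le_sqrt_gradNormSq _ _)
  have hle : C * (1 + √(gradNormSq (cpPotential w t₀) (γ y))) ≤
      C * (1 + K) * (1 + ‖y‖ ^ 2) := by
    rw [mul_assoc]
    gcongr
    nlinarith [hK y, sq_nonneg ‖y‖]
  exact ⟨fun i => (hu i).trans hle, hz.trans hle⟩

end Growth

/-! ### Convergence of the integral of projective space -/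

section Convergence

variable {k : ℕ} (w : Fin (k + 1) → ℂ) (ħ : ℂ) (γ : EuclideanSpace ℝ (Fin k) → (Fin k → ℂ))

theorem cpIntegrand_eq (t : ℂ) (y : EuclideanSpace ℝ (Fin k)) :
    cpIntegrand w ħ γ t y = Complex.exp (w 0 * t / ħ) *
      (Complex.exp (Complex.exp t * (Complex.exp (-∑ i, γ y i) / ħ)) *
      (Complex.exp (((∑ i, (Complex.exp (γ y i) + w i.succ * γ y i)) - w 0 * ∑ i, γ y i) / ħ) *
        formDensity γ y)) := by
  rw [← mul_assoc, ← mul_assoc, ← Complex.exp_add, ← Complex.exp_add, cpIntegrand, cpPotential]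
  congr 2
  rw [sub_eq_add_neg t, Complex.exp_add]
  ring

theorem differentiable_cpIntegrand (y : EuclideanSpace ℝ (Fin k)) :
    Differentiable ℂ fun t => cpIntegrand w ħ γ t y := by
  simp only [cpIntegrand_eq]
  fun_prop

theorem hasDerivAt_cpIntegrand (t : ℂ) (y : EuclideanSpace ℝ (Fin k)) :
    HasDerivAt (fun t => cpIntegrand w ħ γ t y)
      ((Complex.exp (t - ∑ i, γ y i) + w 0) / ħ * cpIntegrand w ħ γ t y) t := by
  have hsub : HasDerivAt (fun t : ℂ => t - ∑ i, γ y i) 1 t := (hasDerivAt_id t).sub_const _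
  have hpotential : HasDerivAt (fun t => cpPotential w t (γ y))
      (Complex.exp (t - ∑ i, γ y i) * 1 + w 0 * 1) t :=
    (hsub.cexp.const_add (∑ i, (Complex.exp (γ y i) + w i.succ * γ y i))).add
      (hsub.const_mul (w 0))
  refine ((hpotential.div_const ħ).cexp.mul_const (formDensity γ y)).congr_deriv ?_
  simp only [cpIntegrand]
  ring

variable {γ}

theorem continuous_cpIntegrand (hγ : ContDiff ℝ 1 γ) (t : ℂ) :
    Continuous (cpIntegrand w ħ γ t) := by
  have hpotential := (contDiff_cpPotential w t (n := 0)).continuous.comp hγ.continuous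
  exact ((hpotential.div_const ħ).cexp).mul (continuous_formDensity hγ)

variable {w ħ}

/- Up to the factor `exp (w 0 * t / ħ)` the integrand is the exponential of an affine function
of `x = exp t`. -/
theorem norm_cpIntegrand_le {t : ℂ} {S : Finset ℂ}
    (hS : Complex.exp t ∈ convexHull ℝ (Complex.exp '' S)) (y : EuclideanSpace ℝ (Fin k)) :
    ‖cpIntegrand w ħ γ t y‖ ≤ ‖Complex.exp (w 0 * t / ħ)‖ *
      ∑ τ ∈ S, ‖Complex.exp (w 0 * τ / ħ)‖⁻¹ * ‖cpIntegrand w ħ γ τ y‖ := by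
  have hconvex : ConvexOn ℝ Set.univ fun x : ℂ => (x * (Complex.exp (-∑ i, γ y i) / ħ)).re :=
    (Complex.reLm ∘ₗ (LinearMap.mul ℝ ℂ).flip _).convexOn convex_univ
  obtain ⟨_, ⟨τ, hτ, rfl⟩, hle⟩ := hconvex.exists_ge_of_mem_convexHull (Set.subset_univ _) hS
  have hτ_le := Finset.single_le_sum
    (f := fun τ => ‖Complex.exp (w 0 * τ / ħ)‖⁻¹ * ‖cpIntegrand w ħ γ τ y‖)
    (fun _ _ => by positivity) hτ
  have hne : ‖Complex.exp (w 0 * τ / ħ)‖ ≠ 0 := norm_ne_zero_iff.mpr (Complex.exp_ne_zero _)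
  rw [cpIntegrand_eq, norm_mul]
  refine mul_le_mul_of_nonneg_left (le_trans ?_ hτ_le) (norm_nonneg _)
  rw [cpIntegrand_eq, norm_mul (Complex.exp (w 0 * τ / ħ)), inv_mul_cancel_left₀ hne, norm_mul,
    norm_mul (Complex.exp (Complex.exp τ * _)), Complex.norm_exp, Complex.norm_exp]
  gcongr

theorem integrable_cpIntegrand_of_mem_convexHull (hγ : ContDiff ℝ 1 γ) {t : ℂ} {S : Finset ℂ}
    (hS : Complex.exp t ∈ convexHull ℝ (Complex.exp '' S))
    (hint : ∀ τ ∈ S, Integrable (cpIntegrand w ħ γ τ)) : Integrable (cpIntegrand w ħ γ t) :=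
  ((integrable_finsetSum S fun τ hτ => (hint τ hτ).norm.const_mul _).const_mul _).mono'
    (continuous_cpIntegrand w ħ hγ t).aestronglyMeasurable
    (Eventually.of_forall fun y => norm_cpIntegrand_le hS y)

theorem exp_mem_segment (t : ℂ) {σ₁ σ₂ : ℝ} (hσ₁ : σ₁ ≤ 0) (hσ₂ : 0 ≤ σ₂) :
    Complex.exp t ∈ segment ℝ (Complex.exp (t + σ₁)) (Complex.exp (t + σ₂)) := by
  have hone : (1 : ℝ) ∈ segment ℝ (Real.exp σ₁) (Real.exp σ₂) := by
    rw [segment_eq_Icc (Real.exp_le_exp.mpr (hσ₁.trans hσ₂))]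
    exact ⟨Real.exp_le_one_iff.mpr hσ₁, Real.one_le_exp hσ₂⟩
  have himage := Set.mem_image_of_mem (LinearMap.toSpanSingleton ℝ ℂ (Complex.exp t)) hone
  rw [← LinearMap.coe_toAffineMap, image_segment] at himage
  simpa [Complex.exp_add, mul_comm] using himage

theorem integrable_cpIntegrand_of_segment (hγ : ContDiff ℝ 1 γ) {t : ℂ} {σ₁ σ₂ : ℝ}
    (hσ₁ : σ₁ ≤ 0) (hσ₂ : 0 ≤ σ₂) (hint₁ : Integrable (cpIntegrand w ħ γ (t + σ₁)))
    (hint₂ : Integrable (cpIntegrand w ħ γ (t + σ₂))) : Integrable (cpIntegrand w ħ γ t) := by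
  refine integrable_cpIntegrand_of_mem_convexHull hγ (S := {t + σ₁, t + σ₂}) ?_ ?_
  · rw [Finset.coe_pair, Set.image_pair, convexHull_pair]
    exact exp_mem_segment t hσ₁ hσ₂
  · simp only [Finset.mem_insert, Finset.mem_singleton]
    rintro τ (rfl | rfl)
    exacts [hint₁, hint₂]

theorem exists_finset_eventually_exp_mem_convexHull {U : Set ℂ} (hU : IsOpen U) {t : ℂ}
    (ht : t ∈ U) : ∃ S : Finset ℂ, (∀ τ ∈ S, τ ∈ U) ∧
      ∀ᶠ t' in 𝓝 t, Complex.exp t' ∈ convexHull ℝ (Complex.exp '' S) := by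
  classical
  obtain ⟨b, hb, hsub⟩ := exists_mem_interior_convexHull_affineBasis
    ((Complex.isOpenMap_exp U hU).mem_nhds (Set.mem_image_of_mem Complex.exp ht))
  choose τ hτ hτ_exp using fun j => hsub (subset_convexHull ℝ _ (Set.mem_range_self j))
  refine ⟨Finset.univ.image τ, by simpa using hτ, ?_⟩
  have himage : Complex.exp '' (Finset.univ.image τ : Finset ℂ) = Set.range b := by
    simp only [Finset.coe_image, Finset.coe_univ, Set.image_univ, ← Set.range_comp,
      Function.comp_def, hτ_exp]
  rw [himage]
  exact Complex.continuous_exp.continuousAt.eventually (mem_interior_iff_mem_nhds.mp hb)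

theorem locDominated_cpIntegrand (hγ : ContDiff ℝ 1 γ) {U : Set ℂ} (hU : IsOpen U)
    (hint : ∀ t ∈ U, Integrable (cpIntegrand w ħ γ t)) :
    LocDominated volume U (cpIntegrand w ħ γ) where
  holo y := (differentiable_cpIntegrand w ħ γ y).differentiableOn
  meas t _ := (continuous_cpIntegrand w ħ hγ t).aestronglyMeasurable
  bound t ht := by
    obtain ⟨S, hSU, hS⟩ := exists_finset_eventually_exp_mem_convexHull hU ht
    have hfactor : ∀ᶠ t' in 𝓝 t,
        ‖Complex.exp (w 0 * t' / ħ)‖ < ‖Complex.exp (w 0 * t / ħ)‖ + 1 :=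
      (by fun_prop : Continuous fun t' => ‖Complex.exp (w 0 * t' / ħ)‖).continuousAt.eventually
        (gt_mem_nhds (lt_add_one _))
    obtain ⟨δ, hδ, hball⟩ :=
      Metric.eventually_nhds_iff_ball.mp (hS.and (hfactor.and (hU.mem_nhds ht)))
    refine ⟨δ, hδ, fun t' ht' => (hball t' ht').2.2, fun y => (‖Complex.exp (w 0 * t / ħ)‖ + 1) *
      ∑ τ ∈ S, ‖Complex.exp (w 0 * τ / ħ)‖⁻¹ * ‖cpIntegrand w ħ γ τ y‖,
      (integrable_finsetSum S fun τ hτ => (hint τ (hSU τ hτ)).norm.const_mul _).const_mul _,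
      fun t' ht' y => ?_⟩
    obtain ⟨hmem, hlt, -⟩ := hball t' ht'
    exact (norm_cpIntegrand_le hmem y).trans
      (mul_le_mul_of_nonneg_right hlt.le (Finset.sum_nonneg fun _ _ => by positivity))

end Convergence

/-! ### Regularized integrands -/

/-- Polynomials in `ε`, `ε u_i` and `ε x / (u_1 ⋯ u_k)`, where `x = exp t₀`, as families of
functions of `log u` indexed by `ε`, together with their limit at `ε = 0`. The regularized integrals
are stable under integration by parts because symbols are stable under derivation. -/
inductive IsSymbol {k : ℕ} (t₀ : ℂ) : (ℝ → (Fin k → ℂ) → ℂ) → ℂ → Prop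
  | const (a : ℂ) : IsSymbol t₀ (fun _ _ => a) a
  | eps : IsSymbol t₀ (fun ε _ => (ε : ℂ)) 0
  | exp (i : Fin k) : IsSymbol t₀ (fun ε s => ε * Complex.exp (s i)) 0
  | quot : IsSymbol t₀ (fun ε s => ε * Complex.exp (t₀ - ∑ j, s j)) 0
  | add {Q Q' : ℝ → (Fin k → ℂ) → ℂ} {κ κ' : ℂ} : IsSymbol t₀ Q κ → IsSymbol t₀ Q' κ' →
      IsSymbol t₀ (fun ε s => Q ε s + Q' ε s) (κ + κ')
  | mul {Q Q' : ℝ → (Fin k → ℂ) → ℂ} {κ κ' : ℂ} : IsSymbol t₀ Q κ → IsSymbol t₀ Q' κ' →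
      IsSymbol t₀ (fun ε s => Q ε s * Q' ε s) (κ * κ')

namespace IsSymbol

variable {k : ℕ} {t₀ : ℂ} {Q : ℝ → (Fin k → ℂ) → ℂ} {κ : ℂ}

theorem contDiff (hQ : IsSymbol t₀ Q κ) (ε : ℝ) {n : WithTop ℕ∞} : ContDiff ℂ n (Q ε) := by
  induction hQ with
  | const a => exact contDiff_const
  | eps => exact contDiff_const
  | exp i => fun_prop
  | quot => fun_prop
  | add _ _ ih ih' => exact ih.add ih'
  | mul _ _ ih ih' => exact ih.mul ih'

theorem differentiable (hQ : IsSymbol t₀ Q κ) (ε : ℝ) : Differentiable ℂ (Q ε) :=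
  (hQ.contDiff ε).differentiable one_ne_zero

theorem tendsto (hQ : IsSymbol t₀ Q κ) (s : Fin k → ℂ) :
    Tendsto (fun ε => Q ε s) (𝓝 0) (𝓝 κ) := by
  have hε : Tendsto (fun ε : ℝ => (ε : ℂ)) (𝓝 0) (𝓝 0) := by
    simpa using Complex.continuous_ofReal.tendsto 0
  induction hQ with
  | const a => exact tendsto_const_nhds
  | eps => exact hε
  | exp i => simpa using hε.mul_const (Complex.exp (s i))
  | quot => simpa using hε.mul_const (Complex.exp (t₀ - ∑ j, s j))
  | add _ _ ih ih' => exact ih.add ih'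
  | mul _ _ ih ih' => exact ih.mul ih'

theorem exists_partialDeriv (hQ : IsSymbol t₀ Q κ) (i : Fin k) :
    ∃ Q', IsSymbol t₀ Q' 0 ∧ ∀ ε s, partialDeriv (Q ε) i s = Q' ε s := by
  induction hQ with
  | const a => exact ⟨_, const 0, fun _ _ => partialDeriv_const _ _ _⟩
  | eps => exact ⟨_, const 0, fun _ _ => partialDeriv_const _ _ _⟩
  | exp j =>
    refine ⟨_, by simpa only [mul_zero] using (const (if j = i then 1 else 0)).mul (exp j),
      fun ε s => ?_⟩
    rw [partialDeriv_const_mul (by fun_prop), partialDeriv_exp (by fun_prop), partialDeriv_coord]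
    ring
  | quot =>
    refine ⟨_, by simpa only [mul_zero] using (const (-1)).mul quot, fun ε s => ?_⟩
    rw [partialDeriv_const_mul (by fun_prop), partialDeriv_exp (by fun_prop),
      partialDeriv_const_sub_sum]
    ring
  | add hQ hQ' ih ih' =>
    obtain ⟨R, hR, hQR⟩ := ih
    obtain ⟨R', hR', hQR'⟩ := ih'
    refine ⟨_, by simpa only [add_zero] using hR.add hR', fun ε s => ?_⟩
    rw [partialDeriv_add (hQ.differentiable ε s) (hQ'.differentiable ε s), hQR, hQR']
  | mul hQ hQ' ih ih' =>
    obtain ⟨R, hR, hQR⟩ := ih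
    obtain ⟨R', hR', hQR'⟩ := ih'
    refine ⟨_, by simpa only [mul_zero, zero_mul, add_zero] using (hQ.mul hR').add (hR.mul hQ'),
      fun ε s => ?_⟩
    rw [partialDeriv_mul (hQ.differentiable ε s) (hQ'.differentiable ε s), hQR, hQR']

theorem exists_norm_le (hQ : IsSymbol t₀ Q κ) {E : Type*} [NormedAddCommGroup E]
    {γ : E → (Fin k → ℂ)} {C : ℝ} (hC₀ : 0 ≤ C)
    (hC : ∀ y, MonomialsBoundedBy t₀ (C * (1 + ‖y‖ ^ 2)) (γ y)) :
    ∃ A : ℝ, 0 ≤ A ∧ ∃ d : ℕ, ∀ ε : ℝ, 0 < ε → ∀ y,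
      ‖Q ε (γ y)‖ ≤ A * (1 + ε * (1 + ‖y‖ ^ 2)) ^ d := by
  have hε_mul {K : ℝ} (hK : 0 ≤ K) {z : ℂ} {ε : ℝ} {y : E} (hε : 0 < ε)
      (hz : ‖z‖ ≤ K * (1 + ‖y‖ ^ 2)) : ‖(ε : ℂ) * z‖ ≤ K * (1 + ε * (1 + ‖y‖ ^ 2)) ^ 1 := by
    rw [norm_mul, Complex.norm_real, Real.norm_of_nonneg hε.le, pow_one]
    linarith [mul_le_mul_of_nonneg_left hz hε.le]
  have hone (ε : ℝ) (hε : 0 < ε) (y : E) : 1 ≤ 1 + ε * (1 + ‖y‖ ^ 2) :=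
    le_add_of_nonneg_right (by positivity)
  induction hQ with
  | const a => exact ⟨‖a‖, norm_nonneg _, 0, fun _ _ _ => by simp⟩
  | eps =>
    exact ⟨1, one_pos.le, 1, fun ε hε y => by
      simpa using hε_mul one_pos.le (z := 1) (y := y) hε (by simp)⟩
  | exp i => exact ⟨C, hC₀, 1, fun ε hε y => hε_mul hC₀ hε ((hC y).1 i)⟩
  | quot => exact ⟨C, hC₀, 1, fun ε hε y => hε_mul hC₀ hε (hC y).2⟩
  | add _ _ ih ih' =>
    obtain ⟨A, hA, d, hle⟩ := ih
    obtain ⟨A', hA', d', hle'⟩ := ih'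
    refine ⟨A + A', by positivity, d + d', fun ε hε y => (norm_add_le _ _).trans ?_⟩
    rw [add_mul]
    gcongr
    · exact (hle ε hε y).trans (by gcongr; exacts [hone ε hε y, d.le_add_right d'])
    · exact (hle' ε hε y).trans (by gcongr; exacts [hone ε hε y, d'.le_add_left d])
  | mul _ _ ih ih' =>
    obtain ⟨A, hA, d, hle⟩ := ih
    obtain ⟨A', hA', d', hle'⟩ := ih'
    refine ⟨A * A', by positivity, d + d', fun ε hε y => ?_⟩
    rw [norm_mul, pow_add, mul_mul_mul_comm]
    exact mul_le_mul (hle ε hε y) (hle' ε hε y) (norm_nonneg _) (by positivity)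

end IsSymbol

section Regularization

variable {k : ℕ}

/-- The function `exp (ε (f - f c) / ħ)`, which is `exp (- ε ‖y‖ ^ 2)` on a thimble of `f`. -/
noncomputable def regularizer (f : (Fin k → ℂ) → ℂ) (ħ : ℂ) (c : Fin k → ℂ) (ε : ℝ)
    (s : Fin k → ℂ) : ℂ := Complex.exp (ε / ħ * (f s - f c))

/-- The monomial `∏_{i ∈ A} u_i`. -/
noncomputable def expMonomial (A : List (Fin k)) (s : Fin k → ℂ) : ℂ :=
  (A.map fun i => Complex.exp (s i)).prod

/-- The regularized weight `u_A exp (ε (W - W c) / ħ) Q`, which is bounded on the thimble. -/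
noncomputable def regWeight (w : Fin (k + 1) → ℂ) (ħ t₀ : ℂ) (c : Fin k → ℂ) (A : List (Fin k))
    (Q : ℝ → (Fin k → ℂ) → ℂ) (ε : ℝ) (s : Fin k → ℂ) : ℂ :=
  expMonomial A s * (regularizer (cpPotential w t₀) ħ c ε s * Q ε s)

theorem expMonomial_cons (i : Fin k) (A : List (Fin k)) :
    expMonomial (i :: A) = fun s => Complex.exp (s i) * expMonomial A s :=
  funext fun _ => by simp only [expMonomial, List.map_cons, List.prod_cons]

theorem expMonomial_finRange (s : Fin k → ℂ) :
    expMonomial (List.finRange k) s = Complex.exp (∑ i, s i) := by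
  rw [expMonomial, Complex.exp_sum, ← List.ofFn_eq_map, List.prod_ofFn]

theorem contDiff_expMonomial (A : List (Fin k)) {n : WithTop ℕ∞} :
    ContDiff ℂ n (expMonomial A) := by
  induction A with
  | nil => exact contDiff_const
  | cons i A ih =>
    rw [expMonomial_cons]
    fun_prop

theorem partialDeriv_expMonomial {A : List (Fin k)} {i : Fin k} (hi : i ∉ A) (s : Fin k → ℂ) :
    partialDeriv (expMonomial A) i s = 0 := by
  induction A with
  | nil => exact partialDeriv_const 1 i s
  | cons j A ih =>
    rw [List.mem_cons, not_or] at hi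
    rw [expMonomial_cons, partialDeriv_mul (by fun_prop)
      ((contDiff_expMonomial A).differentiable one_ne_zero s), ih hi.2,
      partialDeriv_exp (by fun_prop), partialDeriv_coord, if_neg (Ne.symm hi.1)]
    simp

theorem norm_expMonomial_le (A : List (Fin k)) {s : Fin k → ℂ} {B : ℝ}
    (hB : ∀ i, ‖Complex.exp (s i)‖ ≤ B) : ‖expMonomial A s‖ ≤ B ^ A.length := by
  induction A with
  | nil => simp [expMonomial]
  | cons j A ih =>
    rw [expMonomial_cons, norm_mul, List.length_cons, pow_succ']
    exact mul_le_mul (hB j) ih (norm_nonneg _) ((norm_nonneg _).trans (hB j))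

theorem contDiff_regularizer {f : (Fin k → ℂ) → ℂ} {n : WithTop ℕ∞} (hf : ContDiff ℂ n f)
    (ħ : ℂ) (c : Fin k → ℂ) (ε : ℝ) : ContDiff ℂ n (regularizer f ħ c ε) := by
  unfold regularizer
  fun_prop

theorem tendsto_regularizer (f : (Fin k → ℂ) → ℂ) (ħ : ℂ) (c s : Fin k → ℂ) :
    Tendsto (fun ε => regularizer f ħ c ε s) (𝓝 0) (𝓝 1) := by
  have hcont : Continuous fun ε => regularizer f ħ c ε s := by
    unfold regularizer
    fun_prop
  simpa [regularizer] using hcont.tendsto 0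

theorem partialDeriv_regularizer {f : (Fin k → ℂ) → ℂ} {s : Fin k → ℂ}
    (hf : DifferentiableAt ℂ f s) (ħ : ℂ) (c : Fin k → ℂ) (ε : ℝ) (i : Fin k) :
    partialDeriv (regularizer f ħ c ε) i s =
      ε / ħ * partialDeriv f i s * regularizer f ħ c ε s := by
  have hsub : partialDeriv (fun s => f s - f c) i s = partialDeriv f i s :=
    partialDeriv_eq_of_hasFDerivAt (hf.hasFDerivAt.sub_const (f c)) i
  rw [← hsub, ← partialDeriv_const_mul (hf.sub_const _)]
  exact partialDeriv_exp ((hf.sub_const _).const_mul (ε / ħ : ℂ)) i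

theorem IsLefschetzThimble.regularizer_eq {f : (Fin k → ℂ) → ℂ} {ħ : ℂ} {c : Fin k → ℂ}
    {γ : EuclideanSpace ℝ (Fin k) → (Fin k → ℂ)} (hγ : IsLefschetzThimble f ħ c γ) (hħ : ħ ≠ 0)
    (ε : ℝ) (y : EuclideanSpace ℝ (Fin k)) :
    regularizer f ħ c ε (γ y) = (Real.exp (-(ε * ‖y‖ ^ 2)) : ℂ) := by
  rw [regularizer, hγ.level]
  push_cast
  congr 1
  field_simp
  ring

theorem one_add_pow_mul_exp_neg_le (n : ℕ) {x : ℝ} (hx : 0 ≤ x) :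
    (1 + x) ^ n * Real.exp (-x) ≤ n.factorial * Real.exp 1 := by
  have hpow := Real.pow_div_factorial_le_exp (x := 1 + x) (by linarith) n
  rw [div_le_iff₀ (by positivity), Real.exp_add] at hpow
  rw [Real.exp_neg, ← div_eq_mul_inv, div_le_iff₀ (Real.exp_pos x)]
  linarith

variable {w : Fin (k + 1) → ℂ} {ħ t₀ : ℂ} {c : Fin k → ℂ}
  {γ : EuclideanSpace ℝ (Fin k) → (Fin k → ℂ)} {Q : ℝ → (Fin k → ℂ) → ℂ} {κ : ℂ}

theorem contDiff_regWeight (hQ : IsSymbol t₀ Q κ) (A : List (Fin k)) (ε : ℝ) {n : WithTop ℕ∞} :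
    ContDiff ℂ n (regWeight w ħ t₀ c A Q ε) :=
  (contDiff_expMonomial A).mul
    ((contDiff_regularizer (contDiff_cpPotential w t₀) ħ c ε).mul (hQ.contDiff ε))

theorem tendsto_regWeight_nil (hQ : IsSymbol t₀ Q κ) (s : Fin k → ℂ) :
    Tendsto (fun ε => regWeight w ħ t₀ c [] Q ε s) (𝓝 0) (𝓝 κ) := by
  simpa [regWeight, expMonomial] using
    (tendsto_regularizer (cpPotential w t₀) ħ c s).mul (hQ.tendsto s)

theorem IsSymbol.exists_partialDeriv_regularizer_mul (hQ : IsSymbol t₀ Q κ) (w : Fin (k + 1) → ℂ)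
    (ħ : ℂ) (c : Fin k → ℂ) (i : Fin k) :
    ∃ Q', IsSymbol t₀ Q' 0 ∧ ∀ ε s,
      partialDeriv (fun s => regularizer (cpPotential w t₀) ħ c ε s * Q ε s) i s =
        regularizer (cpPotential w t₀) ħ c ε s * Q' ε s := by
  obtain ⟨R, hR, hQR⟩ := hQ.exists_partialDeriv i
  have hpotential := ((IsSymbol.exp (t₀ := t₀) i).add
    ((IsSymbol.const (w i.succ - w 0)).mul IsSymbol.eps)).add
      ((IsSymbol.const (-1)).mul IsSymbol.quot)
  have hR' := hR.add (((IsSymbol.const ħ⁻¹).mul hpotential).mul hQ)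
  simp only [mul_zero, zero_mul, add_zero] at hR'
  refine ⟨_, hR', fun ε s => ?_⟩
  have hf : Differentiable ℂ (cpPotential w t₀) :=
    (contDiff_cpPotential w t₀ (n := 1)).differentiable one_ne_zero
  rw [partialDeriv_mul ((contDiff_regularizer (contDiff_cpPotential w t₀) ħ c ε).differentiable
    one_ne_zero s) (hQ.differentiable ε s), hQR, partialDeriv_regularizer (hf s),
    partialDeriv_cpPotential]
  ring

theorem IsSymbol.exists_partialDeriv_regWeight (hQ : IsSymbol t₀ Q κ) (w : Fin (k + 1) → ℂ)
    (ħ : ℂ) (c : Fin k → ℂ) {A : List (Fin k)} {i : Fin k} (hi : i ∉ A) :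
    ∃ Q', IsSymbol t₀ Q' 0 ∧ ∀ ε s,
      partialDeriv (regWeight w ħ t₀ c A Q ε) i s = regWeight w ħ t₀ c A Q' ε s := by
  obtain ⟨Q', hQ', hQQ'⟩ := hQ.exists_partialDeriv_regularizer_mul w ħ c i
  refine ⟨Q', hQ', fun ε s => ?_⟩
  have hreg : Differentiable ℂ fun s => regularizer (cpPotential w t₀) ħ c ε s * Q ε s :=
    ((contDiff_regularizer (contDiff_cpPotential w t₀) ħ c ε).differentiable one_ne_zero).mul
      (hQ.differentiable ε)
  change partialDeriv (fun s => expMonomial A s * (_ * Q ε s)) i s = _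
  rw [partialDeriv_mul ((contDiff_expMonomial A).differentiable one_ne_zero s) (hreg s),
    partialDeriv_expMonomial hi, hQQ', zero_mul, add_zero, regWeight]

theorem IsSymbol.exists_pow_mul_norm_le (hQ : IsSymbol t₀ Q κ)
    (hγ : IsLefschetzThimble (cpPotential w t₀) ħ c γ) (hħ : ħ ≠ 0) (m : ℕ) :
    ∃ B : ℝ, ∀ ε : ℝ, 0 < ε → ε ≤ 1 → ∀ y, (ε * (1 + ‖y‖ ^ 2)) ^ m *
      ‖regularizer (cpPotential w t₀) ħ c ε (γ y) * Q ε (γ y)‖ ≤ B := by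
  obtain ⟨C, hC₀, hC⟩ := hγ.exists_monomialsBoundedBy hħ
  obtain ⟨A, hA, d, hle⟩ := hQ.exists_norm_le hC₀ hC
  refine ⟨A * (Real.exp 1 * ((m + d).factorial * Real.exp 1)), fun ε hε hε₁ y => ?_⟩
  set x := ε * (1 + ‖y‖ ^ 2)
  have hx₀ : 0 ≤ x := by positivity
  have hexp : Real.exp (-(ε * ‖y‖ ^ 2)) ≤ Real.exp 1 * Real.exp (-x) := by
    rw [← Real.exp_add, Real.exp_le_exp]
    linarith
  rw [norm_mul, hγ.regularizer_eq hħ, Complex.norm_real, Real.norm_of_nonneg (Real.exp_pos _).le]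
  calc x ^ m * (Real.exp (-(ε * ‖y‖ ^ 2)) * ‖Q ε (γ y)‖)
      ≤ (1 + x) ^ m * (Real.exp 1 * Real.exp (-x) * (A * (1 + x) ^ d)) := by
        gcongr
        exacts [le_add_of_nonneg_left zero_le_one, hle ε hε y]
    _ = A * (Real.exp 1 * ((1 + x) ^ (m + d) * Real.exp (-x))) := by ring
    _ ≤ _ := by
        have := one_add_pow_mul_exp_neg_le (m + d) hx₀
        gcongr

theorem IsLefschetzThimble.exists_one_add_norm_sq_mul_norm_regWeight_le
    (hγ : IsLefschetzThimble (cpPotential w t₀) ħ c γ) (hħ : ħ ≠ 0) (hQ : IsSymbol t₀ Q κ)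
    (A : List (Fin k)) {ε : ℝ} (hε : ε ∈ Set.Ioc 0 1) :
    ∃ B : ℝ, ∀ y, (1 + ‖y‖ ^ 2) * ‖regWeight w ħ t₀ c A Q ε (γ y)‖ ≤ B := by
  obtain ⟨hε₀, hε₁⟩ := hε
  obtain ⟨C, hC₀, hC⟩ := hγ.exists_monomialsBoundedBy hħ
  obtain ⟨B, hB⟩ := hQ.exists_pow_mul_norm_le hγ hħ (A.length + 1)
  refine ⟨C ^ A.length * (ε ^ (A.length + 1))⁻¹ * B, fun y => ?_⟩
  rw [regWeight, norm_mul]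
  set R := ‖regularizer (cpPotential w t₀) ħ c ε (γ y) * Q ε (γ y)‖
  calc (1 + ‖y‖ ^ 2) * (‖expMonomial A (γ y)‖ * R)
      ≤ (1 + ‖y‖ ^ 2) * ((C * (1 + ‖y‖ ^ 2)) ^ A.length * R) := by
        have := norm_expMonomial_le A (hC y).1
        gcongr
    _ = C ^ A.length * (ε ^ (A.length + 1))⁻¹ * ((ε * (1 + ‖y‖ ^ 2)) ^ (A.length + 1) * R) := by
        have hε_pow : ε ^ (A.length + 1) ≠ 0 := by positivity
        rw [mul_pow, mul_pow, pow_succ (1 + ‖y‖ ^ 2)]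
        field_simp
    _ ≤ _ := mul_le_mul_of_nonneg_left (hB ε hε₀ hε₁ y) (by positivity)

theorem IsLefschetzThimble.exists_norm_regWeight_le
    (hγ : IsLefschetzThimble (cpPotential w t₀) ħ c γ) (hħ : ħ ≠ 0) (hQ : IsSymbol t₀ Q κ)
    (A : List (Fin k)) {ε : ℝ} (hε : ε ∈ Set.Ioc 0 1) :
    ∃ B : ℝ, ∀ y, ‖regWeight w ħ t₀ c A Q ε (γ y)‖ ≤ B := by
  obtain ⟨B, hB⟩ := hγ.exists_one_add_norm_sq_mul_norm_regWeight_le hħ hQ A hε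
  exact ⟨B, fun y => (le_mul_of_one_le_left (norm_nonneg _)
    (le_add_of_nonneg_right (sq_nonneg _))).trans (hB y)⟩

end Regularization

/-! ### The differential equation of projective space -/

section ProjectiveSpace

variable {k : ℕ} {w : Fin (k + 1) → ℂ} {ħ t₀ : ℂ} {c : Fin k → ℂ}
  {γ : EuclideanSpace ℝ (Fin k) → (Fin k → ℂ)} {Q : ℝ → (Fin k → ℂ) → ℂ} {κ : ℂ}

theorem partialDeriv_mul_exp_cpPotential_div (hħ : ħ ≠ 0) {g : (Fin k → ℂ) → ℂ} {s : Fin k → ℂ}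
    (hg : DifferentiableAt ℂ g s) (w : Fin (k + 1) → ℂ) (t : ℂ) (i : Fin k) :
    partialDeriv (fun s => g s * Complex.exp (cpPotential w t s / ħ)) i s =
      ħ⁻¹ * (ħ * partialDeriv g i s + Complex.exp (s i) * g s -
        g s * (Complex.exp (t - ∑ j, s j) + w 0 - w i.succ)) *
          Complex.exp (cpPotential w t s / ħ) := by
  have hpot : DifferentiableAt ℂ (cpPotential w t) s :=
    (contDiff_cpPotential w t (n := 1)).differentiable one_ne_zero s
  simp only [div_eq_inv_mul]
  rw [partialDeriv_mul hg (hpot.const_mul _).cexp, partialDeriv_exp (hpot.const_mul _),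
    partialDeriv_const_mul hpot, partialDeriv_cpPotential]
  field_simp
  ring

theorem IsLefschetzThimble.integral_partialDeriv_mul_cpIntegrand
    (hγ : IsLefschetzThimble (cpPotential w t₀) ħ c γ) (hħ : ħ ≠ 0) {t : ℂ}
    (hint : Integrable (cpIntegrand w ħ γ t)) {g : (Fin k → ℂ) → ℂ} (hg : ContDiff ℂ 2 g) {B : ℝ}
    (hB : ∀ y, (1 + ‖y‖ ^ 2) * ‖g (γ y)‖ ≤ B) (i : Fin k)
    (hint' : Integrable fun y => (ħ * partialDeriv g i (γ y) + Complex.exp (γ y i) * g (γ y) -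
      g (γ y) * (Complex.exp (t - ∑ j, γ y j) + w 0 - w i.succ)) * cpIntegrand w ħ γ t y) :
    ∫ y, (ħ * partialDeriv g i (γ y) + Complex.exp (γ y i) * g (γ y) -
      g (γ y) * (Complex.exp (t - ∑ j, γ y j) + w 0 - w i.succ)) * cpIntegrand w ħ γ t y = 0 := by
  set Φ : (Fin k → ℂ) → ℂ := fun s => g s * Complex.exp (cpPotential w t s / ħ) with hΦ
  have hΦ_smooth : ContDiff ℂ 2 Φ := hg.mul ((contDiff_cpPotential w t).div_const ħ).cexp
  have hγ₁ : ContDiff ℝ 1 γ := contDiff_infty.mp hγ.smooth 1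
  have hpartial (y : EuclideanSpace ℝ (Fin k)) : partialDeriv Φ i (γ y) * formDensity γ y =
      ħ⁻¹ * ((ħ * partialDeriv g i (γ y) + Complex.exp (γ y i) * g (γ y) -
        g (γ y) * (Complex.exp (t - ∑ j, γ y j) + w 0 - w i.succ)) * cpIntegrand w ħ γ t y) := by
    rw [hΦ, partialDeriv_mul_exp_cpPotential_div hħ (hg.differentiable two_ne_zero _), cpIntegrand]
    ring
  obtain ⟨C, hC⟩ := hγ.exists_sqrt_gradNormSq_le hħ
  have hzero := hγ.integral_partialDeriv_eq_zero hħ (contDiff_cpPotential w t₀) hΦ_smooth i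
    (fun y => (norm_partialDeriv_le_sqrt_gradNormSq _ _ i).trans (hC y)) ?_ ?_
  · simpa only [hpartial, integral_const_mul, mul_eq_zero, inv_eq_zero, hħ, false_or] using hzero
  · refine (hint.norm.const_mul B).mono' (Continuous.aestronglyMeasurable ?_)
      (Eventually.of_forall fun y => ?_)
    · exact (by fun_prop : Continuous fun y : EuclideanSpace ℝ (Fin k) => 1 + ‖y‖ ^ 2).mul
        ((hΦ_smooth.continuous.comp hγ₁.continuous).mul (continuous_formDensity hγ₁)).norm
    · rw [hΦ, mul_assoc, ← cpIntegrand, norm_mul, norm_norm, norm_mul, ← mul_assoc,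
        Real.norm_of_nonneg (by positivity)]
      exact mul_le_mul_of_nonneg_right (hB y) (norm_nonneg _)
  · simp only [hpartial]
    exact hint'.const_mul ħ⁻¹

variable {U : Set ℂ}

theorem IsLefschetzThimble.locDominated_regWeight
    (hγ : IsLefschetzThimble (cpPotential w t₀) ħ c γ) (hħ : ħ ≠ 0) (hU : IsOpen U)
    (hint : ∀ t ∈ U, Integrable (cpIntegrand w ħ γ t)) (hQ : IsSymbol t₀ Q κ) (A : List (Fin k))
    {ε : ℝ} (hε : ε ∈ Set.Ioc 0 1) :
    LocDominated volume U fun t y => regWeight w ħ t₀ c A Q ε (γ y) * cpIntegrand w ħ γ t y := by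
  obtain ⟨B, hB⟩ := hγ.exists_norm_regWeight_le hħ hQ A hε
  exact (locDominated_cpIntegrand (contDiff_infty.mp hγ.smooth 1) hU hint).bdd_mul
    ((contDiff_regWeight hQ A ε (n := 0)).continuous.comp
      hγ.smooth.continuous).aestronglyMeasurable hB

theorem firstOrder_mul_cpIntegrand (hħ : ħ ≠ 0) (a b : ℂ) (t : ℂ)
    (y : EuclideanSpace ℝ (Fin k)) :
    firstOrder ħ (-b) (fun t => a * cpIntegrand w ħ γ t y) t =
      a * (Complex.exp (t - ∑ j, γ y j) + w 0 - b) * cpIntegrand w ħ γ t y := by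
  rw [firstOrder, ((hasDerivAt_cpIntegrand w ħ γ t y).const_mul a).deriv]
  field_simp
  ring

/- Multiplication by `u_i` amounts to applying `ŷ - w_i`, up to a correction that vanishes in the
limit `ε → 0`. -/
theorem IsLefschetzThimble.integral_regWeight_cons
    (hγ : IsLefschetzThimble (cpPotential w t₀) ħ c γ) (hħ : ħ ≠ 0) (hU : IsOpen U)
    (hint : ∀ t ∈ U, Integrable (cpIntegrand w ħ γ t)) (hQ : IsSymbol t₀ Q κ)
    {A : List (Fin k)} {i : Fin k} {Q' : ℝ → (Fin k → ℂ) → ℂ} {κ' : ℂ} (hQ' : IsSymbol t₀ Q' κ')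
    (hQQ' : ∀ ε s, partialDeriv (regWeight w ħ t₀ c A Q ε) i s = regWeight w ħ t₀ c A Q' ε s)
    {ε : ℝ} (hε : ε ∈ Set.Ioc 0 1) {t : ℂ} (ht : t ∈ U) :
    ∫ y, regWeight w ħ t₀ c (i :: A) Q ε (γ y) * cpIntegrand w ħ γ t y =
      firstOrder ħ (-w i.succ)
        (fun t => ∫ y, regWeight w ħ t₀ c A Q ε (γ y) * cpIntegrand w ħ γ t y) t -
      ħ * ∫ y, regWeight w ħ t₀ c A Q' ε (γ y) * cpIntegrand w ħ γ t y := by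
  have hdom := hγ.locDominated_regWeight hħ hU hint hQ A hε
  have hI_cons := (hγ.locDominated_regWeight hħ hU hint hQ (i :: A) hε).integrable ht
  have hI_firstOrder := (hdom.firstOrder hU ħ (-w i.succ)).integrable ht
  have hI' := ((hγ.locDominated_regWeight hħ hU hint hQ' A hε).integrable ht).const_mul ħ
  obtain ⟨B, hB⟩ := hγ.exists_one_add_norm_sq_mul_norm_regWeight_le hħ hQ A hε
  have hpoint (y : EuclideanSpace ℝ (Fin k)) :
      (ħ * partialDeriv (regWeight w ħ t₀ c A Q ε) i (γ y) +
        Complex.exp (γ y i) * regWeight w ħ t₀ c A Q ε (γ y) - regWeight w ħ t₀ c A Q ε (γ y) *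
          (Complex.exp (t - ∑ j, γ y j) + w 0 - w i.succ)) * cpIntegrand w ħ γ t y =
      ħ * (regWeight w ħ t₀ c A Q' ε (γ y) * cpIntegrand w ħ γ t y) +
        regWeight w ħ t₀ c (i :: A) Q ε (γ y) * cpIntegrand w ħ γ t y - firstOrder ħ (-w i.succ)
          (fun t => regWeight w ħ t₀ c A Q ε (γ y) * cpIntegrand w ħ γ t y) t := by
    rw [hQQ', firstOrder_mul_cpIntegrand hħ, regWeight, regWeight, regWeight, expMonomial_cons]
    ring
  have hI_sum := hI'.fun_add hI_cons
  have hstokes := hγ.integral_partialDeriv_mul_cpIntegrand hħ (hint t ht)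
    (contDiff_regWeight hQ A ε) hB i (by
      simp only [hpoint]
      exact hI_sum.sub hI_firstOrder)
  simp only [hpoint] at hstokes
  rw [integral_sub hI_sum hI_firstOrder, integral_add hI' hI_cons, integral_const_mul] at hstokes
  rw [hdom.firstOrder_integral hU ħ (-w i.succ) ht]
  linear_combination hstokes

theorem tendstoLocallyUniformlyOn_firstOrder {ι : Type*} {φ : Filter ι}
    {F : ι → ℂ → ℂ} {G : ℂ → ℂ} (h : TendstoLocallyUniformlyOn F G φ U) (hU : IsOpen U)
    (hF : ∀ᶠ n in φ, DifferentiableOn ℂ (F n) U) (a b : ℂ) :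
    TendstoLocallyUniformlyOn (fun n => firstOrder a b (F n)) (firstOrder a b G) φ U :=
  ((ContinuousLinearMap.mul ℂ ℂ a).uniformContinuous.comp_tendstoLocallyUniformlyOn
    (h.deriv hF hU)).add
      ((ContinuousLinearMap.mul ℂ ℂ b).uniformContinuous.comp_tendstoLocallyUniformlyOn h)

theorem IsLefschetzThimble.tendstoLocallyUniformlyOn_integral_regWeight_nil
    (hγ : IsLefschetzThimble (cpPotential w t₀) ħ c γ) (hħ : ħ ≠ 0) (hU : IsOpen U)
    (hint : ∀ t ∈ U, Integrable (cpIntegrand w ħ γ t)) (hQ : IsSymbol t₀ Q κ) :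
    TendstoLocallyUniformlyOn
      (fun ε t => ∫ y, regWeight w ħ t₀ c [] Q ε (γ y) * cpIntegrand w ħ γ t y)
      (fun t => κ * cpIntegral w ħ γ t) (𝓝[>] 0) U := by
  obtain ⟨B, hB⟩ := hQ.exists_pow_mul_norm_le hγ hħ 0
  refine (locDominated_cpIntegrand (contDiff_infty.mp hγ.smooth
    1) hU hint).tendstoLocallyUniformlyOn_integral_mul (C := B)
      (Eventually.of_forall fun ε => ?_) ?_ fun y => ?_
  · exact ((contDiff_regWeight hQ [] ε (n := 0)).continuous.comp
      hγ.smooth.continuous).aestronglyMeasurable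
  · filter_upwards [Ioc_mem_nhdsGT one_pos] with ε hε y
    simpa [regWeight, expMonomial] using hB ε hε.1 hε.2 y
  · exact (tendsto_regWeight_nil hQ (γ y)).mono_left nhdsWithin_le_nhds

theorem IsLefschetzThimble.tendstoLocallyUniformlyOn_integral_regWeight
    (hγ : IsLefschetzThimble (cpPotential w t₀) ħ c γ) (hħ : ħ ≠ 0) (hU : IsOpen U)
    (hint : ∀ t ∈ U, Integrable (cpIntegrand w ħ γ t)) (hQ : IsSymbol t₀ Q κ)
    {A : List (Fin k)} (hA : A.Nodup) :
    TendstoLocallyUniformlyOn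
      (fun ε t => ∫ y, regWeight w ħ t₀ c A Q ε (γ y) * cpIntegrand w ħ γ t y)
      (fun t => κ * firstOrderProd (A.map fun i => (ħ, -w i.succ)) (cpIntegral w ħ γ) t)
      (𝓝[>] 0) U := by
  induction A generalizing Q κ with
  | nil => exact hγ.tendstoLocallyUniformlyOn_integral_regWeight_nil hħ hU hint hQ
  | cons i A ih =>
    rw [List.nodup_cons] at hA
    have hε : ∀ᶠ ε : ℝ in 𝓝[>] 0, ε ∈ Set.Ioc 0 1 := Ioc_mem_nhdsGT one_pos
    obtain ⟨Q', hQ', hQQ'⟩ := hQ.exists_partialDeriv_regWeight w ħ c hA.1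
    have hmain := tendstoLocallyUniformlyOn_firstOrder (ih hQ hA.2) hU (hε.mono fun ε hε =>
      (hγ.locDominated_regWeight hħ hU hint hQ A hε).differentiableOn_integral hU) ħ (-w i.succ)
    have hcorrection := (ContinuousLinearMap.mul ℂ ℂ
      ħ).uniformContinuous.comp_tendstoLocallyUniformlyOn (ih hQ' hA.2)
    refine ((hmain.sub hcorrection).congr_inseparable (hε.mono fun ε hε t ht =>
      .of_eq ?_)).congr_right fun t _ => ?_
    · exact (hγ.integral_regWeight_cons hħ hU hint hQ hQ' hQQ' hε ht).symm
    · simp only [Pi.sub_apply, Function.comp_apply, ContinuousLinearMap.mul_apply', zero_mul,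
        mul_zero, sub_zero, List.map_cons, firstOrderProd, firstOrder, deriv_const_mul_field]
      ring

theorem IsLefschetzThimble.firstOrder_integral_regWeight_finRange
    (hγ : IsLefschetzThimble (cpPotential w t₀) ħ c γ) (hħ : ħ ≠ 0) (hU : IsOpen U)
    (hint : ∀ t ∈ U, Integrable (cpIntegrand w ħ γ t)) (hQ : IsSymbol t₀ Q κ) {ε : ℝ}
    (hε : ε ∈ Set.Ioc 0 1) {t : ℂ} (ht : t ∈ U) :
    firstOrder ħ (-w 0) (fun t => ∫ y, regWeight w ħ t₀ c (List.finRange k) Q ε (γ y) *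
        cpIntegrand w ħ γ t y) t =
      Complex.exp t * ∫ y, regWeight w ħ t₀ c [] Q ε (γ y) * cpIntegrand w ħ γ t y := by
  rw [(hγ.locDominated_regWeight hħ hU hint hQ _ hε).firstOrder_integral hU _ _ ht,
    ← integral_const_mul]
  congr 1 with y
  have hexp : Complex.exp t = Complex.exp (∑ j, γ y j) * Complex.exp (t - ∑ j, γ y j) := by
    rw [← Complex.exp_add, add_sub_cancel]
  rw [firstOrder_mul_cpIntegrand hħ, regWeight, expMonomial_finRange, regWeight,
    add_sub_cancel_right, hexp]
  simp only [expMonomial, List.map_nil, List.prod_nil]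
  ring

theorem IsLefschetzThimble.cpGKZ_cpIntegral (hγ : IsLefschetzThimble (cpPotential w t₀) ħ c γ)
    (hħ : ħ ≠ 0) (hU : IsOpen U) (hint : ∀ t ∈ U, Integrable (cpIntegrand w ħ γ t)) :
    ∀ t ∈ U, cpGKZ w ħ (cpIntegral w ħ γ) t = 0 := by
  intro t ht
  have hε : ∀ᶠ ε : ℝ in 𝓝[>] 0, ε ∈ Set.Ioc 0 1 := Ioc_mem_nhdsGT one_pos
  have hQ : IsSymbol (k := k) t₀ (fun _ _ => 1) 1 := IsSymbol.const 1
  have hleft := (tendstoLocallyUniformlyOn_firstOrder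
    (hγ.tendstoLocallyUniformlyOn_integral_regWeight hħ hU hint hQ (List.nodup_finRange k)) hU
    (hε.mono fun ε hε => (hγ.locDominated_regWeight hħ hU hint hQ _ hε).differentiableOn_integral
      hU) ħ (-w 0)).tendsto_at ht
  have hright := ((hγ.tendstoLocallyUniformlyOn_integral_regWeight_nil hħ hU hint hQ).tendsto_at
    ht).const_mul (Complex.exp t)
  have hlim := tendsto_nhds_unique (hleft.congr' (hε.mono fun ε hε =>
    hγ.firstOrder_integral_regWeight_finRange hħ hU hint hQ hε ht)) hright
  simp only [one_mul] at hlim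
  rw [cpGKZ, wProd_eq_firstOrderProd, List.finRange_succ, List.map_cons, List.map_map, xHat,
    sub_eq_zero]
  exact hlim

end ProjectiveSpace

/-! ### Interior estimates along horizontal lines -/

/-- Test functions for weak estimates on `[0, 1]`: they vanish near `1` but not at `0`, so that
integration by parts produces a boundary value at `0` only. -/
structure IsTest (q : ℝ → ℂ) : Prop where
  contDiff : ContDiff ℝ (⊤ : ℕ∞) q
  eventuallyEq_zero : q =ᶠ[𝓝 1] 0

namespace IsTest

variable {p q : ℝ → ℂ}

theorem add (hp : IsTest p) (hq : IsTest q) : IsTest fun σ => p σ + q σ where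
  contDiff := hp.contDiff.add hq.contDiff
  eventuallyEq_zero := by
    filter_upwards [hp.eventuallyEq_zero, hq.eventuallyEq_zero] with σ hpσ hqσ
    simp [hpσ, hqσ]

theorem const_mul (hq : IsTest q) (a : ℂ) : IsTest fun σ => a * q σ where
  contDiff := contDiff_const.mul hq.contDiff
  eventuallyEq_zero := hq.eventuallyEq_zero.mono fun σ hσ => by simp [hσ]

theorem ofReal_pow_mul (hq : IsTest q) (m : ℕ) : IsTest fun σ => (σ : ℂ) ^ m * q σ where
  contDiff := (Complex.ofRealCLM.contDiff.pow m).mul hq.contDiff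
  eventuallyEq_zero := hq.eventuallyEq_zero.mono fun σ hσ => by simp [hσ]

protected theorem deriv (hq : IsTest q) : IsTest (deriv q) where
  contDiff := (contDiff_infty_iff_deriv.mp hq.contDiff).2
  eventuallyEq_zero := by
    simpa only [Pi.zero_def, deriv_const'] using hq.eventuallyEq_zero.deriv

theorem continuous (hq : IsTest q) : Continuous q :=
  hq.contDiff.continuous

theorem hasDerivAt (hq : IsTest q) (σ : ℝ) : HasDerivAt q (deriv q σ) σ :=
  (hq.contDiff.differentiable (by simp) σ).hasDerivAt

theorem adjoint_firstOrder (hq : IsTest q) (a b : ℂ) :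
    IsTest fun σ => -a * deriv q σ + b * q σ :=
  (hq.deriv.const_mul (-a)).add (hq.const_mul b)

theorem exists_eq_one_at_zero : ∃ q, IsTest q ∧ q 0 = 1 := by
  let χ : ContDiffBump (0 : ℝ) := ⟨1 / 4, 1 / 2, by norm_num, by norm_num⟩
  refine ⟨fun σ => (χ σ : ℂ), ⟨Complex.ofRealCLM.contDiff.comp χ.contDiff, ?_⟩, ?_⟩
  · filter_upwards [Ioi_mem_nhds (show (1 / 2 : ℝ) < 1 by norm_num)] with σ hσ
    have hdist : χ.rOut ≤ dist σ 0 := by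
      rw [dist_zero_right]
      exact (le_of_lt hσ).trans (le_abs_self σ)
    simp [χ.zero_of_le_dist hdist]
  · simp [χ.one_of_mem_closedBall (mem_closedBall_self χ.rIn_pos.le)]

theorem deriv_ofReal_pow_succ_mul (hq : IsTest q) (m : ℕ) (σ : ℝ) :
    deriv (fun σ : ℝ => (σ : ℂ) ^ (m + 1) * q σ) σ =
      (σ : ℂ) ^ m * ((m + 1) * q σ + σ * deriv q σ) := by
  have hid : HasDerivAt (fun σ : ℝ => (σ : ℂ)) 1 σ := Complex.ofRealCLM.hasDerivAt
  rw [((hid.fun_pow (m + 1)).fun_mul (hq.hasDerivAt σ)).deriv]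
  push_cast
  ring

end IsTest

/-- The weak form of the estimate `Z = O(B)` for functions on a horizontally invariant domain: the
integrals of `Z` over the segments `[t, t + 1]`, against test functions vanishing to order `m`
at the left end point, are `O(B t)`. -/
def WeakBound (D : Set ℂ) (B : ℂ → ℝ) (m : ℕ) (Z : ℂ → ℂ) : Prop :=
  ∀ q : ℝ → ℂ, IsTest q →
    ∃ C : ℝ, ∀ t ∈ D, ‖∫ σ in (0 : ℝ)..1, (σ : ℂ) ^ m * q σ * Z (t + σ)‖ ≤ C * B t

section WeakBound

variable {D : Set ℂ} {B : ℂ → ℝ} {m : ℕ} {Z : ℂ → ℂ}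

theorem hasDerivAt_comp_add_ofReal (hD : IsOpen D) (hZ : DifferentiableOn ℂ Z D) {t : ℂ} {σ : ℝ}
    (h : t + σ ∈ D) : HasDerivAt (fun σ : ℝ => Z (t + σ)) (deriv Z (t + σ)) σ :=
  ((hZ.differentiableAt (hD.mem_nhds h)).hasDerivAt.comp_const_add t (σ : ℂ)).comp_ofReal

theorem continuous_comp_add_ofReal (hDr : ∀ t ∈ D, ∀ σ : ℝ, t + (σ : ℂ) ∈ D)
    (hZ : ContinuousOn Z D) {t : ℂ} (ht : t ∈ D) : Continuous fun σ : ℝ => Z (t + σ) :=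
  hZ.comp_continuous (by fun_prop) (hDr t ht)

theorem IsTest.intervalIntegrable_mul {q g : ℝ → ℂ} (hq : IsTest q) (hg : Continuous g)
    (a b : ℝ) : IntervalIntegrable (fun σ => q σ * g σ) volume a b :=
  (hq.continuous.fun_mul hg).intervalIntegrable a b

theorem IsTest.integral_mul_firstOrder (hD : IsOpen D) (hDr : ∀ t ∈ D, ∀ σ : ℝ, t + (σ : ℂ) ∈ D)
    (hZ : DifferentiableOn ℂ Z D) (a b : ℂ) {φ : ℝ → ℂ} (hφ : IsTest φ) {t : ℂ} (ht : t ∈ D) :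
    ∫ σ in (0 : ℝ)..1, φ σ * firstOrder a b Z (t + σ) =
      -(a * φ 0 * Z t) + ∫ σ in (0 : ℝ)..1, (-a * deriv φ σ + b * φ σ) * Z (t + σ) := by
  have hZ_cont := continuous_comp_add_ofReal hDr hZ.continuousOn ht
  have hLZ_cont := continuous_comp_add_ofReal hDr
    (differentiableOn_firstOrder hD a b hZ).continuousOn ht
  have hderiv (σ : ℝ) : HasDerivAt (fun σ : ℝ => a * (φ σ * Z (t + σ)))
      (φ σ * firstOrder a b Z (t + σ) - (-a * deriv φ σ + b * φ σ) * Z (t + σ)) σ := by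
    refine (((hφ.hasDerivAt σ).mul
      (hasDerivAt_comp_add_ofReal hD hZ (hDr t ht σ))).const_mul a).congr_deriv ?_
    rw [firstOrder]
    ring
  have hleft := hφ.intervalIntegrable_mul hLZ_cont 0 1
  have hright := (hφ.adjoint_firstOrder a b).intervalIntegrable_mul hZ_cont 0 1
  rw [← sub_eq_iff_eq_add, ← intervalIntegral.integral_sub hleft hright,
    intervalIntegral.integral_eq_sub_of_hasDerivAt (fun σ _ => hderiv σ) (hleft.sub hright),
    hφ.eventuallyEq_zero.eq_of_nhds]
  simp only [Pi.zero_apply, Complex.ofReal_zero, add_zero, zero_mul, mul_zero]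
  ring

theorem IsTest.integral_pow_succ_mul_firstOrder (hD : IsOpen D)
    (hDr : ∀ t ∈ D, ∀ σ : ℝ, t + (σ : ℂ) ∈ D) (hZ : DifferentiableOn ℂ Z D) (a b : ℂ) {q : ℝ → ℂ}
    (hq : IsTest q) (m : ℕ) {t : ℂ} (ht : t ∈ D) :
    ∫ σ in (0 : ℝ)..1, (σ : ℂ) ^ (m + 1) * q σ * firstOrder a b Z (t + σ) =
      ∫ σ in (0 : ℝ)..1, (σ : ℂ) ^ m * (-a * (m + 1) * q σ + (σ : ℂ) ^ 1 *
        (-a * deriv q σ + b * q σ)) * Z (t + σ) := by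
  rw [(hq.ofReal_pow_mul (m + 1)).integral_mul_firstOrder hD hDr hZ a b ht]
  simp only [hq.deriv_ofReal_pow_succ_mul, Complex.ofReal_zero, zero_pow m.succ_ne_zero, zero_mul,
    mul_zero, neg_zero, zero_add]
  congr 1 with σ
  ring

theorem WeakBound.succ (h : WeakBound D B m Z) : WeakBound D B (m + 1) Z := by
  intro q hq
  obtain ⟨C, hC⟩ := h _ (hq.ofReal_pow_mul 1)
  simp only [← mul_assoc, ← pow_add] at hC
  exact ⟨C, hC⟩

theorem WeakBound.of_zero (h : WeakBound D B 0 Z) : ∀ m, WeakBound D B m Z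
  | 0 => h
  | m + 1 => (of_zero h m).succ

protected theorem WeakBound.firstOrder (hD : IsOpen D) (hDr : ∀ t ∈ D, ∀ σ : ℝ, t + (σ : ℂ) ∈ D)
    (hZ : DifferentiableOn ℂ Z D) (h : WeakBound D B m Z) (a b : ℂ) :
    WeakBound D B (m + 1) (firstOrder a b Z) := by
  intro q hq
  obtain ⟨C, hC⟩ := h _ ((hq.const_mul (-a * (m + 1))).add
    ((hq.adjoint_firstOrder a b).ofReal_pow_mul 1))
  refine ⟨C, fun t ht => ?_⟩
  rw [hq.integral_pow_succ_mul_firstOrder hD hDr hZ a b m ht]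
  exact hC t ht

/- Integrating `firstOrder a b Z` by parts against `σ ^ (m + 1) q` yields a nonzero multiple of
`σ ^ m q Z`, and terms in `σ ^ (m + 1) Z`. -/
theorem WeakBound.of_succ (hD : IsOpen D) (hDr : ∀ t ∈ D, ∀ σ : ℝ, t + (σ : ℂ) ∈ D)
    (hZ : DifferentiableOn ℂ Z D) {a b : ℂ} (ha : a ≠ 0) (h : WeakBound D B (m + 1) Z)
    (h' : WeakBound D B (m + 1) (firstOrder a b Z)) : WeakBound D B m Z := by
  intro q hq
  have hm : (-a * (m + 1) : ℂ) ≠ 0 :=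
    mul_ne_zero (neg_ne_zero.mpr ha) (by exact_mod_cast m.succ_ne_zero)
  have hp : IsTest fun σ => (-a * (m + 1))⁻¹ * q σ := hq.const_mul _
  set p : ℝ → ℂ := fun σ => (-a * (m + 1))⁻¹ * q σ
  have hp_adj := hp.adjoint_firstOrder a b
  obtain ⟨C, hC⟩ := h' p hp
  obtain ⟨C', hC'⟩ := h _ hp_adj
  refine ⟨C + C', fun t ht => ?_⟩
  have hZ_cont := continuous_comp_add_ofReal hDr hZ.continuousOn ht
  have hparts := hp.integral_pow_succ_mul_firstOrder hD hDr hZ a b m ht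
  have hsplit (σ : ℝ) : (σ : ℂ) ^ m * (-a * (m + 1) * p σ + (σ : ℂ) ^ 1 *
      (-a * deriv p σ + b * p σ)) * Z (t + σ) = (σ : ℂ) ^ m * q σ * Z (t + σ) +
        (σ : ℂ) ^ (m + 1) * (-a * deriv p σ + b * p σ) * Z (t + σ) := by
    rw [show -a * (m + 1) * p σ = q σ from mul_inv_cancel_left₀ hm _]
    ring
  simp only [hsplit] at hparts
  rw [intervalIntegral.integral_add ((hq.ofReal_pow_mul m).intervalIntegrable_mul hZ_cont _ _)
    ((hp_adj.ofReal_pow_mul (m + 1)).intervalIntegrable_mul hZ_cont _ _)] at hparts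
  rw [eq_sub_of_add_eq hparts.symm, add_mul]
  exact (norm_sub_le _ _).trans (add_le_add (hC t ht) (hC' t ht))

theorem WeakBound.of_firstOrder (hD : IsOpen D) (hDr : ∀ t ∈ D, ∀ σ : ℝ, t + (σ : ℂ) ∈ D)
    (hZ : DifferentiableOn ℂ Z D) {a b : ℂ} (ha : a ≠ 0) (h : WeakBound D B m Z)
    (h' : WeakBound D B 0 (firstOrder a b Z)) : WeakBound D B 0 Z := by
  induction m with
  | zero => exact h
  | succ m ih => exact ih (h.of_succ hD hDr hZ ha (h'.of_zero _))

theorem WeakBound.exists_norm_le (hD : IsOpen D) (hDr : ∀ t ∈ D, ∀ σ : ℝ, t + (σ : ℂ) ∈ D)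
    (hZ : DifferentiableOn ℂ Z D) {a b : ℂ} (ha : a ≠ 0) (h : WeakBound D B 0 Z)
    (h' : WeakBound D B 0 (firstOrder a b Z)) :
    ∃ C : ℝ, ∀ t ∈ D, ‖Z t‖ ≤ C * B t := by
  obtain ⟨q, hq, hq₀⟩ := IsTest.exists_eq_one_at_zero
  obtain ⟨C, hC⟩ := h' q hq
  obtain ⟨C', hC'⟩ := h _ (hq.adjoint_firstOrder a b)
  simp only [pow_zero, one_mul] at hC hC'
  refine ⟨‖a‖⁻¹ * (C' + C), fun t ht => ?_⟩
  have hparts := hq.integral_mul_firstOrder hD hDr hZ a b ht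
  rw [hq₀, mul_one, neg_add_eq_sub, eq_comm, sub_eq_iff_eq_add', ← sub_eq_iff_eq_add] at hparts
  rw [mul_assoc, le_inv_mul_iff₀ (norm_pos_iff.mpr ha), ← norm_mul, ← hparts, add_mul]
  exact (norm_sub_le _ _).trans (add_le_add (hC' t ht) (hC t ht))

variable {F : ℂ → ℂ}

protected theorem WeakBound.firstOrderProd (hD : IsOpen D)
    (hDr : ∀ t ∈ D, ∀ σ : ℝ, t + (σ : ℂ) ∈ D) (hF : DifferentiableOn ℂ F D)
    (h : WeakBound D B 0 F) (L : List (ℂ × ℂ)) :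
    WeakBound D B L.length (firstOrderProd L F) := by
  induction L with
  | nil => exact h
  | cons p L ih => exact ih.firstOrder hD hDr (differentiableOn_firstOrderProd hD L hF) p.1 p.2

theorem WeakBound.of_firstOrderProd_append (hD : IsOpen D)
    (hDr : ∀ t ∈ D, ∀ σ : ℝ, t + (σ : ℂ) ∈ D) (hF : DifferentiableOn ℂ F D)
    (hF_weak : WeakBound D B 0 F) {L₁ L₂ : List (ℂ × ℂ)} (hL₁ : ∀ p ∈ L₁, p.1 ≠ 0)
    (h : WeakBound D B 0 (firstOrderProd (L₁ ++ L₂) F)) :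
    WeakBound D B 0 (firstOrderProd L₂ F) := by
  induction L₁ with
  | nil => exact h
  | cons p L₁ ih =>
    rw [List.forall_mem_cons] at hL₁
    exact ih hL₁.2 ((hF_weak.firstOrderProd hD hDr hF (L₁ ++ L₂)).of_firstOrder hD hDr
      (differentiableOn_firstOrderProd hD _ hF) hL₁.1 h)

theorem WeakBound.exists_norm_firstOrderProd_le (hD : IsOpen D)
    (hDr : ∀ t ∈ D, ∀ σ : ℝ, t + (σ : ℂ) ∈ D) (hF : DifferentiableOn ℂ F D)
    (hF_weak : WeakBound D B 0 F) {L₁ L₂ : List (ℂ × ℂ)} {p : ℂ × ℂ}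
    (hL : ∀ q ∈ L₁ ++ p :: L₂, q.1 ≠ 0)
    (h : WeakBound D B 0 (firstOrderProd (L₁ ++ p :: L₂) F)) :
    ∃ C : ℝ, ∀ t ∈ D, ‖firstOrderProd L₂ F t‖ ≤ C * B t := by
  simp only [List.forall_mem_append, List.forall_mem_cons] at hL
  have hp := hF_weak.of_firstOrderProd_append hD hDr hF hL.1 h
  exact ((hF_weak.firstOrderProd hD hDr hF L₂).of_firstOrder hD hDr
    (differentiableOn_firstOrderProd hD L₂ hF) hL.2.1 hp).exists_norm_le hD hDr
      (differentiableOn_firstOrderProd hD L₂ hF) hL.2.1 hp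

theorem weakBound_zero_of_norm_le (hDr : ∀ t ∈ D, ∀ σ : ℝ, t + (σ : ℂ) ∈ D)
    (hF : ContinuousOn F D) {K : ℂ → ℝ}
    (hZ : ∀ t ∈ D, ∀ σ ∈ Set.Icc (0 : ℝ) 1, ‖Z (t + σ)‖ ≤ K t * ‖F (t + σ)‖) :
    WeakBound D (fun t => K t * ∫ σ in (0 : ℝ)..1, ‖F (t + σ)‖) 0 Z := by
  intro q hq
  obtain ⟨M, hM⟩ := isCompact_Icc.exists_bound_of_continuousOn
    (hq.continuous.continuousOn (s := Set.Icc (0 : ℝ) 1))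
  refine ⟨M, fun t ht => ?_⟩
  have hF_cont := (continuous_comp_add_ofReal hDr hF ht).norm
  change _ ≤ M * (K t * _)
  rw [← intervalIntegral.integral_const_mul, ← intervalIntegral.integral_const_mul]
  refine intervalIntegral.norm_integral_le_of_norm_le zero_le_one
    (Eventually.of_forall fun σ hσ => ?_)
    (((hF_cont.const_mul _).const_mul _).intervalIntegrable _ _)
  have hσ_mem := Set.Ioc_subset_Icc_self hσ
  rw [pow_zero, one_mul, norm_mul]
  exact mul_le_mul (hM σ hσ_mem) (hZ t ht σ hσ_mem) (norm_nonneg _)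
    ((norm_nonneg _).trans (hM σ hσ_mem))

end WeakBound

/-! ### Growth along vertical segments -/

/-- The vector `(z 0, μ⁻¹ z 1, …, μ ^ (-(N - 1)) z (N - 1))`. The weights balance the entries of a
chain of derivatives that closes up with `z N = O(μ ^ N) z 0`. -/
noncomputable def rescale (μ : ℝ) (N : ℕ) (z : ℕ → ℂ) (j : Fin N) : ℂ :=
  ((μ ^ (j : ℕ))⁻¹ : ℝ) * z j

section Chain

variable {μ : ℝ} {N : ℕ}

theorem norm_rescale_apply (hμ : 0 ≤ μ) (z : ℕ → ℂ) (j : Fin N) :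
    ‖rescale μ N z j‖ = (μ ^ (j : ℕ))⁻¹ * ‖z j‖ := by
  rw [rescale, norm_mul, Complex.norm_real, Real.norm_of_nonneg (by positivity)]

theorem inv_pow_mul_norm_le_norm_rescale (hμ : 0 ≤ μ) (z : ℕ → ℂ) {j : ℕ} (hj : j < N) :
    (μ ^ j)⁻¹ * ‖z j‖ ≤ ‖rescale μ N z‖ :=
  (norm_rescale_apply hμ z ⟨j, hj⟩).symm.trans_le (norm_le_pi_norm _ _)

theorem inv_pow_mul_norm_succ_le_norm_rescale (hμ : 0 < μ) {z : ℕ → ℂ}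
    (hlast : ‖z N‖ ≤ μ ^ N * ‖z 0‖) {j : ℕ} (hj : j < N) :
    (μ ^ j)⁻¹ * ‖z (j + 1)‖ ≤ μ * ‖rescale μ N z‖ := by
  have hshift : (μ ^ j)⁻¹ * ‖z (j + 1)‖ = μ * ((μ ^ (j + 1))⁻¹ * ‖z (j + 1)‖) := by
    rw [pow_succ]
    field_simp
  rw [hshift, mul_le_mul_iff_right₀ hμ]
  obtain hlt | rfl : j + 1 < N ∨ j + 1 = N := by omega
  · exact inv_pow_mul_norm_le_norm_rescale hμ.le z hlt
  · rw [inv_mul_le_iff₀ (by positivity)]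
    refine hlast.trans (mul_le_mul_of_nonneg_left ?_ (by positivity))
    simpa using inv_pow_mul_norm_le_norm_rescale hμ.le z j.succ_pos

theorem norm_rescale_le_sum (hμ : 1 ≤ μ) (z : ℕ → ℂ) :
    ‖rescale μ N z‖ ≤ ∑ j ∈ Finset.range N, ‖z j‖ := by
  rw [pi_norm_le_iff_of_nonneg (Finset.sum_nonneg fun _ _ => norm_nonneg _)]
  intro j
  rw [norm_rescale_apply (by linarith)]
  exact (mul_le_of_le_one_left (norm_nonneg _) (inv_le_one_of_one_le₀ (one_le_pow₀ hμ))).trans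
    (Finset.single_le_sum (f := fun j => ‖z j‖) (fun _ _ => norm_nonneg _)
      (Finset.mem_range.mpr j.2))

theorem norm_rescale_le_of_chain {α β : ℝ} (hα : 0 < α) (hβ : 0 ≤ β) (hμ : 1 ≤ μ) {z z' : ℕ → ℂ}
    (hstep : ∀ j < N, α * ‖z' j‖ ≤ ‖z (j + 1)‖ + β * ‖z j‖) (hlast : ‖z N‖ ≤ μ ^ N * ‖z 0‖) :
    ‖rescale μ N z'‖ ≤ (1 + β) / α * μ * ‖rescale μ N z‖ := by
  have hμ₀ : 0 < μ := by linarith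
  rw [pi_norm_le_iff_of_nonneg (by positivity)]
  intro j
  have hz := inv_pow_mul_norm_le_norm_rescale hμ₀.le z j.2
  have hz_succ := inv_pow_mul_norm_succ_le_norm_rescale hμ₀ hlast j.2
  rw [norm_rescale_apply hμ₀.le, div_mul_eq_mul_div, div_mul_eq_mul_div, le_div_iff₀ hα]
  calc (μ ^ (j : ℕ))⁻¹ * ‖z' j‖ * α = (μ ^ (j : ℕ))⁻¹ * (α * ‖z' j‖) := by ring
    _ ≤ (μ ^ (j : ℕ))⁻¹ * (‖z (j + 1)‖ + β * ‖z j‖) := by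
        have := hstep j j.2
        gcongr
    _ = (μ ^ (j : ℕ))⁻¹ * ‖z (j + 1)‖ + β * ((μ ^ (j : ℕ))⁻¹ * ‖z j‖) := by ring
    _ ≤ μ * ‖rescale μ N z‖ + β * (μ * ‖rescale μ N z‖) := add_le_add hz_succ
        (mul_le_mul_of_nonneg_left (hz.trans (le_mul_of_one_le_left (norm_nonneg _) hμ)) hβ)
    _ = (1 + β) * μ * ‖rescale μ N z‖ := by ring

theorem norm_le_exp_of_chain {D : Set ℂ} (hD : IsOpen D) (hN : 0 < N) {α β : ℝ} (hα : 0 < α)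
    (hβ : 0 ≤ β) (hμ : 1 ≤ μ) {Z : ℕ → ℂ → ℂ} (hZ : ∀ j, DifferentiableOn ℂ (Z j) D)
    {t ζ : ℂ} (hζ : ‖ζ‖ = 1) {θ : ℝ} (hθ : 0 ≤ θ) (hseg : ∀ s ∈ Set.Icc 0 θ, t + s * ζ ∈ D)
    (hstep : ∀ j < N, ∀ z ∈ D, α * ‖deriv (Z j) z‖ ≤ ‖Z (j + 1) z‖ + β * ‖Z j z‖)
    (hlast : ∀ s ∈ Set.Icc 0 θ, ‖Z N (t + s * ζ)‖ ≤ μ ^ N * ‖Z 0 (t + s * ζ)‖) :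
    ‖Z 0 (t + θ * ζ)‖ ≤ (∑ j ∈ Finset.range N, ‖Z j t‖) * Real.exp ((1 + β) / α * μ * θ) := by
  set f : ℝ → Fin N → ℂ := fun s => rescale μ N fun j => Z j (t + s * ζ) with hf
  set f' : ℝ → Fin N → ℂ := fun s => rescale μ N fun j => deriv (Z j) (t + s * ζ) * ζ
  have hderiv (s : ℝ) (hs : s ∈ Set.Icc 0 θ) : HasDerivAt f (f' s) s := by
    have hline : HasDerivAt (fun s : ℝ => t + (s : ℂ) * ζ) ζ s := by
      simpa using ((Complex.ofRealCLM.hasDerivAt (x := s)).mul_const ζ).const_add t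
    exact hasDerivAt_pi.mpr fun j => (((hZ j).differentiableAt
      (hD.mem_nhds (hseg s hs))).hasDerivAt.comp_of_eq s hline rfl).const_mul _
  have hbound (s : ℝ) (hs : s ∈ Set.Icc 0 θ) : ‖f' s‖ ≤ (1 + β) / α * μ * ‖f s‖ :=
    norm_rescale_le_of_chain hα hβ hμ
      (fun j hj => by simpa only [norm_mul, hζ, mul_one] using hstep j hj _ (hseg s hs))
      (hlast s hs)
  have hinit : ‖f 0‖ ≤ ∑ j ∈ Finset.range N, ‖Z j t‖ := by
    simpa only [hf, Complex.ofReal_zero, zero_mul, add_zero] using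
      norm_rescale_le_sum hμ fun j => Z j t
  have hgronwall := norm_le_gronwallBound_of_norm_deriv_right_le (ε := 0)
    (fun s hs => (hderiv s hs).continuousAt.continuousWithinAt)
    (fun s hs => (hderiv s (Set.Ico_subset_Icc_self hs)).hasDerivWithinAt) hinit
    (fun s hs => (hbound s (Set.Ico_subset_Icc_self hs)).trans_eq (add_zero _).symm) θ ⟨hθ, le_rfl⟩
  rw [gronwallBound_ε0, sub_zero] at hgronwall
  have hfirst := inv_pow_mul_norm_le_norm_rescale (zero_le_one.trans hμ)
    (fun j => Z j (t + θ * ζ)) hN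
  rw [pow_zero, inv_one, one_mul] at hfirst
  exact hfirst.trans hgronwall

end Chain

section CpGKZ

variable {D : Set ℂ} {F : ℂ → ℂ}

theorem exists_eq_take_append_drop {α : Type*} (L : List α) {j : ℕ} (hj : j < L.length) :
    ∃ p, L = L.take (L.length - (j + 1)) ++ p :: L.drop (L.length - j) ∧
      L.drop (L.length - (j + 1)) = p :: L.drop (L.length - j) := by
  have hlt : L.length - (j + 1) < L.length := by omega
  have hdrop := List.drop_eq_getElem_cons hlt
  rw [show L.length - (j + 1) + 1 = L.length - j by omega] at hdrop
  exact ⟨_, by rw [← hdrop, List.take_append_drop], hdrop⟩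

theorem mul_norm_deriv_firstOrderProd_drop_le {a : ℂ} {β : ℝ} {L : List (ℂ × ℂ)}
    (hL : ∀ p ∈ L, p.1 = a ∧ ‖p.2‖ ≤ β) {j : ℕ} (hj : j < L.length) (F : ℂ → ℂ) (z : ℂ) :
    ‖a‖ * ‖deriv (firstOrderProd (L.drop (L.length - j)) F) z‖ ≤
      ‖firstOrderProd (L.drop (L.length - (j + 1))) F z‖ +
        β * ‖firstOrderProd (L.drop (L.length - j)) F z‖ := by
  obtain ⟨p, hLp, hdrop⟩ := exists_eq_take_append_drop L hj
  obtain ⟨rfl, hβ⟩ := hL p (by rw [hLp]; simp)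
  set G := firstOrderProd (L.drop (L.length - j)) F with hG
  have hsolve : p.1 * deriv G z =
      firstOrderProd (L.drop (L.length - (j + 1))) F z - p.2 * G z := by
    rw [hdrop, firstOrderProd, ← hG, firstOrder, add_sub_cancel_right]
  rw [← norm_mul, hsolve]
  refine (norm_sub_le _ _).trans ?_
  rw [norm_mul]
  gcongr

theorem exists_norm_firstOrderProd_drop_le_integral (hD : IsOpen D)
    (hDr : ∀ t ∈ D, ∀ σ : ℝ, t + (σ : ℂ) ∈ D) (hF : DifferentiableOn ℂ F D) {L : List (ℂ × ℂ)}
    (hL : ∀ p ∈ L, p.1 ≠ 0) (hLF : ∀ t ∈ D, firstOrderProd L F t = Complex.exp t * F t) {j : ℕ}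
    (hj : j < L.length) : ∃ C : ℝ, ∀ t ∈ D, ‖firstOrderProd (L.drop (L.length - j)) F t‖ ≤
      C * ((1 + Real.exp t.re) * ∫ σ in (0 : ℝ)..1, ‖F (t + σ)‖) := by
  obtain ⟨p, hLp, -⟩ := exists_eq_take_append_drop L hj
  have hexp_one : 1 ≤ Real.exp 1 := Real.one_le_exp zero_le_one
  have hF_weak : WeakBound D _ 0 F := weakBound_zero_of_norm_le hDr hF.continuousOn
    (K := fun t => Real.exp 1 * (1 + Real.exp t.re)) fun t _ σ _ =>
      le_mul_of_one_le_left (norm_nonneg _) (by nlinarith [Real.exp_pos t.re])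
  have hLF_weak : WeakBound D _ 0 (firstOrderProd L F) :=
    weakBound_zero_of_norm_le hDr hF.continuousOn
      (K := fun t => Real.exp 1 * (1 + Real.exp t.re)) fun t ht σ hσ => by
        have hexp_le : Real.exp σ ≤ Real.exp 1 := Real.exp_le_exp.mpr hσ.2
        rw [hLF _ (hDr t ht σ), norm_mul, Complex.norm_exp, Complex.add_re, Complex.ofReal_re,
          Real.exp_add]
        refine mul_le_mul_of_nonneg_right ?_ (norm_nonneg _)
        nlinarith [Real.exp_pos t.re, mul_le_mul_of_nonneg_left hexp_le (Real.exp_pos t.re).le]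
  rw [hLp] at hL hLF_weak
  obtain ⟨C, hC⟩ := hF_weak.exists_norm_firstOrderProd_le hD hDr hF hL hLF_weak
  exact ⟨C * Real.exp 1, fun t ht => (hC t ht).trans_eq (by ring)⟩

/- Along the segment `t + s ζ` the real part, hence the size of the coefficient `exp`, is constant:
Grönwall's inequality loses only `exp (K μ θ)` with `μ ^ (k + 1)` comparable to `exp t.re`. -/
theorem exists_norm_le_integral_of_cpGKZ {k : ℕ} {w : Fin (k + 1) → ℂ} {ħ : ℂ} (hħ : ħ ≠ 0)
    (hD : IsOpen D) (hDr : ∀ t ∈ D, ∀ σ : ℝ, t + (σ : ℂ) ∈ D) (hF : DifferentiableOn ℂ F D)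
    (hGKZ : ∀ t ∈ D, cpGKZ w ħ F t = 0) :
    ∃ C K : ℝ, 0 ≤ C ∧ 0 ≤ K ∧ ∀ t ∈ D, ∀ ζ : ℂ, ‖ζ‖ = 1 → ζ.re = 0 → ∀ θ : ℝ, 0 ≤ θ →
      (∀ s ∈ Set.Icc 0 θ, t + s * ζ ∈ D) → ∀ μ : ℝ, 1 ≤ μ → Real.exp t.re ≤ μ ^ (k + 1) →
      ‖F (t + θ * ζ)‖ ≤ C * Real.exp (K * μ * θ) *
        ((1 + Real.exp t.re) * ∫ σ in (0 : ℝ)..1, ‖F (t + σ)‖) := by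
  set L : List (ℂ × ℂ) := (List.finRange (k + 1)).map fun i => (ħ, -w i) with hL
  have hlen : L.length = k + 1 := by simp [hL]
  have hL_mem : ∀ p ∈ L, p.1 = ħ ∧ ‖p.2‖ ≤ ∑ i, ‖w i‖ := by
    simp only [hL, List.forall_mem_map, norm_neg, true_and]
    exact fun i _ => Finset.single_le_sum (f := fun i => ‖w i‖) (fun _ _ => norm_nonneg _)
      (Finset.mem_univ i)
  have hLF : ∀ t ∈ D, firstOrderProd L F t = Complex.exp t * F t := fun t ht => by
    simpa only [cpGKZ, wProd_eq_firstOrderProd, xHat, sub_eq_zero] using hGKZ t ht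
  choose! C hC using fun j (hj : j < L.length) => exists_norm_firstOrderProd_drop_le_integral
    hD hDr hF (fun p hp => (hL_mem p hp).1.trans_ne hħ) hLF hj
  refine ⟨∑ j ∈ Finset.range L.length, |C j|, (1 + ∑ i, ‖w i‖) / ‖ħ‖, by positivity, by positivity,
    fun t ht ζ hζ hζ_re θ hθ hseg μ hμ hμ_pow => ?_⟩
  rw [← hlen] at hμ_pow
  have hgrowth := norm_le_exp_of_chain hD (N := L.length) (by omega) (norm_pos_iff.mpr hħ)
    (by positivity) hμ (fun j => differentiableOn_firstOrderProd hD (L.drop (L.length - j)) hF)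
    hζ hθ hseg (fun j hj z _ => mul_norm_deriv_firstOrderProd_drop_le hL_mem hj F z) fun s hs => by
      simp only [Nat.sub_self, List.drop_zero, Nat.sub_zero, List.drop_length]
      rw [hLF _ (hseg s hs), norm_mul, Complex.norm_exp, Complex.add_re, Complex.re_ofReal_mul,
        hζ_re, mul_zero, add_zero]
      exact mul_le_mul_of_nonneg_right hμ_pow (norm_nonneg _)
  simp only [Nat.sub_zero, List.drop_length] at hgrowth
  have hintegral : 0 ≤ ∫ σ in (0 : ℝ)..1, ‖F (t + σ)‖ :=
    intervalIntegral.integral_nonneg zero_le_one fun _ _ => norm_nonneg _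
  have hsum : ∑ j ∈ Finset.range L.length, ‖firstOrderProd (L.drop (L.length - j)) F t‖ ≤
      (∑ j ∈ Finset.range L.length, |C j|) *
        ((1 + Real.exp t.re) * ∫ σ in (0 : ℝ)..1, ‖F (t + σ)‖) := by
    rw [Finset.sum_mul]
    exact Finset.sum_le_sum fun j hj => (hC j (Finset.mem_range.mp hj) t ht).trans
      (mul_le_mul_of_nonneg_right (le_abs_self _) (by positivity))
  exact (hgrowth.trans (mul_le_mul_of_nonneg_right hsum (Real.exp_pos _).le)).trans_eq
    (mul_right_comm _ _ _)

end CpGKZ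

/-! ### The Laplace transform in logarithmic coordinates -/

section ExpSubstitution

variable {n : ℕ} {E : Type*} [NormedAddCommGroup E] [NormedSpace ℝ E]

theorem image_exp_eq_orthant :
    (fun (r : Fin n → ℝ) a => Real.exp (r a)) '' Set.univ = orthant n := by
  ext v
  simp only [Set.image_univ, Set.mem_range, orthant, Set.mem_ofPred_eq]
  constructor
  · rintro ⟨r, rfl⟩ a
    exact Real.exp_pos _
  · intro hv
    exact ⟨fun a => Real.log (v a), funext fun a => Real.exp_log (hv a)⟩

theorem injective_exp_pi : Function.Injective fun (r : Fin n → ℝ) a => Real.exp (r a) :=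
  fun _ _ h => funext fun a => Real.exp_injective (congrFun h a)

theorem hasFDerivAt_exp_pi (r : Fin n → ℝ) :
    HasFDerivAt (fun (r : Fin n → ℝ) a => Real.exp (r a))
      (ContinuousLinearMap.pi fun a =>
        (ContinuousLinearMap.toSpanSingleton ℝ (Real.exp (r a))).comp
          (ContinuousLinearMap.proj a)) r :=
  hasFDerivAt_pi.mpr fun a =>
    (Real.hasDerivAt_exp (r a)).hasFDerivAt.comp (f := fun r : Fin n → ℝ => r a) r
      (hasFDerivAt_apply a r)

theorem abs_det_exp_pi (r : Fin n → ℝ) :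
    |(ContinuousLinearMap.pi fun a => (ContinuousLinearMap.toSpanSingleton ℝ (Real.exp (r a))).comp
      (ContinuousLinearMap.proj a : (Fin n → ℝ) →L[ℝ] ℝ)).det| = Real.exp (∑ a, r a) := by
  rw [ContinuousLinearMap.det_pi]
  simp only [ContinuousLinearMap.det_toSpanSingleton]
  rw [← Real.exp_sum, Real.abs_exp]

theorem integral_orthant_eq_integral_exp (f : (Fin n → ℝ) → E) :
    ∫ v in orthant n, f v = ∫ r : Fin n → ℝ, Real.exp (∑ a, r a) • f fun a => Real.exp (r a) := by
  rw [← image_exp_eq_orthant, integral_image_eq_integral_abs_det_fderiv_smul volume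
    MeasurableSet.univ (fun r _ => (hasFDerivAt_exp_pi r).hasFDerivWithinAt)
    injective_exp_pi.injOn, Measure.restrict_univ]
  simp only [abs_det_exp_pi]

theorem integrableOn_orthant_iff_integrable_exp (f : (Fin n → ℝ) → E) :
    IntegrableOn f (orthant n) ↔
      Integrable fun r : Fin n → ℝ => Real.exp (∑ a, r a) • f fun a => Real.exp (r a) := by
  rw [← image_exp_eq_orthant, integrableOn_image_iff_integrableOn_abs_det_fderiv_smul volume
    MeasurableSet.univ (fun r _ => (hasFDerivAt_exp_pi r).hasFDerivWithinAt)
    injective_exp_pi.injOn, integrableOn_univ]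
  simp only [abs_det_exp_pi]

end ExpSubstitution

/-- The weight `exp (-(∑ v_a + lam_a log v_a) / ħ) ∏ v_a ^ (m_a + 1)` at `v_a = exp (r a)`; the `1`
in the exponents comes from `dv_a = v_a dr_a`. -/
noncomputable def laplaceWeight {n : ℕ} (lam : Fin n → ℂ) (ħ : ℂ) (m : Fin n → ℕ)
    (r : Fin n → ℝ) : ℂ :=
  Complex.exp (∑ a, (((m a : ℂ) + 1) * r a - (Complex.exp (r a) + lam a * r a) / ħ))

/-- The integrand of the Laplace transform in the coordinates `r a = log (v a)`, with the additional
factor `∏ v_a ^ m_a`. -/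
noncomputable def laplaceFamily {n : ℕ} (l : Fin n → ℕ) (lam : Fin n → ℂ) (ħ : ℂ) (F : ℂ → ℂ)
    (m : Fin n → ℕ) (t : ℂ) (r : Fin n → ℝ) : ℂ :=
  laplaceWeight lam ħ m r * F (t + ∑ a, (l a : ℂ) * (r a : ℂ))

section Laplace

variable {n : ℕ} {l : Fin n → ℕ} {lam : Fin n → ℂ} {ħ : ℂ} {F : ℂ → ℂ} {m : Fin n → ℕ} {D : Set ℂ}

theorem add_sum_mem (hDr : ∀ t ∈ D, ∀ σ : ℝ, t + (σ : ℂ) ∈ D) {t : ℂ}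
    (ht : t ∈ D) (l : Fin n → ℕ) (r : Fin n → ℝ) : t + ∑ b, (l b : ℂ) * (r b : ℂ) ∈ D := by
  simpa only [Complex.ofReal_sum, Complex.ofReal_mul, Complex.ofReal_natCast]
    using hDr t ht (∑ b, (l b : ℝ) * r b)

theorem continuous_laplaceWeight : Continuous (laplaceWeight lam ħ m) := by
  unfold laplaceWeight
  fun_prop

theorem exp_sum_smul_laplaceIntegrand (t : ℂ) (r : Fin n → ℝ) :
    Real.exp (∑ a, r a) • laplaceIntegrand l lam ħ F t (fun a => Real.exp (r a)) =
      laplaceFamily l lam ħ F 0 t r := by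
  simp only [laplaceIntegrand, laplaceFamily, laplaceWeight, Real.log_exp, Complex.real_smul]
  rw [← mul_assoc, Complex.ofReal_exp, ← Complex.exp_add, neg_div, ← sub_eq_add_neg,
    Finset.sum_div, Complex.ofReal_sum, ← Finset.sum_sub_distrib]
  simp

theorem ciLaplace_eq_integral_laplaceFamily (t : ℂ) :
    ciLaplace l lam ħ F t = ∫ r, laplaceFamily l lam ħ F 0 t r := by
  simp only [ciLaplace, integral_orthant_eq_integral_exp, exp_sum_smul_laplaceIntegrand]

theorem integrableOn_laplaceIntegrand_iff (t : ℂ) :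
    IntegrableOn (laplaceIntegrand l lam ħ F t) (orthant n) ↔
      Integrable (laplaceFamily l lam ħ F 0 t) := by
  simp only [integrableOn_orthant_iff_integrable_exp, exp_sum_smul_laplaceIntegrand]

theorem laplaceWeight_add (m m' : Fin n → ℕ) (r : Fin n → ℝ) :
    laplaceWeight lam ħ (m + m') r =
      Complex.exp (∑ a, (m' a : ℂ) * (r a : ℂ)) * laplaceWeight lam ħ m r := by
  simp only [laplaceWeight]
  rw [← Complex.exp_add, ← Finset.sum_add_distrib]
  refine congrArg Complex.exp (Finset.sum_congr rfl fun a _ => ?_)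
  rw [Pi.add_apply, Nat.cast_add]
  ring

theorem laplaceWeight_update (m : Fin n → ℕ) (a : Fin n) (r : Fin n → ℝ) :
    laplaceWeight lam ħ (Function.update m a (m a + 1)) r =
      Complex.exp (r a) * laplaceWeight lam ħ m r := by
  have update_eq : Function.update m a (m a + 1) = m + Pi.single a 1 := by
    funext b
    rcases eq_or_ne b a with rfl | hb
    · simp
    · simp [hb]
  rw [update_eq, laplaceWeight_add, Finset.sum_eq_single a]
  · simp
  · intro b _ hb
    simp [hb]
  · simp

theorem sum_mul_add_smul_single (d : Fin n → ℂ) (r : Fin n → ℝ) (a : Fin n) (s : ℝ) :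
    ∑ b, d b * ((r + s • (Pi.single a 1 : Fin n → ℝ)) b : ℝ) = ∑ b, d b * (r b : ℂ) + d a * s := by
  simp only [Pi.add_apply, Pi.smul_apply, smul_eq_mul, Complex.ofReal_add, mul_add,
    Finset.sum_add_distrib, Complex.ofReal_mul]
  rw [Finset.sum_eq_single (M := ℂ) a
    (f := fun b => d b * (s * ((Pi.single a 1 : Fin n → ℝ) b : ℝ)))]
  · simp
  · intro b _ hb
    simp [hb]
  · simp

theorem hasDerivAt_sum_cexp_line (a : Fin n) (r : Fin n → ℝ) :
    HasDerivAt (fun s : ℝ => ∑ b, Complex.exp ((r + s • (Pi.single a 1 : Fin n → ℝ)) b : ℝ))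
      (Complex.exp (r a)) 0 := by
  have hasDerivAt_coord (b : Fin n) :
      HasDerivAt (fun s : ℝ => (r + s • (Pi.single a 1 : Fin n → ℝ)) b)
        ((Pi.single a 1 : Fin n → ℝ) b) 0 := by
    simpa using ((hasDerivAt_id (0 : ℝ)).mul_const ((Pi.single a 1 : Fin n → ℝ) b)).const_add (r b)
  refine (HasDerivAt.fun_sum fun b _ => (hasDerivAt_coord b).ofReal_comp.cexp).congr_deriv ?_
  rw [Finset.sum_eq_single a]
  · simp
  · intro b _ hb
    simp [hb]
  · simp

theorem laplaceWeight_eq (r : Fin n → ℝ) : laplaceWeight lam ħ m r =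
    Complex.exp (∑ a, ((m a : ℂ) + 1 - lam a / ħ) * (r a : ℂ) -
      (∑ a, Complex.exp (r a)) / ħ) := by
  rw [laplaceWeight, Finset.sum_div, ← Finset.sum_sub_distrib]
  exact congrArg Complex.exp (Finset.sum_congr rfl fun a _ => by ring)

theorem hasLineDerivAt_laplaceWeight (a : Fin n) (r : Fin n → ℝ) :
    HasLineDerivAt ℝ (laplaceWeight lam ħ m)
      (((m a : ℂ) + 1 - (Complex.exp (r a) + lam a) / ħ) * laplaceWeight lam ħ m r) r
      (Pi.single a 1) := by
  simp only [HasLineDerivAt, laplaceWeight_eq, sum_mul_add_smul_single]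
  refine ((((hasDerivAt_id (0 : ℝ)).ofReal_comp.const_mul _).const_add _).sub
    ((hasDerivAt_sum_cexp_line a r).div_const ħ)).cexp.congr_deriv ?_
  simp only [Pi.sub_apply, id, zero_smul, add_zero, Complex.ofReal_zero, Complex.ofReal_one,
    mul_zero]
  ring

theorem hasLineDerivAt_laplaceFamily (hD : IsOpen D)
    (hDr : ∀ t ∈ D, ∀ σ : ℝ, t + (σ : ℂ) ∈ D) (hF : DifferentiableOn ℂ F D) {t : ℂ} (ht : t ∈ D)
    (a : Fin n) (r : Fin n → ℝ) :
    HasLineDerivAt ℝ (laplaceFamily l lam ħ F m t)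
      (((m a : ℂ) + 1 - (Complex.exp (r a) + lam a) / ħ) * laplaceFamily l lam ħ F m t r +
        laplaceWeight lam ħ m r * (l a * deriv F (t + ∑ b, (l b : ℂ) * (r b : ℂ)))) r
      (Pi.single a 1) := by
  set z := t + ∑ b, (l b : ℂ) * (r b : ℂ) with hz
  have hasDerivAt_arg : HasDerivAt (fun s : ℝ => z + l a * (s : ℂ)) (l a) 0 := by
    simpa using ((hasDerivAt_id (0 : ℝ)).ofReal_comp.const_mul (l a : ℂ)).const_add z
  have hasDerivAt_F : HasDerivAt (fun s : ℝ => F (z + l a * (s : ℂ))) (deriv F z * l a) 0 :=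
    (hF.differentiableAt (hD.mem_nhds (add_sum_mem hDr ht l r))).hasDerivAt.comp_of_eq (0 : ℝ)
      hasDerivAt_arg (by simp [hz])
  have hasDerivAt_weight := hasLineDerivAt_laplaceWeight (lam := lam) (ħ := ħ) (m := m) a r
  simp only [HasLineDerivAt, laplaceFamily, sum_mul_add_smul_single, ← add_assoc]
  refine (hasDerivAt_weight.mul hasDerivAt_F).congr_deriv ?_
  simp only [zero_smul, add_zero, mul_zero, Complex.ofReal_zero]
  ring

theorem integral_eq_zero_of_hasLineDerivAt {E : Type*} [NormedAddCommGroup E] [NormedSpace ℝ E]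
    [FiniteDimensional ℝ E] [MeasurableSpace E] [BorelSpace E] {μ : Measure E} [μ.IsAddHaarMeasure]
    {G : Type*} [NormedAddCommGroup G] [NormedSpace ℝ G] {f f' : E → G} {v : E}
    (hf : Integrable f μ) (hf' : Integrable f' μ) (hderiv : ∀ x, HasLineDerivAt ℝ f (f' x) x v) :
    ∫ x, f' x ∂μ = 0 := by
  have := integral_bilinear_hasLineDerivAt_right_eq_neg_left_of_integrable
    (B := ContinuousLinearMap.lsmul ℝ ℝ) (f := fun _ : E => (1 : ℝ)) (f' := fun _ => 0)
    (g := f) (g' := f') (v := v) (μ := μ) (by simp) (by simpa using hf') (by simpa using hf)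
    (fun x _ => by simpa [HasLineDerivAt] using hasDerivAt_const (0 : ℝ) (1 : ℝ))
    (fun x _ => hderiv x)
  simpa using this

theorem firstOrder_laplaceFamily_sub (hħ : ħ ≠ 0) (m : Fin n → ℕ) (a : Fin n) (t : ℂ)
    (r : Fin n → ℝ) :
    firstOrder (l a * ħ) (-lam a + ((m a : ℂ) + 1) * ħ)
        (fun t => laplaceFamily l lam ħ F m t r) t -
      laplaceFamily l lam ħ F (Function.update m a (m a + 1)) t r =
    ħ * ((((m a : ℂ) + 1) - (Complex.exp (r a) + lam a) / ħ) * laplaceFamily l lam ħ F m t r +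
      laplaceWeight lam ħ m r * (l a * deriv F (t + ∑ b, (l b : ℂ) * (r b : ℂ)))) := by
  simp only [laplaceFamily]
  rw [firstOrder_const_mul_translate]
  simp only [laplaceWeight_update, firstOrder]
  field_simp
  ring

/- By `firstOrder_laplaceFamily_sub` the difference of the integrands is a partial derivative of
`laplaceFamily l lam ħ F m t`. -/
theorem firstOrder_integral_laplaceFamily (hħ : ħ ≠ 0) (hD : IsOpen D)
    (hDr : ∀ t ∈ D, ∀ σ : ℝ, t + (σ : ℂ) ∈ D) (hF : DifferentiableOn ℂ F D)
    (hdom : ∀ m, LocDominated volume D (laplaceFamily l lam ħ F m)) (m : Fin n → ℕ) (a : Fin n) :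
    Set.EqOn (firstOrder (l a * ħ) (-lam a + ((m a : ℂ) + 1) * ħ)
        fun t => ∫ r, laplaceFamily l lam ħ F m t r)
      (fun t => ∫ r, laplaceFamily l lam ħ F (Function.update m a (m a + 1)) t r) D := by
  intro t ht
  have integrable_firstOrder :=
    ((hdom m).firstOrder hD (l a * ħ) (-lam a + ((m a : ℂ) + 1) * ħ)).integrable ht
  have integrable_update := (hdom (Function.update m a (m a + 1))).integrable ht
  have integrable_lineDeriv := (integrable_firstOrder.sub integrable_update).const_mul ħ⁻¹
  rw [(hdom m).firstOrder_integral hD _ _ ht, ← sub_eq_zero,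
    ← integral_sub integrable_firstOrder integrable_update]
  simp only [Pi.sub_apply, firstOrder_laplaceFamily_sub hħ, inv_mul_cancel_left₀ hħ]
    at integrable_lineDeriv ⊢
  rw [integral_const_mul, integral_eq_zero_of_hasLineDerivAt ((hdom m).integrable ht)
    integrable_lineDeriv (hasLineDerivAt_laplaceFamily hD hDr hF ht a), mul_zero]

theorem firstOrderProd_range_reverse_integral_laplaceFamily (hħ : ħ ≠ 0)
    (hD : IsOpen D) (hDr : ∀ t ∈ D, ∀ σ : ℝ, t + (σ : ℂ) ∈ D) (hF : DifferentiableOn ℂ F D)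
    (hdom : ∀ m, LocDominated volume D (laplaceFamily l lam ħ F m)) {a : Fin n}
    (hm : m a = 0) (j : ℕ) :
    Set.EqOn (firstOrderProd ((List.range j).reverse.map fun i : ℕ =>
        ((l a : ℂ) * ħ, -lam a + ((i : ℂ) + 1) * ħ)) fun t => ∫ r, laplaceFamily l lam ħ F m t r)
      (fun t => ∫ r, laplaceFamily l lam ħ F (Function.update m a j) t r) D := by
  induction j with
  | zero =>
    intro t _
    simp only [List.range_zero, List.reverse_nil, List.map_nil, firstOrderProd]
    rw [← hm, Function.update_eq_self]
  | succ j ih =>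
    rw [List.range_succ, List.reverse_append, List.reverse_singleton, List.singleton_append,
      List.map_cons]
    refine (firstOrder_congr hD _ _ ih).trans ?_
    simpa only [Function.update_self, Function.update_idem] using
      firstOrder_integral_laplaceFamily hħ hD hDr hF hdom (Function.update m a j) a

theorem firstOrderProd_flatMap_integral_laplaceFamily (hħ : ħ ≠ 0) (hD : IsOpen D)
    (hDr : ∀ t ∈ D, ∀ σ : ℝ, t + (σ : ℂ) ∈ D) (hF : DifferentiableOn ℂ F D)
    (hdom : ∀ m, LocDominated volume D (laplaceFamily l lam ħ F m)) {A : List (Fin n)}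
    (hA : A.Nodup) :
    Set.EqOn
      (firstOrderProd (A.flatMap fun a => (List.range (l a)).reverse.map fun i : ℕ =>
        ((l a : ℂ) * ħ, -lam a + ((i : ℂ) + 1) * ħ)) fun t => ∫ r, laplaceFamily l lam ħ F 0 t r)
      (fun t => ∫ r, laplaceFamily l lam ħ F (fun a => if a ∈ A then l a else 0) t r) D := by
  induction A with
  | nil => exact fun t _ => rfl
  | cons a A ih =>
    rw [List.nodup_cons] at hA
    have update_eq : Function.update (fun b => if b ∈ A then l b else 0) a (l a) =
        fun b => if b ∈ a :: A then l b else 0 := by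
      funext b
      rcases eq_or_ne b a with rfl | hb
      · simp
      · simp [hb]
    rw [List.flatMap_cons, firstOrderProd_append, ← update_eq]
    exact (firstOrderProd_congr hD _ (ih hA.2)).trans
      (firstOrderProd_range_reverse_integral_laplaceFamily hħ hD hDr hF hdom (if_neg hA.1) (l a))

theorem lamProd_integral_laplaceFamily (hħ : ħ ≠ 0) (hD : IsOpen D)
    (hDr : ∀ t ∈ D, ∀ σ : ℝ, t + (σ : ℂ) ∈ D) (hF : DifferentiableOn ℂ F D)
    (hdom : ∀ m, LocDominated volume D (laplaceFamily l lam ħ F m)) :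
    Set.EqOn (lamProd l lam ħ fun t => ∫ r, laplaceFamily l lam ħ F 0 t r)
      (fun t => ∫ r, laplaceFamily l lam ħ F l t r) D := by
  have reverse_perm := List.Perm.flatMap_left (List.finRange n)
    (f := fun a => (List.range (l a)).map fun i : ℕ =>
      ((l a : ℂ) * ħ, -lam a + ((i : ℂ) + 1) * ħ))
    (g := fun a => (List.range (l a)).reverse.map fun i : ℕ =>
      ((l a : ℂ) * ħ, -lam a + ((i : ℂ) + 1) * ħ))
    fun a _ => (List.reverse_perm _).symm.map _
  rw [lamProd_eq_firstOrderProd]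
  refine (firstOrderProd_perm hD reverse_perm ((hdom 0).differentiableOn_integral hD)).trans ?_
  simpa using firstOrderProd_flatMap_integral_laplaceFamily hħ hD hDr hF hdom
    (List.nodup_finRange n)

theorem wProd_laplaceFamily {k : ℕ} {w : Fin (k + 1) → ℂ}
    (hDr : ∀ t ∈ D, ∀ σ : ℝ, t + (σ : ℂ) ∈ D) (hGKZ : ∀ t ∈ D, cpGKZ w ħ F t = 0)
    {t : ℂ} (ht : t ∈ D) (r : Fin n → ℝ) :
    wProd w ħ (fun t => laplaceFamily l lam ħ F 0 t r) t =
      Complex.exp t * laplaceFamily l lam ħ F l t r := by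
  have wProd_F := hGKZ _ (add_sum_mem hDr ht l r)
  rw [cpGKZ, xHat, sub_eq_zero] at wProd_F
  have weight_l : laplaceWeight lam ħ l r = _ := zero_add l ▸ laplaceWeight_add 0 l r
  simp only [laplaceFamily]
  rw [wProd_eq_firstOrderProd, firstOrderProd_const_mul_translate, ← wProd_eq_firstOrderProd]
  simp only [wProd_F]
  rw [weight_l, Complex.exp_add]
  ring

/- Both operators act on the integrand: `∏ (ŷ - w_i)` through the equation of `F`, which multiplies
by `x ∏ v_a ^ l_a`, and `∏∏ (l_a ŷ - λ_a + m ħ)` through integration by parts, which multiplies by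
`∏ v_a ^ l_a`. -/
theorem ciGKZ_ciLaplace_of_locDominated {k : ℕ} {w : Fin (k + 1) → ℂ} (hħ : ħ ≠ 0)
    (hD : IsOpen D) (hDr : ∀ t ∈ D, ∀ σ : ℝ, t + (σ : ℂ) ∈ D) (hF : DifferentiableOn ℂ F D)
    (hGKZ : ∀ t ∈ D, cpGKZ w ħ F t = 0)
    (hdom : ∀ m, LocDominated volume D (laplaceFamily l lam ħ F m)) :
    ∀ t ∈ D, ciGKZ w l lam ħ (ciLaplace l lam ħ F) t = 0 := by
  intro t ht
  rw [funext (ciLaplace_eq_integral_laplaceFamily (l := l) (lam := lam) (ħ := ħ) (F := F)), ciGKZ,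
    xHat, lamProd_integral_laplaceFamily hħ hD hDr hF hdom ht, wProd_eq_firstOrderProd,
    (hdom 0).firstOrderProd_integral hD _ ht]
  simp only [← wProd_eq_firstOrderProd, wProd_laplaceFamily hDr hGKZ ht, integral_const_mul,
    sub_self]

theorem differentiableOn_ciLaplace_of_locDominated (hD : IsOpen D)
    (hdom : LocDominated volume D (laplaceFamily l lam ħ F 0)) :
    DifferentiableOn ℂ (ciLaplace l lam ħ F) D :=
  (hdom.differentiableOn_integral hD).congr fun t _ => ciLaplace_eq_integral_laplaceFamily t

end Laplace

/-! ### Domination of the Laplace integrand -/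

theorem eventually_mul_rpow_add_mul_log_le {α : ℝ} (hα : α < 1) (C K : ℝ) {c : ℝ} (hc : 0 < c) :
    ∀ᶠ x : ℝ in atTop, C * x ^ α + K * Real.log x ≤ c * x := by
  have tendsto_zero :
      Tendsto (fun x : ℝ => C * x ^ (-(1 - α)) + K * (Real.log x / x)) atTop (𝓝 0) := by
    simpa using ((tendsto_rpow_neg_atTop (sub_pos.mpr hα)).const_mul C).add
      ((Real.isLittleO_log_id_atTop.tendsto_div_nhds_zero).const_mul K)
  filter_upwards [tendsto_zero.eventually (gt_mem_nhds hc), eventually_gt_atTop 0] with x hx hx0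
  have rpow_mul_self : x ^ (-(1 - α)) * x = x ^ α := by
    rw [← Real.rpow_add_one hx0.ne', neg_sub, sub_add_cancel]
  calc C * x ^ α + K * Real.log x = (C * x ^ (-(1 - α)) + K * (Real.log x / x)) * x := by
        rw [add_mul, mul_assoc, rpow_mul_self, mul_assoc, div_mul_cancel₀ _ hx0.ne']
    _ ≤ c * x := mul_le_mul_of_nonneg_right hx.le hx0.le

theorem exists_exp_mul_rpow_mul_pow_le {α : ℝ} (hα : α < 1) (C : ℝ) (K : ℕ) {c : ℝ} (hc : 0 < c) :
    ∃ M : ℝ, 0 ≤ M ∧ ∀ x : ℝ, 1 ≤ x → Real.exp (C * x ^ α) * x ^ K ≤ M * Real.exp (c * x) := by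
  obtain ⟨R, hR⟩ := eventually_atTop.mp (eventually_mul_rpow_add_mul_log_le hα C K hc)
  have continuousOn_lhs :
      ContinuousOn (fun x : ℝ => Real.exp (C * x ^ α) * x ^ K) (Set.Icc 1 R) := by
    have continuousOn_rpow : ContinuousOn (fun x : ℝ => x ^ α) (Set.Icc 1 R) := fun x hx =>
      (Real.continuousAt_rpow_const x α (Or.inl (by linarith [hx.1]))).continuousWithinAt
    exact (Real.continuous_exp.comp_continuousOn (continuousOn_const.mul continuousOn_rpow)).mul
      (continuousOn_id.pow K)
  obtain ⟨B, hB⟩ := isCompact_Icc.exists_bound_of_continuousOn continuousOn_lhs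
  refine ⟨max B 1, le_max_of_le_right zero_le_one, fun x hx => ?_⟩
  have hx0 : 0 < x := by linarith
  rcases le_total x R with hxR | hRx
  · refine ((le_abs_self _).trans (hB x ⟨hx, hxR⟩)).trans ((le_max_left _ 1).trans ?_)
    exact le_mul_of_one_le_right (le_max_of_le_right zero_le_one)
      (Real.one_le_exp (by positivity))
  · refine le_trans ?_ (le_mul_of_one_le_left (Real.exp_pos _).le (le_max_right _ _))
    have pow_eq_exp : x ^ K = Real.exp (K * Real.log x) := by
      rw [mul_comm, Real.exp_mul, Real.exp_log hx0, Real.rpow_natCast]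
    rw [pow_eq_exp, ← Real.exp_add]
    exact Real.exp_le_exp.mpr (hR x hRx)

theorem inv_re_pos {z : ℂ} (hz : 0 < z.re) : 0 < (z⁻¹).re := by
  rw [Complex.inv_re]
  exact div_pos hz (Complex.normSq_pos.mpr fun h => by simp [h] at hz)

theorem integrable_prod_of_norm_add_le {X G E : Type*} [MeasurableSpace X] [MeasurableSpace G]
    [AddGroup G] [MeasurableAdd₂ G] [NormedAddCommGroup E]
    {μ : Measure G} [SFinite μ] [μ.IsAddRightInvariant] {ν : Measure X} [IsFiniteMeasure ν]
    {g : G × X → E} (hg : StronglyMeasurable g) {h : G → ℝ} (hh : Integrable h μ) (s : X → G)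
    (hgh : ∀ᵐ x ∂ν, ∀ r, ‖g (r + s x, x)‖ ≤ h r) : Integrable g (μ.prod ν) := by
  have integrable_shift : ∀ᵐ x ∂ν, Integrable (fun r => g (r + s x, x)) μ :=
    hgh.mono fun x hx => hh.mono' (hg.comp_measurable
      ((measurable_id.add_const (s x)).prodMk measurable_const)).aestronglyMeasurable
      (Eventually.of_forall hx)
  rw [integrable_prod_iff' hg.aestronglyMeasurable]
  constructor
  · exact integrable_shift.mono fun x hx => by simpa using hx.comp_sub_right (s x)
  · refine Integrable.of_bound hg.norm.integral_prod_left'.aestronglyMeasurable (∫ r, h r ∂μ) ?_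
    filter_upwards [hgh, integrable_shift] with x hx hint
    rw [Real.norm_of_nonneg (integral_nonneg fun _ => norm_nonneg _),
      ← integral_add_right_eq_self (fun r => ‖g (r, x)‖) (s x)]
    exact integral_mono hint.norm hh hx

section Laplace

variable {n : ℕ} {l : Fin n → ℕ} {lam : Fin n → ℂ} {ħ : ℂ} {F : ℂ → ℂ} {m : Fin n → ℕ} {D : Set ℂ}

theorem norm_laplaceWeight_zero (r : Fin n → ℝ) : ‖laplaceWeight lam ħ 0 r‖ =
    Real.exp (∑ a, (1 - (lam a / ħ).re) * r a - (ħ⁻¹).re * ∑ a, Real.exp (r a)) := by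
  rw [laplaceWeight_eq, Complex.norm_exp, Complex.sub_re, Complex.re_sum, div_eq_mul_inv,
    mul_comm _ ħ⁻¹]
  simp only [← Complex.ofReal_exp, ← Complex.ofReal_sum, Complex.re_mul_ofReal, Complex.sub_re,
    Pi.zero_apply, Nat.cast_zero, zero_add, Complex.one_re]

theorem exp_sum_mul_le_pow (m : Fin n → ℕ) (r : Fin n → ℝ) :
    Real.exp (∑ a, (m a : ℝ) * r a) ≤ (1 + ∑ a, Real.exp (r a)) ^ (∑ a, m a) := by
  simp only [Real.exp_sum, Real.exp_nat_mul, ← Finset.prod_pow_eq_pow_sum]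
  refine Finset.prod_le_prod (fun a _ => by positivity) fun a ha => ?_
  have exp_le_sum := Finset.single_le_sum (f := fun a => Real.exp (r a))
    (fun b _ => (Real.exp_pos _).le) ha
  gcongr
  linarith

theorem norm_laplaceWeight_le (m : Fin n → ℕ) (r : Fin n → ℝ) : ‖laplaceWeight lam ħ m r‖ ≤
    (1 + ∑ a, Real.exp (r a)) ^ (∑ a, m a) * ‖laplaceWeight lam ħ 0 r‖ := by
  have exponent_eq : ∑ a, (m a : ℂ) * (r a : ℂ) = ((∑ a, (m a : ℝ) * r a : ℝ) : ℂ) := by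
    push_cast
    rfl
  rw [← zero_add m, laplaceWeight_add, zero_add, norm_mul, Complex.norm_exp, exponent_eq,
    Complex.ofReal_re]
  exact mul_le_mul_of_nonneg_right (exp_sum_mul_le_pow m r) (norm_nonneg _)

/- Scaling all `v_a` by `exp s ≥ 2` gains a factor `exp (-Re (1 / ħ) ∑ v_a)`, half of which is spent
on the exponential on the left. -/
theorem exp_mul_norm_laplaceWeight_add_const_le (hc : 0 ≤ (ħ⁻¹).re) {s : ℝ}
    (hs : 2 ≤ Real.exp s) (r : Fin n → ℝ) :
    Real.exp ((ħ⁻¹).re / 2 * ∑ a, Real.exp (r a + s)) * ‖laplaceWeight lam ħ 0 fun a => r a + s‖ ≤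
      Real.exp (s * ∑ a, (1 - (lam a / ħ).re)) * ‖laplaceWeight lam ħ 0 r‖ := by
  have sum_exp : ∑ a, Real.exp (r a + s) = Real.exp s * ∑ a, Real.exp (r a) := by
    simp only [Real.exp_add, Finset.mul_sum, mul_comm]
  have sum_linear : ∑ a, (1 - (lam a / ħ).re) * (r a + s) =
      ∑ a, (1 - (lam a / ħ).re) * r a + s * ∑ a, (1 - (lam a / ħ).re) := by
    simp only [mul_add, Finset.sum_add_distrib, ← Finset.sum_mul]
    rw [mul_comm s]
  have decay := mul_le_mul_of_nonneg_right hs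
    (mul_nonneg hc (Finset.univ.sum_nonneg fun a _ => (Real.exp_pos (r a)).le))
  rw [norm_laplaceWeight_zero, norm_laplaceWeight_zero, ← Real.exp_add, ← Real.exp_add,
    Real.exp_le_exp, sum_exp, sum_linear]
  linarith

theorem continuous_laplaceFamily (hDr : ∀ t ∈ D, ∀ σ : ℝ, t + (σ : ℂ) ∈ D)
    (hF : ContinuousOn F D) {t : ℂ} (ht : t ∈ D) : Continuous (laplaceFamily l lam ħ F m t) :=
  continuous_laplaceWeight.mul (hF.comp_continuous (by fun_prop) (add_sum_mem hDr ht l))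

theorem add_sum_mul_add_div_sum (hl : 0 < ∑ a, l a) (t : ℂ) (r : Fin n → ℝ) (s σ : ℝ) :
    t + ∑ a, (l a : ℂ) * ((r a + (s - σ) / ((∑ a, l a : ℕ) : ℝ) : ℝ) : ℂ) + (σ : ℂ) =
      t + s + ∑ a, (l a : ℂ) * (r a : ℂ) := by
  have sum_ne_zero : (∑ a, (l a : ℂ)) ≠ 0 := by exact_mod_cast hl.ne'
  push_cast
  simp only [mul_add, Finset.sum_add_distrib]
  rw [← Finset.sum_mul, mul_div_cancel₀ _ sum_ne_zero]
  ring

/- Moving the integration variables by the constant `(S - σ) / ∑ l_a` absorbs the translation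
`σ`, so that all integrals over the window are dominated by the one at `t + S`. -/
theorem integrable_laplaceWindow (hl : 0 < ∑ a, l a) (hħ : 0 < ħ.re)
    (hDr : ∀ t ∈ D, ∀ σ : ℝ, t + (σ : ℂ) ∈ D) (hF : ContinuousOn F D)
    (hint : ∀ t ∈ D, Integrable (laplaceFamily l lam ħ F 0 t)) {t : ℂ} (ht : t ∈ D) {a b : ℝ}
    (hab : a ≤ b) :
    Integrable fun r : Fin n → ℝ => ∫ σ in a..b,
      Real.exp ((ħ⁻¹).re / 2 * ∑ a, Real.exp (r a)) * ‖laplaceWeight lam ħ 0 r‖ *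
        ‖F (t + ∑ a, (l a : ℂ) * (r a : ℂ) + σ)‖ := by
  set ℓ : ℝ := ((∑ a, l a : ℕ) : ℝ) with hℓ
  have hℓ0 : 0 < ℓ := Nat.cast_pos.mpr hl
  set S : ℝ := b + ℓ * Real.log 2 with hS
  set κ : ℝ := ∑ a, (1 - (lam a / ħ).re)
  set g : (Fin n → ℝ) × ℝ → ℝ := fun p =>
    Real.exp ((ħ⁻¹).re / 2 * ∑ a, Real.exp (p.1 a)) * ‖laplaceWeight lam ħ 0 p.1‖ *
      ‖F (t + ∑ a, (l a : ℂ) * (p.1 a : ℂ) + (p.2 : ℂ))‖ with hg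
  have continuous_g : Continuous g :=
    (Continuous.mul (by fun_prop) (continuous_laplaceWeight.comp continuous_fst).norm).mul
      (hF.comp_continuous (f := fun p : (Fin n → ℝ) × ℝ =>
        t + ∑ a, (l a : ℂ) * (p.1 a : ℂ) + (p.2 : ℂ)) (by fun_prop)
        fun p => hDr _ (add_sum_mem hDr ht l p.1) p.2).norm
  have g_shift_le : ∀ σ ∈ Set.Ioc a b, ∀ r : Fin n → ℝ, ‖g (r + fun _ => (S - σ) / ℓ, σ)‖ ≤
      Real.exp ((S - a) / ℓ * |κ|) * ‖laplaceFamily l lam ħ F 0 (t + S) r‖ := by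
    intro σ hσ r
    have log_two_le : Real.log 2 ≤ (S - σ) / ℓ := by
      rw [le_div_iff₀ hℓ0, hS]
      linarith [hσ.2]
    have shift_le : (S - σ) / ℓ * κ ≤ (S - a) / ℓ * |κ| :=
      (mul_le_mul_of_nonneg_left (le_abs_self κ)
        ((Real.log_nonneg one_le_two).trans log_two_le)).trans (mul_le_mul_of_nonneg_right
          (div_le_div_of_nonneg_right (by linarith [hσ.1]) hℓ0.le) (abs_nonneg κ))
    rw [Real.norm_of_nonneg (by positivity)]
    simp only [hg, Pi.add_apply, hℓ, add_sum_mul_add_div_sum hl, laplaceFamily, norm_mul]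
    rw [← mul_assoc]
    refine mul_le_mul_of_nonneg_right ?_ (norm_nonneg _)
    exact (exp_mul_norm_laplaceWeight_add_const_le (inv_re_pos hħ).le
      ((Real.log_le_iff_le_exp two_pos).mp log_two_le) r).trans
      (mul_le_mul_of_nonneg_right (Real.exp_le_exp.mpr shift_le) (norm_nonneg _))
  have integrable_g : Integrable g (volume.prod (volume.restrict (Set.Ioc a b))) :=
    integrable_prod_of_norm_add_le continuous_g.stronglyMeasurable
      ((hint _ (hDr t ht S)).norm.const_mul _) (fun σ _ => (S - σ) / ℓ)
      ((ae_restrict_mem measurableSet_Ioc).mono g_shift_le)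
  simpa only [intervalIntegral.integral_of_le hab] using integrable_g.integral_prod_left

theorem exists_norm_ofReal_add_le (d : ℂ) : ∃ ζ : ℂ, ‖ζ‖ = 1 ∧ ζ.re = 0 ∧
    (d.re : ℂ) + (|d.im| : ℝ) * ζ = d ∧
    ∀ s ∈ Set.Icc 0 |d.im|, ‖(d.re : ℂ) + (s : ℂ) * ζ‖ ≤ ‖d‖ := by
  obtain ⟨ε, hε, hd⟩ : ∃ ε : ℝ, |ε| = 1 ∧ d.im = |d.im| * ε := by
    rcases abs_cases d.im with h | h
    · exact ⟨1, by simp, by linarith⟩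
    · exact ⟨-1, by simp, by linarith⟩
  refine ⟨ε * Complex.I, by simp [hε], by simp, ?_, fun s hs => ?_⟩
  · rw [← mul_assoc, ← Complex.ofReal_mul, ← hd, Complex.re_add_im]
  · rw [← sq_le_sq₀ (norm_nonneg _) (norm_nonneg _), Complex.sq_norm, Complex.sq_norm, ← mul_assoc,
      ← Complex.ofReal_mul, Complex.normSq_add_mul_I, mul_pow, ← sq_abs ε, hε, Complex.normSq_apply]
    nlinarith [hs.1, hs.2, abs_mul_abs_self d.im]

theorem integral_const_add_le_integral {g : ℝ → ℝ} (hg : Continuous g) (hg0 : ∀ σ, 0 ≤ g σ)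
    {ρ : ℝ} (hρ : |ρ| ≤ 1) : ∫ σ in (0 : ℝ)..1, g (ρ + σ) ≤ ∫ σ in (-1 : ℝ)..2, g σ := by
  obtain ⟨neg_one_le, le_one⟩ := abs_le.mp hρ
  rw [intervalIntegral.integral_comp_add_left g ρ]
  exact intervalIntegral.integral_mono_interval (by linarith) (by linarith) (by linarith)
    (Eventually.of_forall hg0) (hg.intervalIntegrable _ _)

/- The point `t₀ + d` is reached from `t₀` by a horizontal and then a vertical segment; the vertical
one is controlled by the equation, the horizontal one only moves the window. -/
theorem exists_norm_add_add_ofReal_le_of_cpGKZ {k : ℕ} {w : Fin (k + 1) → ℂ} (hħ : ħ ≠ 0)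
    (hD : IsOpen D) (hDr : ∀ t ∈ D, ∀ σ : ℝ, t + (σ : ℂ) ∈ D) (hF : DifferentiableOn ℂ F D)
    (hGKZ : ∀ t ∈ D, cpGKZ w ħ F t = 0) :
    ∃ C K : ℝ, 0 ≤ C ∧ 0 ≤ K ∧ ∀ t₀ : ℂ, ∀ ε : ℝ, ball t₀ ε ⊆ D → ∀ d : ℂ, ‖d‖ < ε → ‖d‖ ≤ 1 →
      ∀ z ν : ℝ, 1 ≤ ν → Real.exp (t₀.re + d.re + z) ≤ ν ^ (k + 1) →
        ‖F (t₀ + d + z)‖ ≤ C * Real.exp (K * ν) *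
          ((1 + Real.exp (t₀.re + d.re + z)) * ∫ σ in (-1 : ℝ)..2, ‖F (t₀ + z + σ)‖) := by
  obtain ⟨C, K, hC, hK, hbound⟩ := exists_norm_le_integral_of_cpGKZ hħ hD hDr hF hGKZ
  refine ⟨C, K, hC, hK, fun t₀ ε hball d hdε hd1 z ν hν hexp => ?_⟩
  have ht₀ : t₀ ∈ D := hball (mem_ball_self ((norm_nonneg d).trans_lt hdε))
  obtain ⟨ζ, norm_ζ, re_ζ, d_eq, norm_segment_le⟩ := exists_norm_ofReal_add_le d
  set t₁ : ℂ := t₀ + d.re + z with ht₁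
  have re_t₁ : t₁.re = t₀.re + d.re + z := by simp [ht₁]
  rw [← re_t₁] at hexp ⊢
  have segment_mem : ∀ s ∈ Set.Icc 0 |d.im|, t₁ + s * ζ ∈ D := fun s hs => by
    have regroup : t₁ + s * ζ = (t₀ + (d.re + s * ζ)) + (z : ℂ) := by rw [ht₁]; ring
    rw [regroup]
    refine hDr _ (hball ?_) _
    rw [mem_ball, dist_eq_norm, add_sub_cancel_left]
    exact (norm_segment_le s hs).trans_lt hdε
  have endpoint_eq : t₁ + (|d.im| : ℝ) * ζ = t₀ + d + z := by
    linear_combination ht₁ + d_eq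
  have window_le : ∫ σ in (0 : ℝ)..1, ‖F (t₁ + σ)‖ ≤ ∫ σ in (-1 : ℝ)..2, ‖F (t₀ + z + σ)‖ := by
    have arg_eq (σ : ℝ) : t₁ + σ = t₀ + z + ((d.re + σ : ℝ) : ℂ) := by rw [ht₁]; push_cast; ring
    simp only [arg_eq]
    exact integral_const_add_le_integral (continuous_comp_add_ofReal hDr hF.continuousOn
      (hDr _ ht₀ z)).norm (fun _ => norm_nonneg _) ((Complex.abs_re_le_norm d).trans hd1)
  have exp_le : Real.exp (K * ν * |d.im|) ≤ Real.exp (K * ν) :=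
    Real.exp_le_exp.mpr (mul_le_of_le_one_right (by positivity)
      ((Complex.abs_im_le_norm d).trans hd1))
  rw [← endpoint_eq]
  exact (hbound t₁ (hDr _ (hDr _ ht₀ _) _) ζ norm_ζ re_ζ _ (abs_nonneg _) segment_mem ν hν
    hexp).trans (mul_le_mul (mul_le_mul_of_nonneg_left exp_le hC)
      (mul_le_mul_of_nonneg_left window_le (by positivity))
      (mul_nonneg (by positivity) (intervalIntegral.integral_nonneg zero_le_one
        fun _ _ => norm_nonneg _)) (by positivity))

theorem exists_norm_add_ofReal_le_of_cpGKZ {k : ℕ} {w : Fin (k + 1) → ℂ} (hħ : ħ ≠ 0)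
    (hD : IsOpen D) (hDr : ∀ t ∈ D, ∀ σ : ℝ, t + (σ : ℂ) ∈ D) (hF : DifferentiableOn ℂ F D)
    (hGKZ : ∀ t ∈ D, cpGKZ w ħ F t = 0) {t₀ : ℂ} (ht₀ : t₀ ∈ D) :
    ∃ δ > 0, ball t₀ δ ⊆ D ∧ ∃ A B : ℝ, 0 ≤ A ∧ 0 ≤ B ∧ ∀ t ∈ ball t₀ δ, ∀ z μ : ℝ,
      1 ≤ μ → Real.exp z ≤ μ ^ (k + 1) →
        ‖F (t + z)‖ ≤ A * Real.exp (B * μ) * μ ^ (k + 1) * ∫ σ in (-1)..2, ‖F (t₀ + z + σ)‖ := by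
  obtain ⟨ε, hε, hball⟩ := Metric.isOpen_iff.mp hD t₀ ht₀
  obtain ⟨C, K, hC, hK, hbound⟩ := exists_norm_add_add_ofReal_le_of_cpGKZ hħ hD hDr hF hGKZ
  set E : ℝ := Real.exp (t₀.re + 1)
  have hE0 : 0 < E := Real.exp_pos _
  refine ⟨min ε 1, lt_min hε one_pos, (ball_subset_ball (min_le_left _ _)).trans hball,
    C * (1 + E), K * (1 + E), by positivity, by positivity, fun t ht z μ hμ hz => ?_⟩
  obtain ⟨d, rfl⟩ : ∃ d, t = t₀ + d := ⟨t - t₀, by ring⟩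
  obtain ⟨norm_d_lt, norm_d_lt_one⟩ : ‖d‖ < ε ∧ ‖d‖ < 1 := by
    simpa only [mem_ball, dist_eq_norm, add_sub_cancel_left, lt_min_iff] using ht
  have exp_re_le : Real.exp (t₀.re + d.re + z) ≤ E * μ ^ (k + 1) := by
    rw [Real.exp_add]
    exact mul_le_mul (Real.exp_le_exp.mpr (by linarith [Complex.re_le_norm d])) hz
      (Real.exp_pos _).le hE0.le
  have exp_re_le_pow : Real.exp (t₀.re + d.re + z) ≤ ((1 + E) * μ) ^ (k + 1) := by
    rw [mul_pow]
    refine exp_re_le.trans (mul_le_mul_of_nonneg_right ?_ (by positivity))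
    exact le_trans (by linarith) (le_self_pow₀ (by linarith) (Nat.succ_ne_zero k))
  have one_add_exp_le : 1 + Real.exp (t₀.re + d.re + z) ≤ (1 + E) * μ ^ (k + 1) := by
    linarith [one_le_pow₀ hμ (n := k + 1)]
  have window_nonneg : 0 ≤ ∫ σ in (-1 : ℝ)..2, ‖F (t₀ + z + σ)‖ :=
    intervalIntegral.integral_nonneg (by norm_num) fun _ _ => norm_nonneg _
  calc ‖F (t₀ + d + z)‖
      ≤ C * Real.exp (K * ((1 + E) * μ)) * ((1 + Real.exp (t₀.re + d.re + z)) *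
          ∫ σ in (-1 : ℝ)..2, ‖F (t₀ + z + σ)‖) :=
        hbound t₀ ε hball d norm_d_lt norm_d_lt_one.le z _
          (one_le_mul_of_one_le_of_one_le (by linarith) hμ) exp_re_le_pow
    _ ≤ C * Real.exp (K * ((1 + E) * μ)) * ((1 + E) * μ ^ (k + 1) *
          ∫ σ in (-1 : ℝ)..2, ‖F (t₀ + z + σ)‖) :=
        mul_le_mul_of_nonneg_left (mul_le_mul_of_nonneg_right one_add_exp_le window_nonneg)
          (by positivity)
    _ = _ := by rw [← mul_assoc K]; ring

theorem locDominated_laplaceFamily_zero {l : Fin 0 → ℕ} {lam : Fin 0 → ℂ} (hD : IsOpen D)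
    (hF : DifferentiableOn ℂ F D) (m : Fin 0 → ℕ) :
    LocDominated volume D (laplaceFamily l lam ħ F m) where
  holo r := by simpa [laplaceFamily] using hF.const_mul (laplaceWeight lam ħ m r)
  meas t _ := by
    have : laplaceFamily l lam ħ F m t = fun r => laplaceWeight lam ħ m r * F t := by
      simp [funext_iff, laplaceFamily]
    rw [this]
    exact (continuous_laplaceWeight.mul continuous_const).aestronglyMeasurable
  bound t₀ ht₀ := by
    obtain ⟨ε, hε, hball⟩ := Metric.isOpen_iff.mp hD t₀ ht₀
    obtain ⟨δ, hδ, hle⟩ := Metric.continuousAt_iff.mp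
      (hF.continuousOn.continuousAt (hD.mem_nhds ht₀)) 1 one_pos
    refine ⟨min ε δ, lt_min hε hδ, (ball_subset_ball (min_le_left _ _)).trans hball,
      fun r => ‖laplaceWeight lam ħ m r‖ * (‖F t₀‖ + 1), ?_, fun t ht r => ?_⟩
    · have : IsFiniteMeasure (volume : Measure (Fin 0 → ℝ)) := by
        rw [volume_pi, Measure.pi_of_empty]
        infer_instance
      exact Integrable.of_finite
    · rw [laplaceFamily, norm_mul, Finset.univ_eq_empty, Finset.sum_empty, add_zero]
      refine mul_le_mul_of_nonneg_left ?_ (norm_nonneg _)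
      have dist_lt := hle (mem_ball.mp (ball_subset_ball (min_le_right _ _) ht))
      rw [dist_eq_norm] at dist_lt
      linarith [norm_sub_norm_le (F t) (F t₀)]

/- With `x = 1 + ∑ v_a` and `μ = x ^ (∑ l_a / (k + 1))`, the factor `exp (B * μ)` grows
subexponentially in `x` because `∑ l_a < k + 1`. -/
theorem exists_norm_laplaceFamily_le {k : ℕ} {w : Fin (k + 1) → ℂ} (hħ : 0 < ħ.re)
    (hlk : ∑ a, l a < k + 1) (hD : IsOpen D) (hDr : ∀ t ∈ D, ∀ σ : ℝ, t + (σ : ℂ) ∈ D)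
    (hF : DifferentiableOn ℂ F D) (hGKZ : ∀ t ∈ D, cpGKZ w ħ F t = 0) (m : Fin n → ℕ) {t₀ : ℂ}
    (ht₀ : t₀ ∈ D) :
    ∃ δ > 0, ball t₀ δ ⊆ D ∧ ∃ M : ℝ, ∀ t ∈ ball t₀ δ, ∀ r,
      ‖laplaceFamily l lam ħ F m t r‖ ≤ M * ∫ σ in (-1)..2,
        Real.exp ((ħ⁻¹).re / 2 * ∑ a, Real.exp (r a)) * ‖laplaceWeight lam ħ 0 r‖ *
          ‖F (t₀ + ∑ a, (l a : ℂ) * (r a : ℂ) + σ)‖ := by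
  obtain ⟨δ, hδ, hball, A, B, hA, -, hbound⟩ := exists_norm_add_ofReal_le_of_cpGKZ
    (fun h => by simp [h] at hħ) hD hDr hF hGKZ ht₀
  set ℓ : ℕ := ∑ a, l a with hℓ
  set α : ℝ := (ℓ : ℝ) / ((k + 1 : ℕ) : ℝ) with hα
  have hk0 : (0 : ℝ) < ((k + 1 : ℕ) : ℝ) := by positivity
  have hα1 : α < 1 := (div_lt_one hk0).mpr (Nat.cast_lt.mpr hlk)
  obtain ⟨M, -, hM⟩ := exists_exp_mul_rpow_mul_pow_le hα1 B (∑ a, m a + ℓ)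
    (half_pos (inv_re_pos hħ))
  refine ⟨δ, hδ, hball, A * M * Real.exp ((ħ⁻¹).re / 2), fun t ht r => ?_⟩
  set x : ℝ := 1 + ∑ a, Real.exp (r a) with hx
  have hx1 : 1 ≤ x :=
    le_add_of_nonneg_right (Finset.sum_nonneg fun a _ => (Real.exp_pos (r a)).le)
  have rpow_pow : (x ^ α) ^ (k + 1) = x ^ ℓ := by
    rw [← Real.rpow_mul_natCast (by linarith), hα, div_mul_cancel₀ _ hk0.ne', Real.rpow_natCast]
  have sum_eq : ∑ a, (l a : ℂ) * (r a : ℂ) = ((∑ a, (l a : ℝ) * r a : ℝ) : ℂ) := by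
    push_cast
    rfl
  have norm_F_le := hbound t ht (∑ a, (l a : ℝ) * r a) (x ^ α)
    (Real.one_le_rpow hx1 (by positivity)) (rpow_pow ▸ exp_sum_mul_le_pow l r)
  rw [rpow_pow, ← sum_eq] at norm_F_le
  rw [intervalIntegral.integral_const_mul, laplaceFamily, norm_mul]
  set J := ∫ σ in (-1 : ℝ)..2, ‖F (t₀ + ∑ a, (l a : ℂ) * (r a : ℂ) + σ)‖
  have hJ : 0 ≤ J := intervalIntegral.integral_nonneg (by norm_num) fun _ _ => norm_nonneg _
  calc ‖laplaceWeight lam ħ m r‖ * ‖F (t + ∑ a, (l a : ℂ) * (r a : ℂ))‖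
      ≤ (x ^ (∑ a, m a) * ‖laplaceWeight lam ħ 0 r‖) *
          (A * Real.exp (B * x ^ α) * x ^ ℓ * J) :=
        mul_le_mul (norm_laplaceWeight_le m r) norm_F_le (norm_nonneg _) (by positivity)
    _ = (Real.exp (B * x ^ α) * x ^ (∑ a, m a + ℓ)) * (A * ‖laplaceWeight lam ħ 0 r‖ * J) := by
        rw [pow_add]; ring
    _ ≤ (M * Real.exp ((ħ⁻¹).re / 2 * x)) * (A * ‖laplaceWeight lam ħ 0 r‖ * J) :=
        mul_le_mul_of_nonneg_right (hM x hx1) (by positivity)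
    _ = _ := by rw [hx, mul_add, mul_one, Real.exp_add]; ring

theorem locDominated_laplaceFamily {k : ℕ} {w : Fin (k + 1) → ℂ} (hħ : 0 < ħ.re)
    (hl : ∀ a, 0 < l a) (hlk : ∑ a, l a < k + 1) (hD : IsOpen D)
    (hDr : ∀ t ∈ D, ∀ σ : ℝ, t + (σ : ℂ) ∈ D) (hF : DifferentiableOn ℂ F D)
    (hGKZ : ∀ t ∈ D, cpGKZ w ħ F t = 0)
    (hint : ∀ t ∈ D, Integrable (laplaceFamily l lam ħ F 0 t)) (m : Fin n → ℕ) :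
    LocDominated volume D (laplaceFamily l lam ħ F m) := by
  rcases n.eq_zero_or_pos with rfl | hn
  · exact locDominated_laplaceFamily_zero hD hF m
  have sum_pos : 0 < ∑ a, l a := Finset.sum_pos (fun a _ => hl a) ⟨⟨0, hn⟩, Finset.mem_univ _⟩
  refine ⟨fun r => ?_, fun t ht => ?_, fun t₀ ht₀ => ?_⟩
  · exact (hF.comp (by fun_prop) fun t ht => add_sum_mem hDr ht l r).const_mul _
  · exact (continuous_laplaceFamily hDr hF.continuousOn ht).aestronglyMeasurable
  · obtain ⟨δ, hδ, hball, M, hM⟩ := exists_norm_laplaceFamily_le hħ hlk hD hDr hF hGKZ m ht₀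
    exact ⟨δ, hδ, hball, _, (integrable_laplaceWindow sum_pos hħ hDr hF.continuousOn hint ht₀
      (by norm_num)).const_mul M, hM⟩

end Laplace

/-! ### Complete intersections -/

section CompleteIntersection

variable {k n : ℕ} {w : Fin (k + 1) → ℂ} {l : Fin n → ℕ} {lam : Fin n → ℂ} {ħ : ℂ}
  {γ : EuclideanSpace ℝ (Fin k) → (Fin k → ℂ)} {D : Set ℂ} {F : ℂ → ℂ}

theorem differentiableOn_cpGKZ (hD : IsOpen D) (hF : DifferentiableOn ℂ F D) :
    DifferentiableOn ℂ (cpGKZ w ħ F) D := by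
  have differentiableOn_wProd : DifferentiableOn ℂ (wProd w ħ F) D := by
    rw [wProd_eq_firstOrderProd]
    exact differentiableOn_firstOrderProd hD _ hF
  exact differentiableOn_wProd.sub (Complex.differentiable_exp.differentiableOn.mul hF)

theorem cpGKZ_congr (hD : IsOpen D) {G : ℂ → ℂ} (h : Set.EqOn F G D) :
    Set.EqOn (cpGKZ w ħ F) (cpGKZ w ħ G) D := by
  intro t ht
  simp only [cpGKZ, xHat, wProd_eq_firstOrderProd]
  rw [firstOrderProd_congr hD _ h ht, h ht]

theorem ciGKZ_congr (hD : IsOpen D) {G : ℂ → ℂ} (h : Set.EqOn F G D) :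
    Set.EqOn (ciGKZ w l lam ħ F) (ciGKZ w l lam ħ G) D := by
  intro t ht
  simp only [ciGKZ, xHat, wProd_eq_firstOrderProd, lamProd_eq_firstOrderProd]
  rw [firstOrderProd_congr hD _ h ht, firstOrderProd_congr hD _ h ht]

theorem cpGKZ_eq_zero_of_eqOn (hD : IsOpen D) (hDc : IsPreconnected D)
    (hF : DifferentiableOn ℂ F D) {U : Set ℂ} (hUD : U ⊆ D) (hU : IsOpen U) (hUne : U.Nonempty)
    {G : ℂ → ℂ} (hFG : Set.EqOn F G U) (hG : ∀ t ∈ U, cpGKZ w ħ G t = 0) :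
    ∀ t ∈ D, cpGKZ w ħ F t = 0 := by
  obtain ⟨z, hz⟩ := hUne
  refine ((differentiableOn_cpGKZ hD hF).analyticOnNhd
    hD).eqOn_zero_of_preconnected_of_eventuallyEq_zero hDc (hUD hz) ?_
  filter_upwards [hU.mem_nhds hz] with t ht
  rw [cpGKZ_congr hU hFG ht, hG t ht, Pi.zero_apply]

theorem differentiableOn_cpIntegral (hγ : ContDiff ℝ 1 γ) (hD : IsOpen D)
    (hint : ∀ t ∈ D, Integrable (cpIntegrand w ħ γ t)) :
    DifferentiableOn ℂ (cpIntegral w ħ γ) D :=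
  (locDominated_cpIntegrand hγ hD hint).differentiableOn_integral hD

theorem differentiableOn_ciLaplace (hħ : 0 < ħ.re) (hl : ∀ a, 0 < l a) (hlk : ∑ a, l a < k + 1)
    (hD : IsOpen D) (hDr : ∀ t ∈ D, ∀ σ : ℝ, t + (σ : ℂ) ∈ D) (hF : DifferentiableOn ℂ F D)
    (hGKZ : ∀ t ∈ D, cpGKZ w ħ F t = 0)
    (hint : ∀ t ∈ D, IntegrableOn (laplaceIntegrand l lam ħ F t) (orthant n)) :
    DifferentiableOn ℂ (ciLaplace l lam ħ F) D :=
  differentiableOn_ciLaplace_of_locDominated hD <|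
    locDominated_laplaceFamily hħ hl hlk hD hDr hF hGKZ
      (fun t ht => (integrableOn_laplaceIntegrand_iff t).mp (hint t ht)) 0

theorem ciGKZ_ciLaplace (hħ : 0 < ħ.re) (hl : ∀ a, 0 < l a) (hlk : ∑ a, l a < k + 1)
    (hD : IsOpen D) (hDr : ∀ t ∈ D, ∀ σ : ℝ, t + (σ : ℂ) ∈ D) (hF : DifferentiableOn ℂ F D)
    (hGKZ : ∀ t ∈ D, cpGKZ w ħ F t = 0)
    (hint : ∀ t ∈ D, IntegrableOn (laplaceIntegrand l lam ħ F t) (orthant n)) :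
    ∀ t ∈ D, ciGKZ w l lam ħ (ciLaplace l lam ħ F) t = 0 :=
  ciGKZ_ciLaplace_of_locDominated (fun h => by simp [h] at hħ) hD hDr hF hGKZ <|
    locDominated_laplaceFamily hħ hl hlk hD hDr hF hGKZ fun t ht =>
      (integrableOn_laplaceIntegrand_iff t).mp (hint t ht)

theorem measurableSet_orthant : MeasurableSet (orthant n) := by
  have orthant_eq_pi : orthant n = Set.univ.pi fun _ => Set.Ioi 0 := by
    ext v
    simp [orthant]
  rw [orthant_eq_pi]
  exact MeasurableSet.univ_pi fun _ => measurableSet_Ioi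

/-- The weight `exp (-(∑ v_a + lam_a log v_a) / ħ)` of the Laplace transform in the original
coordinates `v`. -/
noncomputable def orthantWeight (lam : Fin n → ℂ) (ħ : ℂ) (v : Fin n → ℝ) : ℂ :=
  Complex.exp (-(∑ a, ((v a : ℂ) + lam a * (Real.log (v a) : ℂ))) / ħ)

theorem ciIntegrand_eq (t : ℂ) (y : EuclideanSpace ℝ (Fin k)) {v : Fin n → ℝ} (hv : v ∈ orthant n) :
    ciIntegrand w l lam ħ γ t (y, v) =
      orthantWeight lam ħ v * cpIntegrand w ħ γ (t + ∑ a, (l a : ℂ) * (Real.log (v a) : ℂ)) y := by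
  simp only [ciIntegrand, cpIntegrand, orthantWeight]
  rw [← mul_assoc, ← Complex.exp_add, ← add_div]
  congr 3
  have exp_log (a : Fin n) : Complex.exp (Real.log (v a) : ℂ) = v a := by
    rw [← Complex.ofReal_exp, Real.exp_log (hv a)]
  simp only [ciPotential, cpPotential, exp_log]
  ring

theorem restrict_univ_prod_orthant :
    (volume : Measure (EuclideanSpace ℝ (Fin k) × (Fin n → ℝ))).restrict
      (Set.univ ×ˢ orthant n) = volume.prod (volume.restrict (orthant n)) := by
  rw [Measure.volume_eq_prod, ← Measure.prod_restrict, Measure.restrict_univ]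

theorem integrable_prod_of_integrableOn_ciIntegrand {t : ℂ}
    (h : IntegrableOn (ciIntegrand w l lam ħ γ t) (Set.univ ×ˢ orthant n)) :
    Integrable (fun p : EuclideanSpace ℝ (Fin k) × (Fin n → ℝ) => orthantWeight lam ħ p.2 *
      cpIntegrand w ħ γ (t + ∑ a, (l a : ℂ) * (Real.log (p.2 a) : ℂ)) p.1)
      (volume.prod (volume.restrict (orthant n))) := by
  rw [← restrict_univ_prod_orthant]
  exact (integrableOn_congr_fun (fun p hp => ciIntegrand_eq t p.1 hp.2)
    (MeasurableSet.univ.prod measurableSet_orthant)).mp h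

theorem integral_orthantWeight_mul_cpIntegrand (t : ℂ) (v : Fin n → ℝ) :
    ∫ y, orthantWeight lam ħ v *
        cpIntegrand w ħ γ (t + ∑ a, (l a : ℂ) * (Real.log (v a) : ℂ)) y =
      laplaceIntegrand l lam ħ (cpIntegral w ħ γ) t v :=
  integral_const_mul _ _

theorem integrableOn_laplaceIntegrand_of_ciIntegrand {t : ℂ}
    (h : IntegrableOn (ciIntegrand w l lam ħ γ t) (Set.univ ×ˢ orthant n)) :
    IntegrableOn (laplaceIntegrand l lam ħ (cpIntegral w ħ γ) t) (orthant n) := by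
  simpa only [IntegrableOn, integral_orthantWeight_mul_cpIntegrand]
    using (integrable_prod_of_integrableOn_ciIntegrand h).integral_prod_right

theorem ciIntegral_eq_ciLaplace {t : ℂ}
    (h : IntegrableOn (ciIntegrand w l lam ħ γ t) (Set.univ ×ˢ orthant n)) :
    ciIntegral w l lam ħ γ t = ciLaplace l lam ħ (cpIntegral w ħ γ) t := by
  rw [ciIntegral, setIntegral_congr_fun (MeasurableSet.univ.prod measurableSet_orthant)
    (fun p hp => ciIntegrand_eq t p.1 hp.2), restrict_univ_prod_orthant,
    integral_prod_symm _ (integrable_prod_of_integrableOn_ciIntegrand h)]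
  simp only [integral_orthantWeight_mul_cpIntegrand, ciLaplace]

theorem exists_mem_of_ae_restrict {α : Type*} [TopologicalSpace α] [MeasurableSpace α]
    [OpensMeasurableSpace α] {μ : Measure α} [μ.IsOpenPosMeasure] {s A : Set α} {p : α → Prop}
    (h : ∀ᵐ x ∂μ.restrict s, p x) (hA : IsOpen A) (hAne : A.Nonempty) (hAs : A ⊆ s) :
    ∃ x ∈ A, p x := by
  have : (ae (μ.restrict A)).NeBot := ae_restrict_neBot.mpr (hA.measure_pos μ hAne).ne'
  exact ((ae_restrict_mem hA.measurableSet).and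
    (ae_restrict_of_ae_restrict_of_subset hAs h)).exists

theorem exists_mem_Ioo_of_ae_restrict_orthant {p : (Fin n → ℝ) → Prop}
    (h : ∀ᵐ v ∂volume.restrict (orthant n), p v) {a b : ℝ} (ha : 0 ≤ a) (hab : a < b) :
    ∃ v, (∀ i, v i ∈ Set.Ioo a b) ∧ p v := by
  obtain ⟨v, hv, hp⟩ := exists_mem_of_ae_restrict h
    (isOpen_set_pi Set.finite_univ fun _ _ => isOpen_Ioo (a := a) (b := b))
    (Set.univ_pi_nonempty_iff.mpr fun _ => Set.nonempty_Ioo.mpr hab)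
    fun v hv i => ha.trans_lt (hv i (Set.mem_univ i)).1
  exact ⟨v, fun i => hv i (Set.mem_univ i), hp⟩

/- By Fubini the integral over `γ` converges at `t + ∑ l_a log v_a` for almost every `v`; a `v` with
all `v_a < 1` and one with all `v_a > 1` place `t` on a segment between two such points. -/
theorem integrable_cpIntegrand_of_ciIntegrand (hγ : ContDiff ℝ 1 γ) {t : ℂ}
    (h : IntegrableOn (ciIntegrand w l lam ħ γ t) (Set.univ ×ˢ orthant n)) :
    Integrable (cpIntegrand w ħ γ t) := by
  have ae_integrable : ∀ᵐ v ∂(volume : Measure (Fin n → ℝ)).restrict (orthant n),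
      Integrable (cpIntegrand w ħ γ (t + ((∑ a, (l a : ℝ) * Real.log (v a) : ℝ) : ℂ))) := by
    filter_upwards [(integrable_prod_of_integrableOn_ciIntegrand h).prod_left_ae] with v hv
    push_cast
    exact (hv.const_mul (orthantWeight lam ħ v)⁻¹).congr
      (Eventually.of_forall fun y => inv_mul_cancel_left₀ (Complex.exp_ne_zero _) _)
  obtain ⟨v₁, hv₁, hint₁⟩ :=
    exists_mem_Ioo_of_ae_restrict_orthant ae_integrable le_rfl one_pos
  obtain ⟨v₂, hv₂, hint₂⟩ :=
    exists_mem_Ioo_of_ae_restrict_orthant ae_integrable zero_le_one one_lt_two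
  refine integrable_cpIntegrand_of_segment hγ ?_ ?_ hint₁ hint₂
  · exact Finset.sum_nonpos fun a _ => mul_nonpos_of_nonneg_of_nonpos (Nat.cast_nonneg _)
      (Real.log_nonpos (hv₁ a).1.le (hv₁ a).2.le)
  · exact Finset.sum_nonneg fun a _ => mul_nonneg (Nat.cast_nonneg _)
      (Real.log_nonneg (hv₂ a).1.le)

end CompleteIntersection

end MirrorGKZ

theorem mainTheorem2 (k : ℕ) (w : Fin (k + 1) → ℂ) (ħ : ℂ) (hħ : ħ ≠ 0) (t₀ : ℂ)
    (c : Fin k → ℂ) (γ : EuclideanSpace ℝ (Fin k) → (Fin k → ℂ))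
    (hγ : MirrorGKZ.IsLefschetzThimble (MirrorGKZ.cpPotential w t₀) ħ c γ) :
    -- projective space: the integral over the thimble, wherever it converges
    (∀ U : Set ℂ, IsOpen U →
      (∀ t ∈ U, MeasureTheory.Integrable (MirrorGKZ.cpIntegrand w ħ γ t)) →
      DifferentiableOn ℂ (MirrorGKZ.cpIntegral w ħ γ) U ∧
        ∀ t ∈ U, MirrorGKZ.cpGKZ w ħ (MirrorGKZ.cpIntegral w ħ γ) t = 0) ∧
    -- complete intersections
    (∀ (n : ℕ) (l : Fin n → ℕ) (lam : Fin n → ℂ), (∀ a, 0 < l a) → ∑ a, l a < k + 1 →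
      0 < ħ.re →
      ∀ D : Set ℂ, IsOpen D → IsPreconnected D → (∀ t ∈ D, ∀ σ : ℝ, t + (σ : ℂ) ∈ D) →
        -- the Laplace transform of the (analytically continued) integral of projective space
        (∀ F : ℂ → ℂ, DifferentiableOn ℂ F D →
          (∃ U : Set ℂ, U ⊆ D ∧ IsOpen U ∧ U.Nonempty ∧
            ∀ t ∈ U, MeasureTheory.Integrable (MirrorGKZ.cpIntegrand w ħ γ t) ∧
              F t = MirrorGKZ.cpIntegral w ħ γ t) →
          (∀ t ∈ D, MeasureTheory.IntegrableOn (MirrorGKZ.laplaceIntegrand l lam ħ F t)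
            (MirrorGKZ.orthant n)) →
          DifferentiableOn ℂ (MirrorGKZ.ciLaplace l lam ħ F) D ∧
            ∀ t ∈ D, MirrorGKZ.ciGKZ w l lam ħ (MirrorGKZ.ciLaplace l lam ħ F) t = 0) ∧
        -- the integral over the product of the thimble and the positive orthant
        ((∀ t ∈ D, MeasureTheory.IntegrableOn (MirrorGKZ.ciIntegrand w l lam ħ γ t)
            (Set.univ ×ˢ MirrorGKZ.orthant n)) →
          (∀ t ∈ D, MirrorGKZ.ciIntegral w l lam ħ γ t =
            MirrorGKZ.ciLaplace l lam ħ (MirrorGKZ.cpIntegral w ħ γ) t) ∧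
          DifferentiableOn ℂ (MirrorGKZ.ciIntegral w l lam ħ γ) D ∧
            ∀ t ∈ D, MirrorGKZ.ciGKZ w l lam ħ (MirrorGKZ.ciIntegral w l lam ħ γ) t = 0)) := by
  have hγ₁ : ContDiff ℝ 1 γ := contDiff_infty.mp hγ.smooth 1
  refine ⟨fun U hU hint => ⟨MirrorGKZ.differentiableOn_cpIntegral hγ₁ hU hint,
    hγ.cpGKZ_cpIntegral hħ hU hint⟩, fun n l lam hl hlk hre D hD hDc hDr =>
    ⟨fun F hF ⟨U, hUD, hU, hUne, hFU⟩ hint => ?_, fun hint => ?_⟩⟩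
  · have hGKZ : ∀ t ∈ D, MirrorGKZ.cpGKZ w ħ F t = 0 :=
      MirrorGKZ.cpGKZ_eq_zero_of_eqOn hD hDc hF hUD hU hUne (fun t ht => (hFU t ht).2)
        (hγ.cpGKZ_cpIntegral hħ hU fun t ht => (hFU t ht).1)
    exact ⟨MirrorGKZ.differentiableOn_ciLaplace hre hl hlk hD hDr hF hGKZ hint,
      MirrorGKZ.ciGKZ_ciLaplace hre hl hlk hD hDr hF hGKZ hint⟩
  · have hcp := fun t ht => MirrorGKZ.integrable_cpIntegrand_of_ciIntegrand hγ₁ (hint t ht)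
    have hF := MirrorGKZ.differentiableOn_cpIntegral hγ₁ hD hcp
    have hGKZ := hγ.cpGKZ_cpIntegral hħ hD hcp
    have hlaplace := fun t ht =>
      MirrorGKZ.integrableOn_laplaceIntegrand_of_ciIntegrand (hint t ht)
    have heq : Set.EqOn _ _ D := fun t ht => MirrorGKZ.ciIntegral_eq_ciLaplace (hint t ht)
    exact ⟨heq, (MirrorGKZ.differentiableOn_ciLaplace hre hl hlk hD hDr hF hGKZ hlaplace).congr heq,
      fun t ht => (MirrorGKZ.ciGKZ_congr hD heq ht).trans
        (MirrorGKZ.ciGKZ_ciLaplace hre hl hlk hD hDr hF hGKZ hlaplace t ht)⟩
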